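/- **Setting.** Let $m,\omega>0$ and let $U:\mathbb R\to\mathbb R$ be smooth. Write $\kappa(q)=1+\frac{U''(q)}{m\omega^2}$ and let $M=\{(q,p)\in\mathbb R^2:\kappa(q)>0\}$. For a unit vector $\psi$ in $L^2(\mathbb R)$ (a Schwartz function) with $q=\langle\hat q\rangle$, $p=\langle\hat p\rangle$, $\hat p=-i\hbar\,d/dx$, the quantum variables are the Weyl-ordered (totally symmetrized) moments $G^{a,n}=\langle(\hat q-q)^{n-a}(\hat p-p)^a\rangle_{\rm Weyl}$, $0\le a\le n$. On the coordinates $q,p,G^{a,n}$ there is the Poisson bracket $\{q,p\}=1$, $\{q,G^{a,n}\}=\{p,G^{a,n}\}=0$ and, for $D(\alpha)=\langle e^{\alpha_q(\hat q-q)+\alpha_p(\hat p-p)}\rangle=\sum_{a,b}\frac{\alpha_q^b\alpha_p^a}{b!\,a!}G^{a,a+b}$ and $\alpha\times\beta=\alpha_q\beta_p-\alpha_p\beta_q$, $$\{D(\alpha),D(\beta)\}=\tfrac2\hbar\sin\!\big(\tfrac\hbar2\,\alpha\times\beta\big)D(\alpha+\beta)-(\alpha\times\beta)\,D(\alpha)D(\beta).$$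 The quantum Hamiltonian of a classical Hamiltonian $H(q,p)$ is the formal series $H_Q=\sum_{n\ge0}\sum_{a=0}^n\frac1{n!}\binom na\frac{\partial^nH}{\partial p^a\partial q^{n-a}}G^{a,n}$, with $G^{a,n}$ counted as being of order $\hbar^{n/2}$. **Adiabatic effective systems.** An adiabatic effective system of order $(e,k)$ for $H$ (of the classical dimension) is an open set $M\subset\mathbb R^2$ with smooth vector fields $X^\hbar_{\rm eff}$, $\hbar>0$, on it, together with formal series $G^{a,n}=\sum_{j\ge0,\,N\ge n}G^{a,n}_{j,N}(q,p)\,\lambda^j\hbar^{N/2}$ with smooth coefficients on $M$ and with $G^{0,0}=1$, $G^{0,1}=G^{1,1}=0$, such that: 1. the $G^{a,n}$ are an adiabatic solution: with $\dot x^i=\{x^i,H_Q\}$ for $(x^1,x^2)=(q,p)$, $$\lambda\,\dot x^i\,\partial_iG^{a,n}=\{G^{a,n},H_Q\}$$ holds in every order of $\lambda$ and in all orders of $\hbar$ below $\hbar^{k+1}$, and for each $n$ at least up to the order $\hbar^{n/2}$; 2. at each point of $M$, $X_{\rm eff}^\hbar=(\{q,H_Q\},\{p,H_Q\})+O(\hbar^{k+1})$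 as $\hbar\to0^+$, where the adiabatic solution is inserted, the result is truncated after $\lambda^e$ and below $\hbar^{k+1}$, and $\lambda$ is set to $1$; 3. up to order $e$ the solution is realized in the space of states: there are Schwartz functions $\psi_{\lambda,\hbar,(q,p)}$ such that, near each point of $M$, for every $\hbar>0$ and all $\lambda$ close to $0$, they are unit vectors with expectation values $(q,p)$ and with quantum variables that are smooth in $(q,p)$; and for all $a,n$ the coefficient of each $\lambda^j$, $j\le e$, in the expansion of $G^{a,n}(\psi_{\lambda,\hbar,(q,p)})$ up to $O(\lambda^{e+1})$ is $\sum_{N\le K}G^{a,n}_{j,N}(q,p)\hbar^{N/2}+O(\hbar^{(K+1)/2})$ as $\hbar\to0^+$, with $K=\max(2k+1,n)$. **Theorem.** Let $m,\omega>0$. To every smooth $U$ one can assign an adiabatic effective system of order $(2,1)$ for $$H=\frac{p^2}{2m}+\frac12m\omega^2q^2+U(q)$$ on $M=\{(q,p):\kappa(q)>0\}$, in such a way that: * (vacuum) when $U$ is replaced by $\tau U$ and $\tau\to0$, then at each point and for $j\le2$ the coefficients $G^{a,n}_{j,N}$ converge to those of the vacuum of the harmonic oscillator, that is, to $0$ unless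 $j=0$, $N=n$ and $a,n$ are even, and in that case to $(m\omega)^{a-n/2}\,\frac{1}{2^n}\frac{a!}{(a/2)!}\frac{(n-a)!}{((n-a)/2)!}$; * (dynamics) for every $\hbar>0$, every open time interval $(t_0,t_1)$ and every function $q$, there is a $p$ such that $(q,p)$ is an integral curve of $X^\hbar_{\rm eff}$ in $M$ on $(t_0,t_1)$ if and only if $q$ is $C^2$ there, $\kappa(q(t))>0$, and $q$ is a stationary point, under smooth compactly supported variations, of the effective action $$\Gamma_{\rm eff}[q]=\int dt\left[\frac12\left(m+\frac{\hbar\,U'''(q)^2}{2^5m^2\left(\omega^2+m^{-1}U''(q)\right)^{5/2}}\right)\dot q^2-\frac12m\omega^2q^2-U(q)-\frac{\hbar\omega}2\left(1+\frac{U''(q)}{m\omega^2}\right)^{1/2}\right].$$ -/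

import Mathlib

open scoped ContDiff SchwartzMap Topology

noncomputable section

namespace AnharmonicEff

/-! ### States, expectation values and quantum variables on `L²(ℝ)` -/

/-- The centred position operator `q̂ - q`. -/
def centredQ (q : ℝ) (f : ℝ → ℂ) : ℝ → ℂ := fun x => ((x - q : ℝ) : ℂ) * f x

/-- The centred momentum operator `p̂ - p`, with `p̂ = -iℏ d/dx`. -/
def centredP (hbar p : ℝ) (f : ℝ → ℂ) : ℝ → ℂ :=
  fun x => -(Complex.I * (hbar : ℂ)) * deriv f x - (p : ℂ) * f x

/-- The inner product of `L²(ℝ, ℂ)`, conjugate linear in the first slot. -/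
def braket (f g : ℝ → ℂ) : ℂ := ∫ x, (starRingEnd ℂ) (f x) * g x

/-- The expectation value `q = ⟨q̂⟩`. -/
def meanQ (f : ℝ → ℂ) : ℝ := (braket f (centredQ 0 f)).re

/-- The expectation value `p = ⟨p̂⟩`. -/
def meanP (hbar : ℝ) (f : ℝ → ℂ) : ℝ := (braket f (centredP hbar 0 f)).re

/-- An operator word of length `n` in the centred operators, applied to `f`: the `i`-th letter
is `p̂ - p` if `i ∈ s` and `q̂ - q` otherwise. -/
def wordOp (hbar q p : ℝ) {n : ℕ} (s : Finset (Fin n)) (f : ℝ → ℂ) : ℝ → ℂ :=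
  (List.ofFn fun i : Fin n => decide (i ∈ s)).foldr
    (fun isP g => if isP then centredP hbar p g else centredQ q g) f

/-- The quantum variable `⟨(q̂ - q)^b (p̂ - p)^a⟩` in Weyl (totally symmetric) order, i.e. `G^{a,n}`
with `n = b + a`: the average over all words with `b` letters `q̂ - q` and `a` letters
`p̂ - p`. -/
def quantumVariable (hbar : ℝ) (f : ℝ → ℂ) (b a : ℕ) : ℝ :=
  (((Nat.choose (b + a) a : ℕ) : ℂ)⁻¹ *
    ∑ s ∈ Finset.powersetCard a (Finset.univ : Finset (Fin (b + a))),
      braket f (wordOp hbar (meanQ f) (meanP hbar f) s f)).re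

/-! ### Expansions in `ℏ^{1/2}` and in the adiabatic parameter -/

/-- Formal expansions: the outer variable is `s = ℏ^{1/2}`, the inner one is the adiabatic
parameter. -/
abbrev Expansion : Type := PowerSeries (PowerSeries ℝ)

/-- The coefficient of `(ℏ^{1/2})^N` times the `j`-th power of the adiabatic parameter. -/
def cf (j N : ℕ) (f : Expansion) : ℝ := PowerSeries.coeff j (PowerSeries.coeff N f)

/-- Planck's constant `ℏ = s²` as a formal variable. -/
def formalHbar : Expansion := PowerSeries.X ^ 2

/-- The adiabatic parameter as a formal variable. -/
def adiab : Expansion := PowerSeries.C PowerSeries.X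

/-- Truncation at order `e` of the adiabatic expansion, with the adiabatic parameter then set
to `1`, and at order `K` in `ℏ^{1/2}`, evaluated at the number `ℏ = hbar`. -/
def truncEval (e K : ℕ) (hbar : ℝ) (f : Expansion) : ℝ :=
  ∑ j ∈ Finset.range (e + 1), ∑ N ∈ Finset.range (K + 1), cf j N f * Real.sqrt hbar ^ N

/-- The `s`-adically convergent sum `∑_{d,c} f d c` of a family in which `f d c` is divisible by
`s^{d+c-2}`, so that only `d + c ≤ N + 2` contributes to the coefficient of `s^N`. -/
def formalSum (f : ℕ → ℕ → Expansion) : Expansion :=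
  PowerSeries.mk fun N => ∑ l ∈ Finset.range (N + 3),
    ∑ d ∈ Finset.range (l + 1), PowerSeries.coeff N (f d (l - d))

/-! ### Poisson structure and quantum Hamiltonian in the coordinates `q, p, G`

A family `G b a` lists the quantum variables `⟨(q̂ - q)^b (p̂ - p)^a⟩_Weyl`. -/

/-- The Poisson bracket of the quantum variables `G b a` and `G d c`, i.e. the coefficient
extraction from
`{D(α), D(β)} = (2/ℏ) sin (ℏ/2 α×β) D(α+β) - (α×β) D(α) D(β)`, where
`D(α) = ⟨exp (α_q (q̂ - q) + α_p (p̂ - p))⟩ = ∑ G b a α_q^b α_p^a / (b! a!)` and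
`α×β = α_q β_p - α_p β_q`. Equivalently, it is `⟨[·,·]⟩/(iℏ)` for the corresponding Weyl ordered
operators, corrected for the state dependence of `q` and `p`. -/
def momentBracket (G : ℕ → ℕ → Expansion) (b a d c : ℕ) : Expansion :=
  (∑ r ∈ Finset.range (b + a + 1), ∑ i ∈ Finset.range (2 * r + 2),
    ((-1 : ℝ) ^ (r + i) / (2 ^ (2 * r) * (i.factorial : ℝ) * ((2 * r + 1 - i).factorial : ℝ)) *
        ((b.descFactorial (2 * r + 1 - i) : ℝ) * (a.descFactorial i : ℝ) *
          (c.descFactorial (2 * r + 1 - i) : ℝ) * (d.descFactorial i : ℝ))) •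
      (formalHbar ^ (2 * r) * G (b + d - (2 * r + 1)) (a + c - (2 * r + 1))))
  - (((b : ℝ) * (c : ℝ)) • (G (b - 1) a * G d (c - 1))
      - ((a : ℝ) * (d : ℝ)) • (G b (a - 1) * G (d - 1) c))

/-- The mixed partial derivative `∂^{d+c} H / ∂q^d ∂p^c` at `(q, p)`. -/
def mixedDeriv (H : ℝ → ℝ → ℝ) (d c : ℕ) (x : ℝ × ℝ) : ℝ :=
  iteratedDeriv d (fun q => iteratedDeriv c (fun p => H q p) x.2) x.1

/-- `{q, H_Q}` for the quantum Hamiltonian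
`H_Q = ⟨H(q̂, p̂)⟩_Weyl = ∑_{d,c} (∂_q^d ∂_p^c H)(q,p) / (d! c!) G d c`, using
`{q, p} = 1` and `{q, G} = {p, G} = 0`. -/
def flowQ (H : ℝ → ℝ → ℝ) (x : ℝ × ℝ) (G : ℕ → ℕ → Expansion) : Expansion :=
  formalSum fun d c =>
    (mixedDeriv H d (c + 1) x / ((d.factorial : ℝ) * (c.factorial : ℝ))) • G d c

/-- `{p, H_Q}`. -/
def flowP (H : ℝ → ℝ → ℝ) (x : ℝ × ℝ) (G : ℕ → ℕ → Expansion) : Expansion :=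
  -formalSum fun d c =>
    (mixedDeriv H (d + 1) c x / ((d.factorial : ℝ) * (c.factorial : ℝ))) • G d c

/-- `{G b a, H_Q}`. -/
def flowG (H : ℝ → ℝ → ℝ) (x : ℝ × ℝ) (G : ℕ → ℕ → Expansion) (b a : ℕ) : Expansion :=
  formalSum fun d c =>
    (mixedDeriv H d c x / ((d.factorial : ℝ) * (c.factorial : ℝ))) • momentBracket G b a d c

/-- Coefficientwise `∂/∂q`. -/
def partialQ (f : ℝ × ℝ → Expansion) (x : ℝ × ℝ) : Expansion :=
  PowerSeries.mk fun N => PowerSeries.mk fun j => deriv (fun q => cf j N (f (q, x.2))) x.1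

/-- Coefficientwise `∂/∂p`. -/
def partialP (f : ℝ × ℝ → Expansion) (x : ℝ × ℝ) : Expansion :=
  PowerSeries.mk fun N => PowerSeries.mk fun j => deriv (fun p => cf j N (f (x.1, p))) x.2

/-! ### Adiabatic effective systems -/

/-- A dynamical system of the classical dimension together with an expansion of the quantum
variables over it and with states that realize this expansion. -/
structure EffectiveData where
  /-- the effective manifold, with coordinates `(q, p)` -/
  M : Set (ℝ × ℝ)
  /-- the effective vector field, depending on `ℏ` -/
  X : ℝ → ℝ × ℝ → ℝ × ℝ
  /-- the quantum variables `G b a` as expansions with coefficients that are functions of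
  `(q, p)` -/
  G : ℝ × ℝ → ℕ → ℕ → Expansion
  /-- the state at `(q, p)`, depending on the adiabatic parameter and on `ℏ` -/
  state : ℝ → ℝ → ℝ × ℝ → 𝓢(ℝ, ℂ)

/-- The order in `ℏ^{1/2}` up to which `G^{a,n}` is considered: all orders below `ℏ^{k+1}`, and in
any case the leading order `ℏ^{n/2}`. -/
def momentOrder (k n : ℕ) : ℕ := max (2 * k + 1) n

/-- An adiabatic effective system of order `(e, k)` for the quantum system with classical
Hamiltonian `H`. -/
structure IsAdiabaticEffectiveSystem (e k : ℕ) (H : ℝ → ℝ → ℝ) (S : EffectiveData) : Prop where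
  isOpen_M : IsOpen S.M
  smooth_X : ∀ hbar > 0, ContDiffOn ℝ ∞ (S.X hbar) S.M
  smooth_G : ∀ b a j N, ContDiffOn ℝ ∞ (fun x => cf j N (S.G x b a)) S.M
  /-- normalization, and `⟨q̂ - q⟩ = ⟨p̂ - p⟩ = 0` -/
  G_zero : ∀ x ∈ S.M, S.G x 0 0 = 1 ∧ S.G x 1 0 = 0 ∧ S.G x 0 1 = 0
  /-- semiclassicality: `G^{a,n}` is of order `ℏ^{n/2}` -/
  G_order : ∀ x ∈ S.M, ∀ b a, (PowerSeries.X : Expansion) ^ (b + a) ∣ S.G x b a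
  /-- The quantum variables are an adiabatic solution: `ẋ^i ∂_i G = {G, H_Q}` with `d/dt`
  multiplied by the adiabatic parameter, in every order of that parameter. -/
  adiabatic : ∀ x ∈ S.M, ∀ b a j N, N ≤ momentOrder k (b + a) →
    cf j N (adiab * (flowQ H x (S.G x) * partialQ (fun y => S.G y b a) x +
        flowP H x (S.G x) * partialP (fun y => S.G y b a) x))
      = cf j N (flowG H x (S.G x) b a)
  /-- The effective flow agrees, up to `O(ℏ^{k+1})`, with the quantum flow of `q` and `p` in which
  the adiabatic solution up to order `e` has been inserted. -/
  almost_preserved : ∀ x ∈ S.M,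
    ((fun hbar => (S.X hbar x).1 - truncEval e (2 * k + 1) hbar (flowQ H x (S.G x)))
      =O[𝓝[>] 0] fun hbar => hbar ^ (k + 1)) ∧
    ((fun hbar => (S.X hbar x).2 - truncEval e (2 * k + 1) hbar (flowP H x (S.G x)))
      =O[𝓝[>] 0] fun hbar => hbar ^ (k + 1))
  /-- The points of the system are states: unit vectors with expectation values `(q, p)`, -/
  state_mem : ∀ x₀ ∈ S.M, ∀ hbar > 0, ∀ᶠ l in 𝓝 (0 : ℝ), ∀ᶠ x in 𝓝 x₀,
    braket (S.state l hbar x) (S.state l hbar x) = 1 ∧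
      meanQ (S.state l hbar x) = x.1 ∧ meanP hbar (S.state l hbar x) = x.2
  /-- whose quantum variables depend smoothly on `(q, p)` -/
  state_smooth : ∀ x₀ ∈ S.M, ∀ hbar > 0, ∀ᶠ l in 𝓝 (0 : ℝ), ∀ b a,
    ContDiffAt ℝ ∞ (fun x => quantumVariable hbar (S.state l hbar x) b a) x₀
  /-- and are given by the adiabatic solution up to order `e`. -/
  state_G : ∀ x ∈ S.M, ∀ b a, ∃ g : ℕ → ℝ → ℝ,
    (∀ hbar > 0, (fun l => quantumVariable hbar (S.state l hbar x) b a -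
        ∑ j ∈ Finset.range (e + 1), g j hbar * l ^ j) =O[𝓝 0] fun l => l ^ (e + 1)) ∧
    ∀ j ≤ e, (fun hbar => g j hbar -
        ∑ N ∈ Finset.range (momentOrder k (b + a) + 1), cf j N (S.G x b a) * Real.sqrt hbar ^ N)
      =O[𝓝[>] 0] fun hbar => Real.sqrt hbar ^ (momentOrder k (b + a) + 1)

/-! ### The anharmonic oscillator and its effective action -/

/-- `H = p²/2m + m om² q²/2 + U(q)`. -/
def hamiltonian (m om : ℝ) (U : ℝ → ℝ) (q p : ℝ) : ℝ :=
  p ^ 2 / (2 * m) + m * om ^ 2 * q ^ 2 / 2 + U q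

/-- `1 + U''(q) / (m om²)`. -/
def stiffness (m om : ℝ) (U : ℝ → ℝ) (q : ℝ) : ℝ := 1 + iteratedDeriv 2 U q / (m * om ^ 2)

/-- The integrand of the effective action. -/
def effLagrangian (m om : ℝ) (U : ℝ → ℝ) (hbar q v : ℝ) : ℝ :=
  (m + hbar * iteratedDeriv 3 U q ^ 2 /
      (2 ^ 5 * m ^ 2 * (om ^ 2 + iteratedDeriv 2 U q / m) ^ (5 / 2 : ℝ))) * v ^ 2 / 2
    - m * om ^ 2 * q ^ 2 / 2 - U q
    - hbar * om / 2 * (stiffness m om U q) ^ (1 / 2 : ℝ)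

/-- The effective action of the curve `q` over the time interval `[c, d]`. -/
def effAction (m om : ℝ) (U : ℝ → ℝ) (hbar c d : ℝ) (q : ℝ → ℝ) : ℝ :=
  ∫ t in c..d, effLagrangian m om U hbar (q t) (deriv q t)

/-- `δΓ_eff/δq = 0` on the time interval `(t₀, t₁)`: the first variation vanishes for all smooth
variations with compact support in it. -/
def IsStationary (m om : ℝ) (U : ℝ → ℝ) (hbar t₀ t₁ : ℝ) (q : ℝ → ℝ) : Prop :=
  ∀ c d, t₀ < c → c < d → d < t₁ → ∀ η : ℝ → ℝ, ContDiff ℝ ∞ η → tsupport η ⊆ Set.Ioo c d →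
    HasDerivAt (fun ε : ℝ => effAction m om U hbar c d (fun t => q t + ε * η t)) 0 0

/-- The curve `t ↦ (q t, p t)` is an integral curve of the effective vector field on
`(t₀, t₁)`. -/
def IsEffectiveMotion (S : EffectiveData) (hbar t₀ t₁ : ℝ) (q p : ℝ → ℝ) : Prop :=
  ∀ t ∈ Set.Ioo t₀ t₁, (q t, p t) ∈ S.M ∧
    HasDerivAt (fun u => (q u, p u)) (S.X hbar (q t, p t)) t

/-- The quantum variable `⟨(q̂ - q)^b (p̂ - p)^a⟩_Weyl` of the harmonic-oscillator vacuum, and of its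
coherent states, divided by `ℏ^{(b+a)/2}`. -/
def vacuumMoment (m om : ℝ) (b a : ℕ) : ℝ :=
  if Even b ∧ Even a then
    (m * om) ^ (((a : ℝ) - (b : ℝ)) / 2) * ((a.factorial : ℝ) * (b.factorial : ℝ)) /
      (2 ^ (b + a) * (((a / 2).factorial : ℝ) * ((b / 2).factorial : ℝ)))
  else 0

end AnharmonicEff

end

/-! Put `w² = ω² + U''/m` and `V = mω²q²/2 + U`, and look for moments `G b a = ℏ^{(b+a)/2} g b a`.
The Poisson bracket lowers the order in `ℏ^{1/2}` by two, so in leading order only the quadratic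
part of the Hamiltonian acts on the moments. The equation for `g` is then linear: along the
classical flow the moments move like those of an oscillator of frequency `w(q)`. The remaining
orders that have to be checked vanish, by parity or because the moment has degree at most one.

A linear symplectic flow maps Gaussians to Gaussians. Hence it suffices to solve for the covariances
`Y, C, P` and to insert them into the universal polynomials `gaussMoment` (`gaussMoment_flow`,
`momentSeries_transport`). Two of the covariance equations define `C` and `P` in terms of `Y`. The
third follows from conservation of `YP - C²`. Requiring `YP - C² = 1/4`, the value for pure
Gaussians, turns the problem into an algebraic recursion for the coefficients of `Y` in the
adiabatic parameter and fixes all integration constants (`varianceSeries_mul_momentumSeries`,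
`momentumSeries_transport`).

The same relation realizes the solution by states. A wave packet annihilated by `(p̂ - p) - z (q̂ -
q)`, with `Im z > 0`, has Gaussian Weyl moments (`weylSum_gaussian`), and its momentum variance is
`(1/4 + C²)/Y` in units of `ℏ`. If its `Y` and `C` are the second order truncations of the series,
division shows that all its moments agree with the series up to second order
(`div_mem_expansionRing`).

Inserting `Y` into `ṗ = -V' - U''' G 2 0 / 2` gives, to first order in `ℏ`, the Euler-Lagrange
equation of `A(q) q̇²/2 - B(q)` with `A = m + ℏ w'²/(8w³)` and `B = V + ℏ w/2`: the zeroth adiabatic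
order gives the zero-point energy, the second order the effective mass. The effective vector field
is taken to be the exact Euler-Lagrange field, which differs from the inserted one by `O(ℏ²)`
(`oscillator_almost_preserved`), so that the equivalence with the action principle is exact
(`exists_integralCurve_iff`, `stationary_iff_eulerLagrange`).

Since moments are polynomials in the covariances, smoothness, expansions and the limit `τ → 0` are
all treated alike: the property in question defines a subring, and the covariances lie in it
(`gaussMoment_mem`). -/

noncomputable section

namespace AnharmonicEff

/-! ### Moments of a centred Gaussian -/

section GaussMoment

variable {R : Type*} [CommRing R]

/-- The moments `E[x^b y^a]` of a centred Gaussian pair with covariances `E[x²] = Y`, `E[xy] = C`,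
`E[y²] = P`, over an arbitrary commutative ring. -/
def gaussMoment (Y C P : R) : ℕ → ℕ → R
  | 0, 0 => 1
  | 0, 1 => 0
  | 0, a + 2 => ((a : R) + 1) * P * gaussMoment Y C P 0 a
  | 1, a => (a : R) * C * gaussMoment Y C P 0 (a - 1)
  | b + 2, a => ((b : R) + 1) * Y * gaussMoment Y C P b a +
      (a : R) * C * gaussMoment Y C P (b + 1) (a - 1)
termination_by b a => (b, a)

variable (Y C P : R)

@[simp] lemma gaussMoment_zero_zero : gaussMoment Y C P 0 0 = 1 := by rw [gaussMoment]

@[simp] lemma gaussMoment_zero_one : gaussMoment Y C P 0 1 = 0 := by rw [gaussMoment]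

@[simp] lemma gaussMoment_one_zero : gaussMoment Y C P 1 0 = 0 := by rw [gaussMoment]; simp

/-- Gaussian integration by parts in `x`, uniformly in the indices: the factors `b` and `a` vanish
exactly where the truncated subtraction would give a wrong index. -/
lemma gaussMoment_succ_left (b a : ℕ) : gaussMoment Y C P (b + 1) a =
    (b : R) * Y * gaussMoment Y C P (b - 1) a + (a : R) * C * gaussMoment Y C P b (a - 1) := by
  cases b with
  | zero => rw [gaussMoment]; simp
  | succ b => rw [gaussMoment]; push_cast; simp

/-- Integration by parts in `y`. The definition pairs off an `x` whenever there is one, so this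
symmetric rule is not definitional: it is the consistency of the two ways of contracting. -/
lemma gaussMoment_succ_right (b a : ℕ) : gaussMoment Y C P b (a + 1) =
    (b : R) * C * gaussMoment Y C P (b - 1) a + (a : R) * P * gaussMoment Y C P b (a - 1) := by
  have h0 : ∀ a : ℕ, gaussMoment Y C P 0 (a + 1) = (a : R) * P * gaussMoment Y C P 0 (a - 1) := by
    intro a
    cases a with
    | zero => simp
    | succ a => rw [gaussMoment]; push_cast; simp
  induction b using Nat.strong_induction_on generalizing a with
  | _ b ih =>
    match b with
    | 0 => simpa using h0 a
    | 1 =>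
      have e1 := gaussMoment_succ_left Y C P 0 (a + 1)
      have e2 := gaussMoment_succ_left Y C P 0 (a - 1)
      have e3 := h0 (a - 1)
      cases a with
      | zero => simp at *; linear_combination e1
      | succ a =>
        simp at *
        rw [e1, e2]
        linear_combination ((a : R) + 1) * C * e3
    | b + 2 =>
      have e1 := gaussMoment_succ_left Y C P (b + 1) (a + 1)
      have e2 := gaussMoment_succ_left Y C P (b + 1) (a - 1)
      have e3 := gaussMoment_succ_left Y C P b a
      have e4 := ih b (by omega) a
      have e5 := ih (b + 1) (by omega) (a - 1)
      cases a with
      | zero =>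
        simp at *
        linear_combination e1 + ((b : R) + 1) * Y * e4 - (b + 1) * C * e3
      | succ a =>
        simp at *
        linear_combination e1 + ((b : R) + 1) * Y * e4 - (b + 1) * C * e3 +
          ((a : R) + 1) * C * e5 - ((a : R) + 1) * P * e2

lemma gaussMoment_eq_zero_of_odd (b a : ℕ) (h : Odd (b + a)) : gaussMoment Y C P b a = 0 := by
  induction hn : b + a using Nat.strong_induction_on generalizing b a with
  | _ n ih =>
    match b, a with
    | 0, 0 => simp at h
    | 0, 1 => simp
    | 0, a + 2 =>
      rw [gaussMoment_succ_right]
      have : Odd (0 + a) := by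
        rw [Nat.odd_iff] at *; omega
      simp [ih (0 + a) (by omega) 0 a this rfl]
    | 1, 0 => simp
    | 1, a + 1 =>
      rw [gaussMoment_succ_left]
      have : Odd (0 + a) := by
        rw [Nat.odd_iff] at *; omega
      simp [ih (0 + a) (by omega) 0 a this rfl]
    | b + 2, 0 =>
      rw [gaussMoment_succ_left]
      have : Odd (b + 0) := by
        rw [Nat.odd_iff] at *; omega
      simp [ih (b + 0) (by omega) b 0 this rfl]
    | b + 2, a + 1 =>
      rw [gaussMoment_succ_left]
      have h1 : Odd (b + (a + 1)) := by
        rw [Nat.odd_iff] at *; omega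
      have h2 : Odd (b + 1 + a) := by
        rw [Nat.odd_iff] at *; omega
      simp [ih _ (by omega) b (a + 1) h1 rfl, ih _ (by omega) (b + 1) a h2 rfl]

/-- A subring that contains the covariances contains all moments. -/
lemma gaussMoment_mem (S : Subring R) (hY : Y ∈ S) (hC : C ∈ S) (hP : P ∈ S) (b a : ℕ) :
    gaussMoment Y C P b a ∈ S := by
  have hN : ∀ n : ℕ, (n : R) ∈ S := fun n => natCast_mem S n
  induction b, a using gaussMoment.induct with
  | case1 => simp
  | case2 => simp
  | case3 a ih =>
    rw [gaussMoment]
    exact S.mul_mem (S.mul_mem (S.add_mem (hN _) S.one_mem) hP) ih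
  | case4 a ih =>
    rw [gaussMoment]
    exact S.mul_mem (S.mul_mem (hN _) hC) ih
  | case5 b a ih1 ih2 =>
    rw [gaussMoment]
    exact S.add_mem (S.mul_mem (S.mul_mem (S.add_mem (hN _) S.one_mem) hY) ih1)
      (S.mul_mem (S.mul_mem (hN _) hC) ih2)

/-- The moments are polynomials in `Y, C, P` with natural number coefficients, hence commute with
ring homomorphisms. The homomorphisms used later are evaluation at a point, projections of products,
constant series, and the embedding of the reals in the complex numbers. -/
lemma map_gaussMoment {T : Type*} [CommRing T] (φ : R →+* T) (b a : ℕ) :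
    φ (gaussMoment Y C P b a) = gaussMoment (φ Y) (φ C) (φ P) b a := by
  induction b, a using gaussMoment.induct with
  | case1 => simp
  | case2 => simp
  | case3 a ih => rw [gaussMoment, gaussMoment, ← ih]; simp
  | case4 a ih => rw [gaussMoment, gaussMoment, ← ih]; simp
  | case5 b a ih1 ih2 => rw [gaussMoment, gaussMoment, ← ih1, ← ih2]; simp

/-- Rescaling of the covariances. -/
lemma gaussMoment_smul (s : R) (b a : ℕ) :
    gaussMoment (s ^ 2 * Y) (s ^ 2 * C) (s ^ 2 * P) b a = s ^ (b + a) * gaussMoment Y C P b a := by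
  induction b, a using gaussMoment.induct with
  | case1 => simp
  | case2 => simp
  | case3 a ih => rw [gaussMoment, gaussMoment, ih, Nat.succ_eq_add_one]; ring
  | case4 a ih =>
    rw [gaussMoment, gaussMoment, ih]
    cases a with
    | zero => simp
    | succ a => simp only [Nat.add_sub_cancel]; ring
  | case5 b a ih1 ih2 =>
    rw [gaussMoment, gaussMoment, ih1, ih2]
    cases a with
    | zero => simp; ring
    | succ a => simp only [Nat.add_sub_cancel, Nat.succ_eq_add_one]; ring

/-- Under a linear symplectic flow of the covariances, a derivation acts on the moments as that
flow. -/
lemma gaussMoment_flow (u f dY dC dP : R) (δ : ℕ → ℕ → R)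
    (hY : dY = 2 * u * C) (hC : dC = u * P - f * Y) (hP : dP = -2 * f * C)
    (h00 : δ 0 0 = 0) (h01 : δ 0 1 = 0)
    (h0 : ∀ a, δ 0 (a + 2) = ((a : R) + 1) * (dP * gaussMoment Y C P 0 a + P * δ 0 a))
    (h1 : ∀ a, δ 1 a = (a : R) * (dC * gaussMoment Y C P 0 (a - 1) + C * δ 0 (a - 1)))
    (h2 : ∀ b a, δ (b + 2) a = ((b : R) + 1) * (dY * gaussMoment Y C P b a + Y * δ b a) +
      (a : R) * (dC * gaussMoment Y C P (b + 1) (a - 1) + C * δ (b + 1) (a - 1))) (b a : ℕ) :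
    δ b a = u * b * gaussMoment Y C P (b - 1) (a + 1) - f * a * gaussMoment Y C P (b + 1) (a - 1) := by
  -- The claim is that `δ` acts on `x^b y^a` as `u y ∂_x - f x ∂_y`. The Leibniz rule is assumed
  -- only along the defining recursion, so the induction follows that recursion.
  induction b, a using gaussMoment.induct with
  | case1 => simp [h00]
  | case2 => simp [h01]
  | case3 a ih =>
    rw [h0, ih, hP]
    have e1 := gaussMoment_succ_left Y C P 0 (a + 1)
    have e2 := gaussMoment_succ_left Y C P 0 (a - 1)
    have e3 := gaussMoment_succ_right Y C P 0 (a - 1)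
    cases a with
    | zero => simp at *; linear_combination (-2) * f * e1
    | succ a =>
      simp at *
      rw [e1, e2]
      linear_combination (f * (a + 1) * C * (a + 2)) * e3
  | case4 a ih =>
    rw [h1, ih, hC]
    have e1 := gaussMoment_succ_left Y C P 1 (a - 1)
    have e2 := gaussMoment_succ_left Y C P 0 (a - 1 - 1)
    have e3 := gaussMoment_succ_right Y C P 0 a
    cases a with
    | zero => simp at *
    | succ a =>
      simp at *
      linear_combination (-u) * e3 + f * (a + 1) * e1
  | case5 b a ih1 ih2 =>
    rw [h2, ih1, ih2, hC, hY]
    have e1 := gaussMoment_succ_right Y C P (b + 1) a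
    have e2 := gaussMoment_succ_left Y C P (b + 2) (a - 1)
    have e6 := gaussMoment_succ_left Y C P b (a + 1)
    cases a with
    | zero =>
      simp at *
      linear_combination (-(b + 1) * u) * e6 - u * e1
    | succ a =>
      simp at *
      linear_combination (-(b + 1) * u) * e6 - u * e1 + f * (a + 1) * e2

end GaussMoment

/-! ### Weyl ordered words -/

section Weyl

variable {V : Type*} [AddCommGroup V] [Module ℂ V]

/-- The sum over all words of length `n` with `a` letters `P` and `n - a` letters `Q`, applied
to `ψ`. -/
def weylSum (Q P : V →ₗ[ℂ] V) (ψ : V) : ℕ → ℕ → V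
  | 0, 0 => ψ
  | 0, _ + 1 => 0
  | n + 1, 0 => Q (weylSum Q P ψ n 0)
  | n + 1, a + 1 => Q (weylSum Q P ψ n (a + 1)) + P (weylSum Q P ψ n a)

/-- The word whose `i`-th letter is `P` if `i ∈ s` and `Q` otherwise, applied to `ψ`. -/
def letterWord (Q P : V →ₗ[ℂ] V) (ψ : V) {n : ℕ} (s : Finset (Fin n)) : V :=
  (List.ofFn fun i : Fin n => decide (i ∈ s)).foldr (fun isP g => if isP then P g else Q g) ψ

variable (Q P : V →ₗ[ℂ] V) (ψ : V)

lemma letterWord_map_succ {n : ℕ} (s : Finset (Fin n)) :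
    letterWord Q P ψ (s.map (Fin.succEmb n)) = Q (letterWord Q P ψ s) := by
  simp [letterWord, List.ofFn_succ]

lemma letterWord_insert_map_succ {n : ℕ} (s : Finset (Fin n)) :
    letterWord Q P ψ (insert 0 (s.map (Fin.succEmb n))) = P (letterWord Q P ψ s) := by
  simp [letterWord, List.ofFn_succ]

/-- A subset of `Fin (n + 1)` is split according to whether it contains `0`, that is, according to
the first letter of the word. -/
lemma sum_letterWord (n a : ℕ) :
    ∑ s ∈ Finset.powersetCard a (Finset.univ : Finset (Fin n)), letterWord Q P ψ s =
      weylSum Q P ψ n a := by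
  induction n generalizing a with
  | zero =>
    cases a with
    | zero => simp [weylSum, letterWord]
    | succ a =>
      rw [Finset.powersetCard_eq_empty.2 (by simp)]
      simp [weylSum]
  | succ n ih =>
    cases a with
    | zero =>
      have := ih 0
      simp only [Finset.powersetCard_zero, Finset.sum_singleton] at this ⊢
      rw [weylSum, ← this, ← letterWord_map_succ]
      simp
    | succ a =>
      have h0 : (0 : Fin (n + 1)) ∉ Finset.univ.map (Fin.succEmb n) := by
        simp [Fin.succ_ne_zero]
      have huniv : (Finset.univ : Finset (Fin (n + 1))) =
          insert 0 (Finset.univ.map (Fin.succEmb n)) := by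
        ext i
        refine Fin.cases ?_ (fun i => ?_) i <;> simp
      rw [huniv, Finset.powersetCard_succ_insert h0, Finset.sum_union, Finset.sum_image,
        Nat.succ_eq_add_one, Finset.powersetCard_map, Finset.powersetCard_map, Finset.sum_map,
        Finset.sum_map, weylSum, ← ih, ← ih, map_sum, map_sum]
      · congr 1
        · exact Finset.sum_congr rfl fun s _ => letterWord_map_succ Q P ψ s
        · exact Finset.sum_congr rfl fun s _ => letterWord_insert_map_succ Q P ψ s
      · intro s hs t ht hst
        have hs' : (0 : Fin (n + 1)) ∉ s := fun h => h0 ((Finset.mem_powersetCard.1 hs).1 h)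
        have ht' : (0 : Fin (n + 1)) ∉ t := fun h => h0 ((Finset.mem_powersetCard.1 ht).1 h)
        rw [← Finset.erase_insert hs', ← Finset.erase_insert ht', hst]
      · rw [Finset.disjoint_left]
        intro s hs hs'
        obtain ⟨t, _, rfl⟩ := Finset.mem_image.1 hs'
        exact h0 ((Finset.mem_powersetCard.1 hs).1 (Finset.mem_insert_self _ _))

lemma weylSum_eq_zero (n a : ℕ) (h : n < a) : weylSum Q P ψ n a = 0 := by
  induction n generalizing a with
  | zero =>
    cases a with
    | zero => omega
    | succ a => rfl
  | succ n ih =>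
    cases a with
    | zero => omega
    | succ a => simp [weylSum, ih (a + 1) (by omega), ih a (by omega)]

variable {Q P ψ}

/-- An operator with scalar commutators with `Q` and `P` that annihilates `ψ` acts on the words as
a derivation. -/
lemma weylSum_derivation (A : V →ₗ[ℂ] V) (α β : ℂ) (hψ : A ψ = 0)
    (hQ : ∀ φ, A (Q φ) = Q (A φ) + α • φ) (hP : ∀ φ, A (P φ) = P (A φ) + β • φ) (n : ℕ) :
    A (weylSum Q P ψ (n + 1) 0) = ((n : ℂ) + 1) • (α • weylSum Q P ψ n 0) ∧
    ∀ a, A (weylSum Q P ψ (n + 1) (a + 1)) =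
      ((n : ℂ) + 1) • (α • weylSum Q P ψ n (a + 1) + β • weylSum Q P ψ n a) := by
  -- Deleting one letter in all possible ways from all words of length `n + 1` produces each word of
  -- length `n` exactly `n + 1` times for each kind of deleted letter, with weight `α` for `Q` and
  -- `β` for `P`.
  induction n with
  | zero =>
    refine ⟨by simp [weylSum, hQ, hψ], fun a => ?_⟩
    cases a with
    | zero => simp [weylSum, hP, hψ]
    | succ a => simp [weylSum]
  | succ n ih =>
    constructor
    · rw [weylSum, hQ, ih.1]
      simp only [weylSum, map_smul]
      push_cast
      module
    · intro a
      rw [weylSum, map_add, hQ, hP, ih.2]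
      cases a with
      | zero =>
        rw [ih.1]
        simp only [weylSum, map_smul, map_add]
        push_cast
        module
      | succ a =>
        rw [ih.2]
        simp only [weylSum, map_smul, map_add]
        push_cast
        module

/-- Euler's relation for the degree. It treats `x` and `y` symmetrically, as does the recursion for
sums over all words. -/
lemma add_mul_gaussMoment {R : Type*} [CommRing R] (Y C P : R) (b a : ℕ) :
    ((b : R) + a) * gaussMoment Y C P b a =
      b * ((b : R) - 1) * Y * gaussMoment Y C P (b - 2) a +
        2 * a * b * C * gaussMoment Y C P (b - 1) (a - 1) +
        a * ((a : R) - 1) * P * gaussMoment Y C P b (a - 2) := by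
  have h1 : (b : R) * gaussMoment Y C P b a =
      b * (((b : R) - 1) * Y * gaussMoment Y C P (b - 2) a +
        a * C * gaussMoment Y C P (b - 1) (a - 1)) := by
    cases b with
    | zero => simp
    | succ b => rw [gaussMoment_succ_left]; push_cast; simp
  have h2 : (a : R) * gaussMoment Y C P b a =
      a * ((b : R) * C * gaussMoment Y C P (b - 1) (a - 1) +
        ((a : R) - 1) * P * gaussMoment Y C P b (a - 2)) := by
    cases a with
    | zero => simp
    | succ a => rw [gaussMoment_succ_right]; push_cast; simp
  linear_combination h1 + h2

/-- The Weyl ordered moments of a vector that is annihilated by `P - z Q` are Gaussian. -/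
theorem weylSum_gaussian (E : V →ₗ[ℂ] ℂ) (z h Y : ℂ) (hE : E ψ = 1)
    (hPψ : P ψ = z • Q ψ) (hEP : ∀ φ, E (P φ) = starRingEnd ℂ z * E (Q φ))
    (hcomm : ∀ φ, Q (P φ) - P (Q φ) = (Complex.I * h) • φ) (hz : starRingEnd ℂ z - z ≠ 0)
    (hY : Y * (starRingEnd ℂ z - z) = -(Complex.I * h)) (b a : ℕ) :
    E (weylSum Q P ψ (b + a) a) = (Nat.choose (b + a) a : ℂ) *
      gaussMoment Y ((z + starRingEnd ℂ z) / 2 * Y) (z * starRingEnd ℂ z * Y) b a := by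
  set z' := starRingEnd ℂ z with hz'
  set A : V →ₗ[ℂ] V := P - z • Q with hA
  have hAψ : A ψ = 0 := by simp [hA, hPψ]
  have hAQ : ∀ φ, A (Q φ) = Q (A φ) + (-(Complex.I * h)) • φ := fun φ => by
    rw [neg_smul, ← hcomm]; simp [hA]
  have hAP : ∀ φ, A (P φ) = P (A φ) + (-(z * (Complex.I * h))) • φ := fun φ => by
    rw [neg_smul, mul_smul, ← hcomm]; simp [hA, smul_sub]
  -- `E ∘ A` is `(z' - z)` times `E ∘ Q`, so under `E` the first letter of any word can be traded
  -- for `A`. Commuting `A` through the word to `ψ`, which it annihilates, leaves words that are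
  -- shorter by two letters.
  have hEQ : ∀ φ, E (Q φ) = E (A φ) / (z' - z) := fun φ => by
    rw [eq_div_iff hz]; simp [hA, hEP]; ring
  have hEP' : ∀ φ, E (P φ) = z' * (E (A φ) / (z' - z)) := fun φ => by rw [hEP, hEQ]
  set e : ℕ → ℕ → ℂ := fun n a => E (weylSum Q P ψ n a) with he
  have hder := weylSum_derivation (Q := Q) (P := P) A _ _ hAψ hAQ hAP
  have hY' : -(Complex.I * h) / (z' - z) = Y := by rw [← hY]; field_simp
  have e00 : e 0 0 = 1 := hE
  have e10 : e 1 0 = 0 := by simp [he, weylSum, hEQ, hAψ]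
  have e11 : e 1 1 = 0 := by simp [he, weylSum, hEP', hAψ]
  have en0 : ∀ n, e (n + 2) 0 = ((n : ℂ) + 1) * Y * e n 0 := fun n => by
    rw [← hY']
    change E (Q (weylSum Q P ψ (n + 1) 0)) = _
    rw [hEQ, (hder n).1]
    simp [he]; field_simp
  have en1 : ∀ n, e (n + 2) 1 = ((n : ℂ) + 1) * (Y * e n 1 + (z + z') * Y * e n 0) := fun n => by
    rw [← hY']
    change E (Q (weylSum Q P ψ (n + 1) 1) + P (weylSum Q P ψ (n + 1) 0)) = _
    rw [map_add, hEQ, hEP', (hder n).1, (hder n).2]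
    simp [he]; field_simp; ring
  have en2 : ∀ n a, e (n + 2) (a + 2) =
      ((n : ℂ) + 1) * (Y * e n (a + 2) + (z + z') * Y * e n (a + 1) + z * z' * Y * e n a) :=
    fun n a => by
    rw [← hY']
    change E (Q (weylSum Q P ψ (n + 1) (a + 2)) + P (weylSum Q P ψ (n + 1) (a + 1))) = _
    rw [map_add, hEQ, hEP', (hder n).2, (hder n).2]
    simp [he]; field_simp; ring
  have evan : ∀ n a, n < a → e n a = 0 := fun n a h => by simp [he, weylSum_eq_zero Q P ψ n a h]
  set C := (z + z') / 2 * Y with hC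
  set P' := z * z' * Y with hP'
  have hC2 : (z + z') * Y = 2 * C := by rw [hC]; ring
  rw [hC2] at en1 en2
  change e (b + a) a = _
  clear_value e C P'
  -- Multiplication by `b! a! / n!` is division by the number of words. After this normalization the
  -- recursions `en0`, `en1`, `en2` become `add_mul_gaussMoment`.
  have key : ∀ n b a, b + a = n → e n a * (b.factorial * a.factorial) =
      (n.factorial : ℂ) * gaussMoment Y C P' b a := by
    intro n
    induction n using Nat.strong_induction_on with
    | _ n ih =>
      intro b a hn
      match n, hn with
      | 0, hn =>
        obtain ⟨rfl, rfl⟩ : b = 0 ∧ a = 0 := by omega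
        simp [e00]
      | 1, hn =>
        obtain ⟨rfl, rfl⟩ | ⟨rfl, rfl⟩ : (b = 1 ∧ a = 0) ∨ (b = 0 ∧ a = 1) := by omega
        · simp [e10]
        · simp [e11]
      | k + 2, hn =>
        have g := add_mul_gaussMoment Y C P' b a
        have hn' : (b : ℂ) + a = k + 2 := by exact_mod_cast hn
        have hk : ((k + 2).factorial : ℂ) * gaussMoment Y C P' b a =
            (k + 1) * k.factorial * (((b : ℂ) + a) * gaussMoment Y C P' b a) := by
          rw [hn', Nat.factorial_succ, Nat.factorial_succ]; push_cast; ring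
        rw [hk, g]
        have t1 : Y * e k a * (b.factorial * a.factorial) =
            k.factorial * (b * ((b : ℂ) - 1) * Y * gaussMoment Y C P' (b - 2) a) := by
          match b with
          | 0 => simp [evan k a (by omega)]
          | 1 => simp [evan k a (by omega)]
          | b + 2 =>
            have i1 := ih k (by omega) b a (by omega)
            simp only [Nat.factorial_succ, Nat.add_sub_cancel]
            push_cast
            linear_combination (b + 2) * (b + 1) * Y * i1
        match a with
        | 0 =>
          rw [en0]
          simp at *
          linear_combination (k + 1) * t1
        | a + 1 =>
          have t2 : 2 * C * e k a * (b.factorial * (a + 1).factorial) =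
              k.factorial * (2 * (a + 1 : ℕ) * b * C * gaussMoment Y C P' (b - 1) a) := by
            match b with
            | 0 => simp [evan k a (by omega)]
            | b + 1 =>
              have i2 := ih k (by omega) b a (by omega)
              simp only [Nat.factorial_succ, Nat.add_sub_cancel]
              push_cast
              linear_combination 2 * (b + 1) * (a + 1) * C * i2
          match a with
          | 0 =>
            rw [en1]
            simp at *
            linear_combination (k + 1) * t1 + (k + 1) * t2
          | a + 1 =>
            have i3 := ih k (by omega) b a (by omega)
            rw [en2]
            simp only [Nat.factorial_succ, Nat.add_sub_cancel, Nat.reduceSubDiff] at *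
            push_cast at *
            linear_combination (k + 1) * t1 + (k + 1) * t2 + (k + 1) * P' * (a + 2) * (a + 1) * i3
  have := key _ b a rfl
  rw [← Nat.add_choose_mul_factorial_mul_factorial] at this
  have hne : ((b.factorial : ℂ) * a.factorial) ≠ 0 := by
    exact_mod_cast (mul_pos b.factorial_pos a.factorial_pos).ne'
  apply mul_right_cancel₀ hne
  rw [this]
  push_cast
  rw [show b + a = a + b from add_comm _ _, Nat.choose_symm_add]
  ring

end Weyl

/-! ### Gaussian Schwartz functions -/

section Gaussian

/-- `exp (α x² + β x)` -/
def quadExp (α β : ℂ) (x : ℝ) : ℂ := Complex.exp (α * (x : ℂ) ^ 2 + β * (x : ℂ))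

lemma contDiff_quadExp (α β : ℂ) : ContDiff ℝ ∞ (quadExp α β) := by
  unfold quadExp
  have : ContDiff ℝ ∞ (fun x : ℝ => (x : ℂ)) := Complex.ofRealCLM.contDiff
  fun_prop

lemma hasDerivAt_quadExp (α β : ℂ) (x : ℝ) :
    HasDerivAt (quadExp α β) ((2 * α * x + β) * quadExp α β x) x := by
  have h : HasDerivAt (fun y : ℝ => (y : ℂ)) 1 x := Complex.ofRealCLM.hasDerivAt
  have h2 : HasDerivAt (fun y : ℝ => α * (y : ℂ) ^ 2 + β * (y : ℂ)) (2 * α * x + β) x := by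
    exact (((h.fun_pow 2).const_mul α).fun_add (h.const_mul β)).congr_deriv (by simp; ring)
  exact h2.cexp.congr_deriv (by rw [quadExp, mul_comm])

lemma iteratedDeriv_quadExp (α β : ℂ) (n : ℕ) :
    ∃ p : Polynomial ℂ, ∀ x : ℝ, iteratedDeriv n (quadExp α β) x = p.eval (x : ℂ) * quadExp α β x := by
  induction n with
  | zero => exact ⟨1, by simp⟩
  | succ n ih =>
    obtain ⟨p, hp⟩ := ih
    refine ⟨p.derivative + p * (Polynomial.C (2 * α) * Polynomial.X + Polynomial.C β), fun x => ?_⟩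
    rw [iteratedDeriv_succ, funext hp]
    have h1 : HasDerivAt (fun y : ℝ => p.eval (y : ℂ)) (p.derivative.eval (x : ℂ)) x :=
      (p.hasDerivAt (x : ℂ)).comp_ofReal
    rw [(h1.fun_mul (hasDerivAt_quadExp α β x)).deriv]
    simp; ring

/-- Near infinity the Gaussian decays faster than `|x|^{-k}`; on the remaining compact set
continuity gives the bound. -/
lemma exists_bound_pow_mul_quadExp {α : ℂ} (hα : α.re < 0) (β : ℂ) (k : ℕ) :
    ∃ C : ℝ, ∀ x : ℝ, ‖(x : ℂ) ^ k * quadExp α β x‖ ≤ C := by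
  have ho := cexp_neg_quadratic_isLittleO_abs_rpow_cocompact hα β (-(k : ℝ))
  have hev : ∀ᶠ x : ℝ in Filter.cocompact ℝ, ‖(x : ℂ) ^ k * quadExp α β x‖ ≤ 1 := by
    have h0 : ∀ᶠ x : ℝ in Filter.cocompact ℝ, x ≠ 0 :=
      (isCompact_singleton (x := (0 : ℝ))).compl_mem_cocompact
    filter_upwards [ho.bound one_pos, h0] with x hx hx0
    have hpos : 0 < |x| := abs_pos.2 hx0
    rw [norm_mul, norm_pow, Complex.norm_real, Real.norm_eq_abs]
    rw [one_mul, Real.norm_of_nonneg (by positivity), Real.rpow_neg hpos.le,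
      Real.rpow_natCast] at hx
    calc |x| ^ k * ‖quadExp α β x‖ ≤ |x| ^ k * (|x| ^ k)⁻¹ := by gcongr; exact hx
      _ = 1 := by field_simp
  obtain ⟨K, hK, hKs⟩ := Filter.mem_cocompact.1 hev
  have hcont : Continuous fun x : ℝ => (x : ℂ) ^ k * quadExp α β x :=
    (Complex.continuous_ofReal.pow k).mul (contDiff_quadExp α β).continuous
  obtain ⟨C, hC⟩ := hK.exists_bound_of_continuousOn hcont.continuousOn
  refine ⟨max C 1, fun x => ?_⟩
  by_cases hx : x ∈ K
  · exact (hC x hx).trans (le_max_left _ _)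
  · exact (hKs hx : _ ≤ _).trans (le_max_right _ _)

lemma exists_bound_poly_mul_quadExp {α : ℂ} (hα : α.re < 0) (β : ℂ) (p : Polynomial ℂ) (k : ℕ) :
    ∃ C : ℝ, ∀ x : ℝ, ‖(x : ℂ) ^ k * (p.eval (x : ℂ) * quadExp α β x)‖ ≤ C := by
  induction p using Polynomial.induction_on' with
  | add p q hp hq =>
    obtain ⟨C, hC⟩ := hp
    obtain ⟨D, hD⟩ := hq
    refine ⟨C + D, fun x => ?_⟩
    have : (x : ℂ) ^ k * ((p + q).eval (x : ℂ) * quadExp α β x) =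
      (x : ℂ) ^ k * (p.eval (x : ℂ) * quadExp α β x) +
        (x : ℂ) ^ k * (q.eval (x : ℂ) * quadExp α β x) := by simp; ring
    rw [this]
    exact (norm_add_le _ _).trans (add_le_add (hC x) (hD x))
  | monomial n c =>
    obtain ⟨C, hC⟩ := exists_bound_pow_mul_quadExp hα β (k + n)
    refine ⟨‖c‖ * C, fun x => ?_⟩
    have : (x : ℂ) ^ k * ((Polynomial.monomial n c).eval (x : ℂ) * quadExp α β x) =
      c * ((x : ℂ) ^ (k + n) * quadExp α β x) := by simp; ring
    rw [this, norm_mul]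
    gcongr
    exact hC x

/-- `exp (α x² + β x)` as a Schwartz function. -/
def quadExpSchwartz (α β : ℂ) (hα : α.re < 0) : 𝓢(ℝ, ℂ) where
  toFun := quadExp α β
  smooth' := contDiff_quadExp α β
  decay' k n := by
    obtain ⟨p, hp⟩ := iteratedDeriv_quadExp α β n
    obtain ⟨C, hC⟩ := exists_bound_poly_mul_quadExp hα β p k
    refine ⟨C, fun x => ?_⟩
    rw [norm_iteratedFDeriv_eq_norm_iteratedDeriv, hp]
    simpa using hC x

end Gaussian

/-! ### Position and momentum on Schwartz functions -/

section Operators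

lemma hasTemperateGrowth_ofReal_sub (q : ℝ) :
    Function.HasTemperateGrowth fun x : ℝ => ((x - q : ℝ) : ℂ) := by fun_prop

/-- `q̂ - q` on Schwartz functions. -/
def schwartzQ (q : ℝ) : 𝓢(ℝ, ℂ) →ₗ[ℂ] 𝓢(ℝ, ℂ) :=
  (SchwartzMap.smulLeftCLM ℂ fun x : ℝ => ((x - q : ℝ) : ℂ)).toLinearMap

/-- `p̂ - p` on Schwartz functions. -/
def schwartzP (hbar p : ℝ) : 𝓢(ℝ, ℂ) →ₗ[ℂ] 𝓢(ℝ, ℂ) :=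
  (-(Complex.I * (hbar : ℂ))) • (SchwartzMap.derivCLM ℂ ℂ).toLinearMap - (p : ℂ) • LinearMap.id

lemma coe_schwartzQ (q : ℝ) (φ : 𝓢(ℝ, ℂ)) : ⇑(schwartzQ q φ) = centredQ q φ := by
  ext x
  simp only [schwartzQ, centredQ, ContinuousLinearMap.coe_coe]
  rw [SchwartzMap.smulLeftCLM_apply_apply (hasTemperateGrowth_ofReal_sub q), smul_eq_mul]

lemma coe_schwartzP (hbar p : ℝ) (φ : 𝓢(ℝ, ℂ)) : ⇑(schwartzP hbar p φ) = centredP hbar p φ := by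
  ext x
  simp [schwartzP, centredP]

lemma coe_letterWord (hbar q p : ℝ) (φ : 𝓢(ℝ, ℂ)) {n : ℕ} (s : Finset (Fin n)) :
    ⇑(letterWord (schwartzQ q) (schwartzP hbar p) φ s) = wordOp hbar q p s φ := by
  unfold letterWord wordOp
  induction List.ofFn fun i : Fin n => decide (i ∈ s) with
  | nil => rfl
  | cons c l ih =>
    cases c
    · simp only [List.foldr_cons, Bool.false_eq_true, if_false, coe_schwartzQ, ih]
    · simp only [List.foldr_cons, if_true, coe_schwartzP, ih]

/-- Complex conjugation of Schwartz functions. -/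
def schwartzConj (φ : 𝓢(ℝ, ℂ)) : 𝓢(ℝ, ℂ) :=
  SchwartzMap.postcompCLM (𝕜 := ℝ) (Complex.conjCLE : ℂ →L[ℝ] ℂ) φ

lemma schwartzConj_apply (φ : 𝓢(ℝ, ℂ)) (x : ℝ) : schwartzConj φ x = starRingEnd ℂ (φ x) := by
  simp [schwartzConj]

lemma integrable_conj_mul (ψ φ : 𝓢(ℝ, ℂ)) :
    MeasureTheory.Integrable fun x => starRingEnd ℂ (ψ x) * φ x := by
  have := (SchwartzMap.pairing (ContinuousLinearMap.mul ℝ ℂ) (schwartzConj ψ) φ).integrable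
    (μ := MeasureTheory.volume)
  refine this.congr (Filter.Eventually.of_forall fun x => ?_)
  simp [SchwartzMap.pairing_apply_apply, schwartzConj_apply]

/-- `φ ↦ ⟨ψ, φ⟩` on Schwartz functions. -/
def schwartzBraket (ψ : 𝓢(ℝ, ℂ)) : 𝓢(ℝ, ℂ) →ₗ[ℂ] ℂ where
  toFun φ := braket ψ φ
  map_add' φ χ := by
    simp only [braket, ← MeasureTheory.integral_add (integrable_conj_mul ψ φ) (integrable_conj_mul ψ χ)]
    congr 1; ext x; simp; ring
  map_smul' c φ := by
    simp only [braket, smul_eq_mul, RingHom.id_apply]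
    rw [← MeasureTheory.integral_const_mul]
    congr 1; ext x; simp; ring

lemma schwartzBraket_apply (ψ φ : 𝓢(ℝ, ℂ)) : schwartzBraket ψ φ = braket ψ φ := rfl

lemma schwartzP_commutator (hbar q p : ℝ) (φ : 𝓢(ℝ, ℂ)) :
    schwartzQ q (schwartzP hbar p φ) - schwartzP hbar p (schwartzQ q φ) =
      (Complex.I * (hbar : ℂ)) • φ := by
  ext x
  have h : HasDerivAt (fun y : ℝ => ((y - q : ℝ) : ℂ)) 1 x := by
    have h1 : HasDerivAt (fun y : ℝ => (y : ℂ)) 1 x := Complex.ofRealCLM.hasDerivAt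
    simpa using h1.sub_const (q : ℂ)
  have hd : deriv (centredQ q φ) x = φ x + ((x - q : ℝ) : ℂ) * deriv φ x := by
    have := (h.fun_mul (φ.hasDerivAt x)).deriv
    rwa [one_mul] at this
  simp only [sub_apply, smul_apply, coe_schwartzP, coe_schwartzQ, smul_eq_mul]
  simp only [centredP, hd]
  simp only [centredQ, centredP]
  ring

/-- Integration by parts without boundary terms; its sign is absorbed by conjugating the factor
`-iℏ`. -/
lemma braket_schwartzP (hbar p : ℝ) (ψ φ : 𝓢(ℝ, ℂ)) :
    braket ψ (schwartzP hbar p φ) = braket (schwartzP hbar p ψ) φ := by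
  have hparts := SchwartzMap.integral_mul_deriv_eq_neg_deriv_mul (schwartzConj ψ) φ
  have hd : ∀ x, deriv (schwartzConj ψ) x = starRingEnd ℂ (deriv ψ x) := fun x => by
    have h1 : HasDerivAt (schwartzConj ψ) (starRingEnd ℂ (deriv ψ x)) x :=
      (Complex.conjCLE : ℂ →L[ℝ] ℂ).hasFDerivAt.comp_hasDerivAt x (ψ.hasDerivAt x)
    exact h1.deriv
  simp only [hd, schwartzConj_apply] at hparts
  have i1 := integrable_conj_mul ψ φ
  have i2 : MeasureTheory.Integrable fun x => starRingEnd ℂ (ψ x) * deriv φ x :=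
    integrable_conj_mul ψ (SchwartzMap.derivCLM ℂ ℂ φ)
  have i3 : MeasureTheory.Integrable fun x => starRingEnd ℂ (deriv ψ x) * φ x :=
    integrable_conj_mul (SchwartzMap.derivCLM ℂ ℂ ψ) φ
  have e1 : braket ψ (schwartzP hbar p φ) = -(Complex.I * hbar) * (∫ x, starRingEnd ℂ (ψ x) * deriv φ x)
      - p * ∫ x, starRingEnd ℂ (ψ x) * φ x := by
    rw [← MeasureTheory.integral_const_mul, ← MeasureTheory.integral_const_mul,
      ← MeasureTheory.integral_sub (i2.const_mul _) (i1.const_mul _)]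
    simp only [braket, coe_schwartzP, centredP]
    congr 1; ext x; ring
  have e2 : braket (schwartzP hbar p ψ) φ = (Complex.I * hbar) * (∫ x, starRingEnd ℂ (deriv ψ x) * φ x)
      - p * ∫ x, starRingEnd ℂ (ψ x) * φ x := by
    rw [← MeasureTheory.integral_const_mul, ← MeasureTheory.integral_const_mul,
      ← MeasureTheory.integral_sub (i3.const_mul _) (i1.const_mul _)]
    simp only [braket, coe_schwartzP, centredP]
    congr 1; ext x; simp; ring
  rw [e1, e2, hparts]
  ring

lemma braket_schwartzQ (q : ℝ) (ψ φ : 𝓢(ℝ, ℂ)) :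
    braket ψ (schwartzQ q φ) = braket (schwartzQ q ψ) φ := by
  simp only [braket, coe_schwartzQ, centredQ]
  congr 1; ext x; simp; ring

/-- The Weyl moments of a unit vector with `(p̂ - p) ψ = z (q̂ - q) ψ`. -/
theorem moments_of_annihilated (hbar q p : ℝ) (z : ℂ) (y c : ℝ) (hy : y ≠ 0)
    (hz : z = (c / y : ℝ) + (1 / (2 * y) : ℝ) * Complex.I) (ψ : 𝓢(ℝ, ℂ)) (hψ : braket ψ ψ = 1)
    (hP : schwartzP hbar p ψ = z • schwartzQ q ψ) :
    meanQ ψ = q ∧ meanP hbar ψ = p ∧ ∀ b a, quantumVariable hbar ψ b a =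
      gaussMoment (hbar * y) (hbar * c) (hbar * ((1 / 4 + c ^ 2) / y)) b a := by
  have hyC : (y : ℂ) ≠ 0 := by exact_mod_cast hy
  have hzc : starRingEnd ℂ z = (c / y : ℝ) - (1 / (2 * y) : ℝ) * Complex.I := by
    rw [hz, map_add, map_mul, Complex.conj_ofReal, Complex.conj_ofReal, Complex.conj_I]; ring
  have hzz : starRingEnd ℂ z - z = -(Complex.I / y) := by
    rw [hzc, hz]; push_cast; field_simp; ring
  have hz0 : starRingEnd ℂ z - z ≠ 0 := by
    rw [hzz]; simp [hyC]
  have hEP : ∀ φ, schwartzBraket ψ (schwartzP hbar p φ) =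
      starRingEnd ℂ z * schwartzBraket ψ (schwartzQ q φ) := by
    intro φ
    rw [schwartzBraket_apply, schwartzBraket_apply, braket_schwartzP, braket_schwartzQ, hP]
    simp only [braket]
    rw [← MeasureTheory.integral_const_mul]
    congr 1; ext x; simp; ring
  -- The expectation value of `p̂ - p` is both `z` and `z̄` times that of `q̂ - q`, and `z` is not
  -- real. Hence both expectation values vanish, and the parameters `q, p` are the means.
  have hQ0 : schwartzBraket ψ (schwartzQ q ψ) = 0 := by
    have h1 := hEP ψ
    rw [hP, map_smul, smul_eq_mul] at h1
    have : (starRingEnd ℂ z - z) * schwartzBraket ψ (schwartzQ q ψ) = 0 := by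
      linear_combination -h1
    exact (mul_eq_zero.1 this).resolve_left hz0
  have hP0 : schwartzBraket ψ (schwartzP hbar p ψ) = 0 := by rw [hEP, hQ0, mul_zero]
  have hE : schwartzBraket ψ ψ = 1 := hψ
  have hmq : meanQ ψ = q := by
    have : schwartzQ 0 ψ = schwartzQ q ψ + (q : ℂ) • ψ := by
      ext x; simp [coe_schwartzQ, centredQ]; ring
    rw [meanQ, ← coe_schwartzQ, ← schwartzBraket_apply, this, map_add, map_smul, hQ0, hE]
    simp
  have hmp : meanP hbar ψ = p := by
    have : schwartzP hbar 0 ψ = schwartzP hbar p ψ + (p : ℂ) • ψ := by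
      ext x; simp [coe_schwartzP, centredP]
    rw [meanP, ← coe_schwartzP, ← schwartzBraket_apply, this, map_add, map_smul, hP0, hE]
    simp
  refine ⟨hmq, hmp, fun b a => ?_⟩
  have key := weylSum_gaussian (schwartzBraket ψ) z hbar (hbar * y) hE hP hEP
    (schwartzP_commutator hbar q p) hz0 (by rw [hzz]; field_simp) b a
  rw [quantumVariable, hmq, hmp]
  have hsum : ∑ s ∈ Finset.powersetCard a (Finset.univ : Finset (Fin (b + a))),
      braket ψ (wordOp hbar q p s ψ) =
      schwartzBraket ψ (weylSum (schwartzQ q) (schwartzP hbar p) ψ (b + a) a) := by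
    rw [← sum_letterWord, map_sum]
    exact Finset.sum_congr rfl fun s _ => by rw [schwartzBraket_apply, coe_letterWord]
  have hch : ((Nat.choose (b + a) a : ℕ) : ℂ) ≠ 0 := by
    exact_mod_cast (Nat.choose_pos (Nat.le_add_left a b)).ne'
  rw [hsum, key, inv_mul_cancel_left₀ hch]
  -- The parametrization `Re z = c/y`, `Im z = 1/(2y)` is chosen so that the covariances `Re z · ℏy`
  -- and `|z|² · ℏy` come out as `ℏc` and `ℏ(1/4 + c²)/y`.
  have h1 : (z + starRingEnd ℂ z) / 2 * (hbar * y) = Complex.ofRealHom (hbar * c) := by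
    rw [hzc, hz]; simp; field_simp
  have h2 : z * starRingEnd ℂ z * (hbar * y) = Complex.ofRealHom (hbar * ((1 / 4 + c ^ 2) / y)) := by
    rw [hzc, hz]; simp; field_simp; ring_nf; simp
  have h3 : (hbar * y : ℂ) = Complex.ofRealHom (hbar * y) := by simp
  rw [h1, h2, h3, ← map_gaussMoment]
  simp

end Operators

/-! ### Gaussian states -/

section GaussianState

/-- The real part is `-Im z / (2ℏ)`, and `Im z = 1/(2y)` is positive: a positive variance makes the
packet decay. -/
lemma gaussian_exponent_neg {hbar y : ℝ} (hh : 0 < hbar) (hy : 0 < y) (c : ℝ) :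
    (Complex.I * (((c / y : ℝ) : ℂ) + ((1 / (2 * y) : ℝ) : ℂ) * Complex.I) / ((2 * hbar : ℝ) : ℂ)).re
      < 0 := by
  rw [Complex.div_ofReal_re]
  simp
  apply div_neg_of_neg_of_pos _ (by positivity)
  simp
  positivity

/-- The Gaussian wave packet of width `(ℏ y)^{1/2}` and correlation `ℏ c`, up to normalization. -/
def wavePacket {hbar y : ℝ} (hh : 0 < hbar) (hy : 0 < y) (c q p : ℝ) : 𝓢(ℝ, ℂ) :=
  SchwartzMap.compSubConstCLM ℂ q (quadExpSchwartz _ (Complex.I * p / hbar)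
    (gaussian_exponent_neg hh hy c))

/-- The exponent is `i z (x - q)²/(2ℏ) + i p (x - q)/ℏ`, so `-iℏ d/dx` multiplies the packet by `z
(x - q) + p`. -/
lemma schwartzP_wavePacket {hbar y : ℝ} (hh : 0 < hbar) (hy : 0 < y) (c q p : ℝ) :
    schwartzP hbar p (wavePacket hh hy c q p) =
      (((c / y : ℝ) : ℂ) + ((1 / (2 * y) : ℝ) : ℂ) * Complex.I) •
        schwartzQ q (wavePacket hh hy c q p) := by
  ext x
  set z : ℂ := ((c / y : ℝ) : ℂ) + ((1 / (2 * y) : ℝ) : ℂ) * Complex.I with hz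
  have hcoe : ⇑(wavePacket hh hy c q p) =
      fun x => quadExp (Complex.I * z / ((2 * hbar : ℝ) : ℂ)) (Complex.I * p / hbar) (x - q) := rfl
  have hd := (hasDerivAt_quadExp (Complex.I * z / ((2 * hbar : ℝ) : ℂ)) (Complex.I * p / hbar)
    (x - q)).comp_sub_const x q
  have hhC : (hbar : ℂ) ≠ 0 := by exact_mod_cast hh.ne'
  rw [coe_schwartzP, smul_apply, coe_schwartzQ, hcoe]
  simp only [centredP, centredQ, smul_eq_mul]
  rw [hd.deriv]
  clear_value z
  push_cast
  field_simp
  ring_nf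
  simp only [Complex.I_sq]
  ring

lemma braket_wavePacket_pos {hbar y : ℝ} (hh : 0 < hbar) (hy : 0 < y) (c q p : ℝ) :
    ∃ r : ℝ, 0 < r ∧ braket (wavePacket hh hy c q p) (wavePacket hh hy c q p) = r := by
  set ψ := wavePacket hh hy c q p with hψ
  refine ⟨∫ x, ‖ψ x‖ ^ 2, ?_, ?_⟩
  · have hint : MeasureTheory.Integrable fun x => ‖ψ x‖ ^ 2 := by
      refine (integrable_conj_mul ψ ψ).norm.congr (Filter.Eventually.of_forall fun x => ?_)
      simp [sq]
    rw [MeasureTheory.integral_pos_iff_support_of_nonneg (fun x => by positivity) hint]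
    have : Function.support (fun x => ‖ψ x‖ ^ 2) = Set.univ := by
      ext x
      have : ψ x ≠ 0 := Complex.exp_ne_zero _
      simp [this]
    rw [this]
    simp
  · rw [← integral_complex_ofReal, braket]
    congr 1; ext x
    rw [Complex.conj_mul']
    push_cast; rfl

open Classical in
/-- The normalized Gaussian state with mean `(q, p)`, position variance `ℏ y` and correlation
`ℏ c`. -/
def gaussianState (hbar y c q p : ℝ) : 𝓢(ℝ, ℂ) :=
  if h : 0 < hbar ∧ 0 < y then
    (((Real.sqrt (braket (wavePacket h.1 h.2 c q p) (wavePacket h.1 h.2 c q p)).re)⁻¹ : ℝ) : ℂ) •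
      wavePacket h.1 h.2 c q p
  -- The variance will be a polynomial in the adiabatic parameter, positive only near `0`; elsewhere
  -- the value of the state is irrelevant.
  else 0

theorem gaussianState_spec {hbar y : ℝ} (hh : 0 < hbar) (hy : 0 < y) (c q p : ℝ) :
    braket (gaussianState hbar y c q p) (gaussianState hbar y c q p) = 1 ∧
    meanQ (gaussianState hbar y c q p) = q ∧ meanP hbar (gaussianState hbar y c q p) = p ∧
    ∀ b a, quantumVariable hbar (gaussianState hbar y c q p) b a =
      Real.sqrt hbar ^ (b + a) * gaussMoment y c ((1 / 4 + c ^ 2) / y) b a := by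
  obtain ⟨r, hr, hbr⟩ := braket_wavePacket_pos hh hy c q p
  have hst : gaussianState hbar y c q p = (((Real.sqrt r)⁻¹ : ℝ) : ℂ) • wavePacket hh hy c q p := by
    rw [gaussianState, dif_pos ⟨hh, hy⟩, hbr, Complex.ofReal_re]
  have hnorm : braket (gaussianState hbar y c q p) (gaussianState hbar y c q p) = 1 := by
    have : braket (gaussianState hbar y c q p) (gaussianState hbar y c q p) =
        (((Real.sqrt r)⁻¹ : ℝ) : ℂ) ^ 2 * braket (wavePacket hh hy c q p) (wavePacket hh hy c q p) := by
      rw [hst]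
      simp only [braket]
      rw [← MeasureTheory.integral_const_mul]
      congr 1; ext x; simp; ring
    rw [this, hbr, ← Complex.ofReal_pow, inv_pow, Real.sq_sqrt hr.le, ← Complex.ofReal_mul,
      inv_mul_cancel₀ hr.ne', Complex.ofReal_one]
  have h := moments_of_annihilated hbar q p _ y c hy.ne' rfl (gaussianState hbar y c q p) hnorm (by
    rw [hst, map_smul, map_smul, schwartzP_wavePacket, smul_comm])
  refine ⟨hnorm, h.1, h.2.1, fun b a => ?_⟩
  rw [h.2.2, ← gaussMoment_smul, Real.sq_sqrt hh.le]

end GaussianState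

/-! ### Formal series with smooth coefficients -/

section Series

/-- The derivative along the vector field `(p/m, -F(q))`. -/
def transport (m : ℝ) (F : ℝ → ℝ) (φ : ℝ × ℝ → ℝ) (x : ℝ × ℝ) : ℝ :=
  fderiv ℝ φ x (x.2 / m, -F x.1)

/-- The coefficientwise derivative along the vector field `(p/m, -F(q))`. -/
def transportSeries (m : ℝ) (F : ℝ → ℝ) (Φ : ℝ × ℝ → PowerSeries ℝ) (x : ℝ × ℝ) : PowerSeries ℝ :=
  PowerSeries.mk fun j => transport m F (fun y => PowerSeries.coeff j (Φ y)) x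

/-- Series whose coefficients are smooth functions on `M`. -/
def smoothSeries (M : Set (ℝ × ℝ)) : Subring (ℝ × ℝ → PowerSeries ℝ) where
  carrier := {Φ | ∀ j, ContDiffOn ℝ ∞ (fun x => PowerSeries.coeff j (Φ x)) M}
  mul_mem' := fun {Φ Ψ} hΦ hΨ j => by
    simp only [Pi.mul_apply, PowerSeries.coeff_mul]
    exact ContDiffOn.sum fun a _ => (hΦ a.1).mul (hΨ a.2)
  one_mem' := fun j => by simpa using contDiffOn_const
  add_mem' := fun {Φ Ψ} hΦ hΨ j => by simpa using (hΦ j).add (hΨ j)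
  zero_mem' := fun j => by simpa using contDiffOn_const
  neg_mem' := fun {Φ} hΦ j => by simpa using (hΦ j).neg

variable {m : ℝ} {F : ℝ → ℝ} {M : Set (ℝ × ℝ)}

lemma _root_.ContDiffOn.transport {φ : ℝ × ℝ → ℝ} (hM : IsOpen M) (hF : ContDiff ℝ ∞ F)
    (hφ : ContDiffOn ℝ ∞ φ M) : ContDiffOn ℝ ∞ (transport m F φ) M := by
  have h1 : ContDiffOn ℝ ∞ (fderiv ℝ φ) M := hφ.fderiv_of_isOpen hM (by simp)
  have h2 : ContDiff ℝ ∞ fun x : ℝ × ℝ => (x.2 / m, -F x.1) :=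
    (contDiff_snd.div_const m).prodMk (hF.comp contDiff_fst).neg
  exact h1.clm_apply h2.contDiffOn

lemma differentiableAt_of_mem {φ : ℝ × ℝ → ℝ} (hM : IsOpen M) (hφ : ContDiffOn ℝ ∞ φ M)
    {x : ℝ × ℝ} (hx : x ∈ M) : DifferentiableAt ℝ φ x :=
  (hφ.contDiffAt (hM.mem_nhds hx)).differentiableAt (by simp)

lemma transportSeries_mul (hM : IsOpen M) {Φ Ψ : ℝ × ℝ → PowerSeries ℝ} (hΦ : Φ ∈ smoothSeries M)
    (hΨ : Ψ ∈ smoothSeries M) {x : ℝ × ℝ} (hx : x ∈ M) :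
    transportSeries m F (Φ * Ψ) x =
      transportSeries m F Φ x * Ψ x + Φ x * transportSeries m F Ψ x := by
  ext j
  simp only [transportSeries, PowerSeries.coeff_mk, map_add, PowerSeries.coeff_mul, Pi.mul_apply,
    transport]
  rw [fderiv_fun_sum fun a _ => (differentiableAt_of_mem hM (hΦ a.1) hx).mul
    (differentiableAt_of_mem hM (hΨ a.2) hx)]
  rw [sum_apply, ← Finset.sum_add_distrib]
  refine Finset.sum_congr rfl fun a _ => ?_
  rw [fderiv_fun_mul (differentiableAt_of_mem hM (hΦ a.1) hx)
    (differentiableAt_of_mem hM (hΨ a.2) hx)]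
  simp; ring

lemma transportSeries_add (hM : IsOpen M) {Φ Ψ : ℝ × ℝ → PowerSeries ℝ} (hΦ : Φ ∈ smoothSeries M)
    (hΨ : Ψ ∈ smoothSeries M) {x : ℝ × ℝ} (hx : x ∈ M) :
    transportSeries m F (Φ + Ψ) x = transportSeries m F Φ x + transportSeries m F Ψ x := by
  ext j
  simp only [transportSeries, PowerSeries.coeff_mk, map_add, Pi.add_apply, transport]
  rw [fderiv_fun_add (differentiableAt_of_mem hM (hΦ j) hx) (differentiableAt_of_mem hM (hΨ j) hx)]
  simp

lemma transportSeries_const (Z : PowerSeries ℝ) (x : ℝ × ℝ) :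
    transportSeries m F (fun _ => Z) x = 0 := by
  ext j
  simp [transportSeries, transport]

lemma transportSeries_congr (hM : IsOpen M) {Φ Ψ : ℝ × ℝ → PowerSeries ℝ}
    (h : ∀ y ∈ M, Φ y = Ψ y) {x : ℝ × ℝ} (hx : x ∈ M) :
    transportSeries m F Φ x = transportSeries m F Ψ x := by
  ext j
  simp only [transportSeries, PowerSeries.coeff_mk, transport]
  have : (fun y => PowerSeries.coeff j (Φ y)) =ᶠ[𝓝 x] fun y => PowerSeries.coeff j (Ψ y) := by
    filter_upwards [hM.mem_nhds hx] with y hy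
    rw [h y hy]
  rw [this.fderiv_eq]

end Series

/-! ### The adiabatic expansion of the covariances -/

section Covariance

open Finset.HasAntidiagonal (antidiagonal)

variable (m : ℝ) (F w : ℝ → ℝ)

/-- The coefficients of the position variance, divided by `ℏ`: they are determined order by order
by the condition that the uncertainty relation is saturated. -/
def varianceCoeff : ℕ → ℝ × ℝ → ℝ
  | 0 => fun x => 1 / (2 * m * w x.1)
  | 1 => fun _ => 0
  | n + 2 => fun x => -(1 / (m * w x.1)) * ∑ a ∈ (antidiagonal n).attach,
      (m ^ 2 * w x.1 ^ 2 * (varianceCoeff (a.1.1 + 1) x * varianceCoeff (a.1.2 + 1) x) +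
        m ^ 2 / 2 * (varianceCoeff a.1.1 x * transport m F (transport m F (varianceCoeff a.1.2)) x) -
        m ^ 2 / 4 * (transport m F (varianceCoeff a.1.1) x * transport m F (varianceCoeff a.1.2) x))
decreasing_by
  all_goals
    have := Finset.HasAntidiagonal.mem_antidiagonal.1 a.2
    omega

lemma varianceCoeff_add_two (n : ℕ) (x : ℝ × ℝ) : varianceCoeff m F w (n + 2) x =
    -(1 / (m * w x.1)) * ∑ a ∈ antidiagonal n,
      (m ^ 2 * w x.1 ^ 2 * (varianceCoeff m F w (a.1 + 1) x * varianceCoeff m F w (a.2 + 1) x) +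
        m ^ 2 / 2 * (varianceCoeff m F w a.1 x *
          transport m F (transport m F (varianceCoeff m F w a.2)) x) -
        m ^ 2 / 4 * (transport m F (varianceCoeff m F w a.1) x *
          transport m F (varianceCoeff m F w a.2) x)) := by
  rw [varianceCoeff, ← Finset.sum_attach (antidiagonal n)]

/-- The adiabatic expansion of the position variance, divided by `ℏ`. -/
def varianceSeries (x : ℝ × ℝ) : PowerSeries ℝ := PowerSeries.mk fun j => varianceCoeff m F w j x

/-- The adiabatic expansion of the correlation, divided by `ℏ`. -/
def correlationSeries (x : ℝ × ℝ) : PowerSeries ℝ :=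
  PowerSeries.C (m / 2) * (PowerSeries.X * transportSeries m F (varianceSeries m F w) x)

/-- The adiabatic expansion of the momentum variance, divided by `ℏ`. -/
def momentumSeries (x : ℝ × ℝ) : PowerSeries ℝ :=
  PowerSeries.C m * (PowerSeries.X * transportSeries m F (correlationSeries m F w) x) +
    PowerSeries.C (m ^ 2 * w x.1 ^ 2) * varianceSeries m F w x

variable {m F w} {O : Set ℝ}

/-- Data of a particle of mass `m` in the force field `-F`, whose local frequency `w` is smooth and
positive on the open set `O`. -/
structure IsFrequency (m : ℝ) (F w : ℝ → ℝ) (O : Set ℝ) : Prop where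
  m_pos : 0 < m
  contDiff_force : ContDiff ℝ ∞ F
  isOpen_domain : IsOpen O
  contDiffOn_freq : ContDiffOn ℝ ∞ w O
  freq_pos : ∀ q ∈ O, 0 < w q

lemma IsFrequency.isOpen_preimage (h : IsFrequency m F w O) :
    IsOpen (Prod.fst ⁻¹' O : Set (ℝ × ℝ)) :=
  h.isOpen_domain.preimage continuous_fst

lemma IsFrequency.contDiffOn_comp_fst (h : IsFrequency m F w O) :
    ContDiffOn ℝ ∞ (fun x : ℝ × ℝ => w x.1) (Prod.fst ⁻¹' O) :=
  h.contDiffOn_freq.comp contDiffOn_fst fun _ hx => hx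

lemma contDiffOn_varianceCoeff (h : IsFrequency m F w O) (j : ℕ) :
    ContDiffOn ℝ ∞ (varianceCoeff m F w j) (Prod.fst ⁻¹' O) := by
  have hm := h.m_pos
  have hF := h.contDiff_force
  have hpos := h.freq_pos
  have hM := h.isOpen_preimage
  have hw' := h.contDiffOn_comp_fst
  induction j using Nat.strong_induction_on with
  | _ j ih =>
    match j with
    | 0 =>
      simp only [varianceCoeff]
      refine contDiffOn_const.div (contDiffOn_const.mul hw') fun x hx => ?_
      have := hpos _ hx
      positivity
    | 1 => simpa [varianceCoeff] using contDiffOn_const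
    | n + 2 =>
      rw [funext (varianceCoeff_add_two m F w n)]
      refine ContDiffOn.mul ?_ (ContDiffOn.sum fun a ha => ?_)
      · refine (contDiffOn_const.div (contDiffOn_const.mul hw') fun x hx => ?_).neg
        have := hpos _ hx
        positivity
      · have hle := Finset.HasAntidiagonal.mem_antidiagonal.1 ha
        have i1 := ih a.1 (by omega)
        have i2 := ih a.2 (by omega)
        have i3 := ih (a.1 + 1) (by omega)
        have i4 := ih (a.2 + 1) (by omega)
        exact (((contDiffOn_const.mul (hw'.pow 2)).mul (i3.mul i4)).add
          (contDiffOn_const.mul (i1.mul ((i2.transport hM hF).transport hM hF)))).sub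
          (contDiffOn_const.mul ((i1.transport hM hF).mul (i2.transport hM hF)))

lemma correlationSeries_coeff_succ (j : ℕ) (x : ℝ × ℝ) :
    PowerSeries.coeff (j + 1) (correlationSeries m F w x) =
      m / 2 * transport m F (varianceCoeff m F w j) x := by
  rw [correlationSeries, PowerSeries.coeff_C_mul, PowerSeries.coeff_succ_X_mul]
  simp [transportSeries, varianceSeries]

lemma varianceSeries_mem (h : IsFrequency m F w O) :
    varianceSeries m F w ∈ smoothSeries (Prod.fst ⁻¹' O) := fun j => by
  simpa [varianceSeries] using contDiffOn_varianceCoeff h j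

lemma correlationSeries_mem (h : IsFrequency m F w O) :
    correlationSeries m F w ∈ smoothSeries (Prod.fst ⁻¹' O) := fun j => by
  cases j with
  | zero => simpa [correlationSeries] using contDiffOn_const
  | succ j =>
    simp only [correlationSeries_coeff_succ]
    exact contDiffOn_const.mul
      ((contDiffOn_varianceCoeff h j).transport h.isOpen_preimage h.contDiff_force)

lemma momentumSeries_mem (h : IsFrequency m F w O) :
    momentumSeries m F w ∈ smoothSeries (Prod.fst ⁻¹' O) := fun j => by
  have h1 : ContDiffOn ℝ ∞ (fun x : ℝ × ℝ =>
      m ^ 2 * w x.1 ^ 2 * PowerSeries.coeff j (varianceSeries m F w x)) (Prod.fst ⁻¹' O) :=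
    (contDiffOn_const.mul (h.contDiffOn_comp_fst.pow 2)).mul (varianceSeries_mem h j)
  simp only [momentumSeries, map_add, PowerSeries.coeff_C_mul]
  refine ContDiffOn.add (contDiffOn_const.mul ?_) h1
  cases j with
  | zero => simpa using contDiffOn_const
  | succ j =>
    simp only [PowerSeries.coeff_succ_X_mul]
    simpa [transportSeries] using
      (correlationSeries_mem h j).transport h.isOpen_preimage h.contDiff_force

lemma transportSeries_correlationSeries (h : IsFrequency m F w O) {x : ℝ × ℝ} (hx : x.1 ∈ O) :
    transportSeries m F (correlationSeries m F w) x = PowerSeries.C (m / 2) * (PowerSeries.X *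
      PowerSeries.mk fun j => transport m F (transport m F (varianceCoeff m F w j)) x) := by
  ext j
  rw [PowerSeries.coeff_C_mul, transportSeries, PowerSeries.coeff_mk]
  cases j with
  | zero => simp [correlationSeries, transport]
  | succ j =>
    simp only [correlationSeries_coeff_succ, PowerSeries.coeff_succ_X_mul, PowerSeries.coeff_mk]
    have hd := differentiableAt_of_mem h.isOpen_preimage (φ := transport m F (varianceCoeff m F w j))
      ((contDiffOn_varianceCoeff h j).transport h.isOpen_preimage h.contDiff_force) hx
    rw [transport, fderiv_const_mul hd]
    simp [transport]

/-- The first two covariance equations, here and in `correlationSeries_transport`, are the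
definitions of the correlation and of the momentum variance, solved for the derivative. -/
lemma varianceSeries_transport (h : IsFrequency m F w O) (x : ℝ × ℝ) :
    PowerSeries.X * transportSeries m F (varianceSeries m F w) x =
      2 * PowerSeries.C (1 / m) * correlationSeries m F w x := by
  have hm := h.m_pos.ne'
  have h2 : (2 : PowerSeries ℝ) = PowerSeries.C 2 := (map_ofNat _ 2).symm
  rw [correlationSeries, ← mul_assoc, h2, ← map_mul, ← map_mul,
    show (2 * (1 / m) * (m / 2) : ℝ) = 1 by field_simp, map_one, one_mul]

lemma correlationSeries_transport (h : IsFrequency m F w O) (x : ℝ × ℝ) :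
    PowerSeries.X * transportSeries m F (correlationSeries m F w) x =
      PowerSeries.C (1 / m) * momentumSeries m F w x -
        PowerSeries.C (m * w x.1 ^ 2) * varianceSeries m F w x := by
  have hm := h.m_pos.ne'
  rw [momentumSeries, mul_add, ← mul_assoc, ← map_mul, ← mul_assoc (PowerSeries.C _) _
    (varianceSeries _ _ _ _), ← map_mul, show (1 / m * m : ℝ) = 1 by field_simp,
    show (1 / m * (m ^ 2 * w x.1 ^ 2) : ℝ) = m * w x.1 ^ 2 by field_simp, map_one, one_mul]
  ring

/-- Separates the two extreme terms of a convolution, the only ones in which the coefficient of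
highest index occurs. -/
lemma coeff_mul_add_two (f g : ℕ → ℝ) (n : ℕ) :
    ∑ a ∈ antidiagonal (n + 2), f a.1 * g a.2 =
      f 0 * g (n + 2) + f (n + 2) * g 0 + ∑ a ∈ antidiagonal n, f (a.1 + 1) * g (a.2 + 1) := by
  rw [Finset.Nat.antidiagonal_succ_succ']
  simp [add_assoc]

/-- The uncertainty relation is saturated in every order. -/
lemma varianceSeries_mul_momentumSeries (h : IsFrequency m F w O) {x : ℝ × ℝ} (hx : x.1 ∈ O) :
    varianceSeries m F w x * momentumSeries m F w x - correlationSeries m F w x ^ 2 =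
      PowerSeries.C (1 / 4) := by
  have hm := h.m_pos.ne'
  have hw := (h.freq_pos _ hx).ne'
  set Y := varianceSeries m F w x with hY
  set D1 := transportSeries m F (varianceSeries m F w) x with hD1
  set D2 : PowerSeries ℝ :=
    PowerSeries.mk fun j => transport m F (transport m F (varianceCoeff m F w j)) x with hD2
  -- Eliminating `C` and `P` turns the uncertainty relation into a second order nonlinear equation
  -- for the variance alone. Its derivative terms carry the square of the adiabatic parameter, so
  -- they only involve earlier coefficients.
  have e : Y * momentumSeries m F w x - correlationSeries m F w x ^ 2 =
      PowerSeries.X ^ 2 * (PowerSeries.C (m ^ 2 / 2) * (Y * D2)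
        - PowerSeries.C (m ^ 2 / 4) * (D1 * D1)) +
        PowerSeries.C (m ^ 2 * w x.1 ^ 2) * (Y * Y) := by
    rw [momentumSeries, correlationSeries, transportSeries_correlationSeries h hx,
      show (m ^ 2 / 2 : ℝ) = m * (m / 2) by ring,
      show (m ^ 2 / 4 : ℝ) = m / 2 * (m / 2) by ring, map_mul _ m (m / 2), map_mul _ (m / 2) (m / 2)]
    ring
  rw [e]
  ext n
  match n with
  | 0 =>
    simp [hY, varianceSeries, varianceCoeff]
    field_simp
    norm_num
  | 1 =>
    rw [map_add, PowerSeries.coeff_X_pow_mul', if_neg (by norm_num), PowerSeries.coeff_C_mul,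
      PowerSeries.coeff_mul]
    simp [hY, varianceSeries, varianceCoeff, Finset.Nat.antidiagonal_succ]
  | n + 2 =>
    -- In this order the new coefficient appears linearly, with factor `2 m² w² · varianceCoeff 0 =
    -- m w`; the recursion divides by it.
    have hrec := varianceCoeff_add_two m F w n x
    rw [Finset.sum_sub_distrib, Finset.sum_add_distrib, ← Finset.mul_sum, ← Finset.mul_sum,
      ← Finset.mul_sum] at hrec
    rw [map_add, PowerSeries.coeff_X_pow_mul, map_sub, PowerSeries.coeff_C_mul,
      PowerSeries.coeff_C_mul, PowerSeries.coeff_C_mul, PowerSeries.coeff_mul, PowerSeries.coeff_mul,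
      PowerSeries.coeff_mul, coeff_mul_add_two (fun i => PowerSeries.coeff i Y) fun i =>
        PowerSeries.coeff i Y]
    simp only [hY, hD1, hD2, varianceSeries, transportSeries, PowerSeries.coeff_mk]
    rw [PowerSeries.coeff_C, if_neg (by omega)]
    rw [show varianceCoeff m F w 0 x = 1 / (2 * m * w x.1) by rw [varianceCoeff]]
    rw [hrec]
    field_simp
    ring

lemma varianceSeries_ne_zero (h : IsFrequency m F w O) {x : ℝ × ℝ} (hx : x.1 ∈ O) :
    varianceSeries m F w x ≠ 0 := by
  intro h0
  have := congrArg (PowerSeries.coeff 0) h0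
  have hm := h.m_pos.ne'
  have hw := (h.freq_pos _ hx).ne'
  simp [varianceSeries, varianceCoeff, hm, hw] at this

/-- The derivative of the conserved `YP - C²` vanishes. Inserting the first two equations leaves the
third one multiplied by `Y`, which cancels because formal series over a field form a domain. -/
lemma momentumSeries_transport (h : IsFrequency m F w O) {x : ℝ × ℝ} (hx : x.1 ∈ O) :
    PowerSeries.X * transportSeries m F (momentumSeries m F w) x =
      -2 * PowerSeries.C (m * w x.1 ^ 2) * correlationSeries m F w x := by
  have hM := h.isOpen_preimage
  have hY := varianceSeries_mem h
  have hC := correlationSeries_mem h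
  have hP := momentumSeries_mem h
  have hC4 : (fun _ => PowerSeries.C (1 / 4) : ℝ × ℝ → PowerSeries ℝ) ∈
      smoothSeries (Prod.fst ⁻¹' O) := fun j => contDiffOn_const
  have e1 := transportSeries_congr (m := m) (F := F) hM
    (Φ := varianceSeries m F w * momentumSeries m F w)
    (Ψ := correlationSeries m F w * correlationSeries m F w + fun _ => PowerSeries.C (1 / 4))
    (fun y hy => by
      rw [Pi.mul_apply, Pi.add_apply, Pi.mul_apply, ← varianceSeries_mul_momentumSeries h hy]
      ring) hx
  rw [transportSeries_mul hM hY hP hx, transportSeries_add hM (Subring.mul_mem _ hC hC) hC4 hx,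
    transportSeries_mul hM hC hC hx, transportSeries_const, add_zero] at e1
  have e2 := varianceSeries_transport h x
  have e3 := correlationSeries_transport h x
  apply mul_left_cancel₀ (varianceSeries_ne_zero h hx)
  linear_combination PowerSeries.X * e1 - momentumSeries m F w x * e2 +
    2 * correlationSeries m F w x * e3

/-- The moments of the adiabatic Gaussian, divided by `ℏ^{(b+a)/2}`. -/
def momentSeries (m : ℝ) (F w : ℝ → ℝ) (b a : ℕ) (x : ℝ × ℝ) : PowerSeries ℝ :=
  gaussMoment (varianceSeries m F w x) (correlationSeries m F w x) (momentumSeries m F w x) b a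

/-- Reads the pointwise moments as moments in the ring of series-valued functions, where the subring
criterion for smoothness applies. -/
lemma momentSeries_eq (b a : ℕ) : momentSeries m F w b a =
    gaussMoment (varianceSeries m F w) (correlationSeries m F w) (momentumSeries m F w) b a := by
  ext1 x
  exact (map_gaussMoment (varianceSeries m F w) (correlationSeries m F w) (momentumSeries m F w)
    (Pi.evalRingHom (fun _ : ℝ × ℝ => PowerSeries ℝ) x) b a).symm

lemma momentSeries_mem (h : IsFrequency m F w O) (b a : ℕ) :
    momentSeries m F w b a ∈ smoothSeries (Prod.fst ⁻¹' O) := by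
  rw [momentSeries_eq]
  exact gaussMoment_mem _ _ _ _ (varianceSeries_mem h) (correlationSeries_mem h)
    (momentumSeries_mem h) b a

/-- The moments solve the linearized equations of motion in every order of the adiabatic
parameter. -/
theorem momentSeries_transport (h : IsFrequency m F w O) {x : ℝ × ℝ} (hx : x.1 ∈ O) (b a : ℕ) :
    PowerSeries.X * transportSeries m F (momentSeries m F w b a) x =
      PowerSeries.C (1 / m) * (b : PowerSeries ℝ) * momentSeries m F w (b - 1) (a + 1) x -
        PowerSeries.C (m * w x.1 ^ 2) * (a : PowerSeries ℝ) * momentSeries m F w (b + 1) (a - 1) x := by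
  have hM := h.isOpen_preimage
  have hY := varianceSeries_mem h
  have hC := correlationSeries_mem h
  have hP := momentumSeries_mem h
  have hG := momentSeries_mem h
  have hN : ∀ n : ℕ, (n : ℝ × ℝ → PowerSeries ℝ) ∈ smoothSeries (Prod.fst ⁻¹' O) :=
    fun n => natCast_mem _ n
  have hleib : ∀ (n : ℕ) (Φ Ψ : ℝ × ℝ → PowerSeries ℝ), Φ ∈ smoothSeries (Prod.fst ⁻¹' O) →
      Ψ ∈ smoothSeries (Prod.fst ⁻¹' O) →
      transportSeries m F ((n : ℝ × ℝ → PowerSeries ℝ) * Φ * Ψ) x =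
        n * (transportSeries m F Φ x * Ψ x + Φ x * transportSeries m F Ψ x) := by
    intro n Φ Ψ hΦ hΨ
    have hn : transportSeries m F (n : ℝ × ℝ → PowerSeries ℝ) x = 0 :=
      transportSeries_const (n : PowerSeries ℝ) x
    rw [mul_assoc, transportSeries_mul hM (hN n) (Subring.mul_mem _ hΦ hΨ) hx, hn,
      transportSeries_mul hM hΦ hΨ hx]
    simp
  refine gaussMoment_flow (varianceSeries m F w x) (correlationSeries m F w x)
    (momentumSeries m F w x) (PowerSeries.C (1 / m)) (PowerSeries.C (m * w x.1 ^ 2)) _ _ _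
    (fun b a => PowerSeries.X * transportSeries m F (momentSeries m F w b a) x)
    (varianceSeries_transport h x) (correlationSeries_transport h x)
    (momentumSeries_transport h hx) ?_ ?_ ?_ ?_ ?_ b a
  · have : momentSeries m F w 0 0 = fun _ => 1 := by ext1 y; simp [momentSeries]
    simp [this, transportSeries_const]
  · have : momentSeries m F w 0 1 = fun _ => 0 := by ext1 y; simp [momentSeries]
    simp [this, transportSeries_const]
  · intro a
    have : momentSeries m F w 0 (a + 2) =
        ((a + 1 : ℕ) : ℝ × ℝ → PowerSeries ℝ) * momentumSeries m F w * momentSeries m F w 0 a := by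
      rw [momentSeries_eq, gaussMoment_succ_right, momentSeries_eq]; simp
    simp only [this, hleib (a + 1) _ _ hP (hG 0 a)]
    simp only [momentSeries]
    push_cast; ring
  · intro a
    have : momentSeries m F w 1 a =
        (a : ℝ × ℝ → PowerSeries ℝ) * correlationSeries m F w * momentSeries m F w 0 (a - 1) := by
      rw [momentSeries_eq, gaussMoment_succ_left, momentSeries_eq]; simp
    simp only [this, hleib a _ _ hC (hG 0 (a - 1))]
    simp only [momentSeries]
    ring
  · intro b a
    have : momentSeries m F w (b + 2) a =
        ((b + 1 : ℕ) : ℝ × ℝ → PowerSeries ℝ) * varianceSeries m F w * momentSeries m F w b a +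
        (a : ℝ × ℝ → PowerSeries ℝ) * correlationSeries m F w *
          momentSeries m F w (b + 1) (a - 1) := by
      rw [momentSeries_eq, gaussMoment_succ_left, momentSeries_eq, momentSeries_eq]; simp
    have hadd := transportSeries_add (m := m) (F := F) hM
      (Subring.mul_mem _ (Subring.mul_mem _ (hN (b + 1)) hY) (hG b a))
      (Subring.mul_mem _ (Subring.mul_mem _ (hN a) hC) (hG (b + 1) (a - 1))) hx
    simp only [this, hadd, hleib (b + 1) _ _ hY (hG b a), hleib a _ _ hC (hG (b + 1) (a - 1))]
    simp only [momentSeries]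
    push_cast; ring

end Covariance

/-! ### The Poisson bracket on homogeneous expansions -/

section Bracket

/-- A term of the bracket that removes more letters than are present vanishes, so truncated
subtraction in its indices does no harm. -/
lemma descFactorial_mul_eq_zero {b a d c k i : ℕ}
    (h : b < k - i ∨ a < i ∨ c < k - i ∨ d < i) :
    (b.descFactorial (k - i) : ℝ) * (a.descFactorial i : ℝ) *
      (c.descFactorial (k - i) : ℝ) * (d.descFactorial i : ℝ) = 0 := by
  rcases h with h | h | h | h <;> simp [Nat.descFactorial_eq_zero_iff_lt.2 h]

/-- If one of the two variables is at most quadratic, the bracket is the classical one. -/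
lemma momentBracket_of_le_two (G : ℕ → ℕ → Expansion) {b a d c : ℕ} (h : b + a ≤ 2 ∨ d + c ≤ 2) :
    momentBracket G b a d c =
      ((b : ℝ) * c - (a : ℝ) * d) • G (b + d - 1) (a + c - 1) -
      (((b : ℝ) * (c : ℝ)) • (G (b - 1) a * G d (c - 1))
        - ((a : ℝ) * (d : ℝ)) • (G b (a - 1) * G (d - 1) c)) := by
  rw [momentBracket, Finset.sum_eq_single 0]
  · congr 1
    simp [Finset.sum_range_succ, sub_smul]
    rw [sub_eq_add_neg, ← neg_smul]
  · intro r _ hr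
    refine Finset.sum_eq_zero fun i hi => ?_
    have hi' := Finset.mem_range.1 hi
    -- The term `r` removes `2r + 1` letters from each of the two variables, which is at least three
    -- if `r ≠ 0`.
    rw [descFactorial_mul_eq_zero (by omega), mul_zero, zero_smul]
  · simp

/-- The expansion in which the coefficient of order `b + a` in `ℏ^{1/2}` of the `b, a`-moment is
`g b a`, and the others vanish. -/
def homogeneous (g : ℕ → ℕ → PowerSeries ℝ) (b a : ℕ) : Expansion :=
  PowerSeries.C (g b a) * PowerSeries.X ^ (b + a)

lemma coeff_homogeneous (g : ℕ → ℕ → PowerSeries ℝ) (b a N : ℕ) :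
    PowerSeries.coeff N (homogeneous g b a) = if N = b + a then g b a else 0 := by
  rw [homogeneous, PowerSeries.coeff_C_mul, PowerSeries.coeff_X_pow]
  simp

variable {g : ℕ → ℕ → PowerSeries ℝ}

lemma coeff_homogeneous_mul (b a d c N : ℕ) (h : N ≠ b + a + (d + c)) :
    PowerSeries.coeff N (homogeneous g b a * homogeneous g d c) = 0 := by
  rw [homogeneous, homogeneous, mul_mul_mul_comm, ← pow_add, ← map_mul, PowerSeries.coeff_C_mul,
    PowerSeries.coeff_X_pow, if_neg h, mul_zero]

/-- The bracket lowers the order in `ℏ^{1/2}` by two. -/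
lemma coeff_momentBracket_eq_zero {b a d c N : ℕ} (h : N + 2 ≠ b + a + (d + c)) :
    PowerSeries.coeff N (momentBracket (homogeneous g) b a d c) = 0 := by
  have h1 : PowerSeries.coeff N (((b : ℝ) * (c : ℝ)) •
      (homogeneous g (b - 1) a * homogeneous g d (c - 1))) = 0 := by
    rcases Nat.eq_zero_or_pos b with rfl | hb
    · simp
    rcases Nat.eq_zero_or_pos c with rfl | hc
    · simp
    rw [PowerSeries.coeff_smul, coeff_homogeneous_mul _ _ _ _ _ (by omega), smul_zero]
  have h2 : PowerSeries.coeff N (((a : ℝ) * (d : ℝ)) •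
      (homogeneous g b (a - 1) * homogeneous g (d - 1) c)) = 0 := by
    rcases Nat.eq_zero_or_pos a with rfl | hb
    · simp
    rcases Nat.eq_zero_or_pos d with rfl | hc
    · simp
    rw [PowerSeries.coeff_smul, coeff_homogeneous_mul _ _ _ _ _ (by omega), smul_zero]
  rw [momentBracket, map_sub, map_sub, h1, h2, sub_zero, sub_zero, map_sum]
  refine Finset.sum_eq_zero fun r _ => ?_
  rw [map_sum]
  refine Finset.sum_eq_zero fun i hi => ?_
  have hi' := Finset.mem_range.1 hi
  by_cases hlt : b < 2 * r + 1 - i ∨ a < i ∨ c < 2 * r + 1 - i ∨ d < i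
  · rw [descFactorial_mul_eq_zero hlt, mul_zero, zero_smul, map_zero]
  · push Not at hlt
    rw [PowerSeries.coeff_smul, formalHbar, ← pow_mul, homogeneous, mul_left_comm (PowerSeries.X ^ _),
      ← pow_add,
      PowerSeries.coeff_C_mul, PowerSeries.coeff_X_pow, if_neg (by omega), mul_zero, smul_zero]

/-- Every linear term removes `4r + 2` letters in total, and every product term removes two and
distributes the rest over two factors. The parity of the total degree is preserved, so each term
contains a moment of odd degree. -/
lemma momentBracket_eq_zero_of_odd (hg : ∀ b a, Odd (b + a) → g b a = 0) {b a d c : ℕ}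
    (h : Odd (b + a + (d + c))) : momentBracket (homogeneous g) b a d c = 0 := by
  have hG : ∀ b a, Odd (b + a) → homogeneous g b a = 0 := fun b a h => by
    rw [homogeneous, hg b a h]; simp
  have hG2 : ∀ b a d c, Odd (b + a + (d + c)) → homogeneous g b a * homogeneous g d c = 0 := by
    intro b a d c h
    rcases Nat.even_or_odd (b + a) with h' | h'
    · rw [hG d c (by grind), mul_zero]
    · rw [hG b a h', zero_mul]
  have h1 : ((b : ℝ) * (c : ℝ)) • (homogeneous g (b - 1) a * homogeneous g d (c - 1)) = 0 := by
    rcases Nat.eq_zero_or_pos b with rfl | hb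
    · simp
    rcases Nat.eq_zero_or_pos c with rfl | hc
    · simp
    rw [hG2 _ _ _ _ (by grind), smul_zero]
  have h2 : ((a : ℝ) * (d : ℝ)) • (homogeneous g b (a - 1) * homogeneous g (d - 1) c) = 0 := by
    rcases Nat.eq_zero_or_pos a with rfl | hb
    · simp
    rcases Nat.eq_zero_or_pos d with rfl | hc
    · simp
    rw [hG2 _ _ _ _ (by grind), smul_zero]
  rw [momentBracket, h1, h2, sub_zero, sub_zero]
  refine Finset.sum_eq_zero fun r _ => Finset.sum_eq_zero fun i hi => ?_
  have hi' := Finset.mem_range.1 hi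
  by_cases hlt : b < 2 * r + 1 - i ∨ a < i ∨ c < 2 * r + 1 - i ∨ d < i
  · rw [descFactorial_mul_eq_zero hlt, mul_zero, zero_smul]
  · push Not at hlt
    rw [hG _ _ (by rw [Nat.odd_iff] at *; omega), mul_zero, smul_zero]

/-- For a variable of degree one the product terms, which account for the state dependence of `q`
and `p`, cancel the classical term; for degree zero every term vanishes. -/
lemma momentBracket_eq_zero_of_le_one {G : ℕ → ℕ → Expansion} (hG : G 0 0 = 1) {b a d c : ℕ}
    (h : b + a ≤ 1 ∨ d + c ≤ 1) : momentBracket G b a d c = 0 := by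
  rw [momentBracket_of_le_two G (by omega)]
  rcases h with h | h
  · obtain ⟨rfl, rfl⟩ | ⟨rfl, rfl⟩ | ⟨rfl, rfl⟩ :
      (b = 0 ∧ a = 0) ∨ (b = 1 ∧ a = 0) ∨ (b = 0 ∧ a = 1) := by omega
    all_goals simp [hG]
  · obtain ⟨rfl, rfl⟩ | ⟨rfl, rfl⟩ | ⟨rfl, rfl⟩ :
      (d = 0 ∧ c = 0) ∨ (d = 1 ∧ c = 0) ∨ (d = 0 ∧ c = 1) := by omega
    all_goals simp [hG]

lemma momentBracket_zero_two {G : ℕ → ℕ → Expansion} (hG : G 0 1 = 0) (b a : ℕ) :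
    momentBracket G b a 0 2 = (2 * b : ℝ) • G (b - 1) (a + 1) := by
  rw [momentBracket_of_le_two G (by omega)]
  simp [hG, mul_comm]

lemma momentBracket_two_zero {G : ℕ → ℕ → Expansion} (hG : G 1 0 = 0) (b a : ℕ) :
    momentBracket G b a 2 0 = -((2 * a : ℝ) • G (b + 1) (a - 1)) := by
  rw [momentBracket_of_le_two G (by omega)]
  simp [hG, mul_comm]

end Bracket

/-! ### The flow of the quantum Hamiltonian -/

section Flow

variable {m om : ℝ} {U : ℝ → ℝ}

/-- The classical potential. -/
def potential (m om : ℝ) (U : ℝ → ℝ) (q : ℝ) : ℝ := m * om ^ 2 * q ^ 2 / 2 + U q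

lemma hamiltonian_eq (q p : ℝ) : hamiltonian m om U q p = p ^ 2 / (2 * m) + potential m om U q := by
  rw [hamiltonian, potential]; ring

lemma iteratedDeriv_hamiltonian (hm : m ≠ 0) (q p : ℝ) (c : ℕ) :
    iteratedDeriv (c + 1) (fun p => hamiltonian m om U q p) p =
      if c = 0 then p / m else if c = 1 then 1 / m else 0 := by
  have h1 : deriv (fun p => hamiltonian m om U q p) = fun p => p / m := by
    ext p
    simp only [hamiltonian_eq]
    rw [deriv_add_const, deriv_div_const]
    simp
    field_simp
  have h2 : deriv (fun p : ℝ => p / m) = fun _ => 1 / m := by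
    ext p
    rw [deriv_div_const]; simp
  rw [iteratedDeriv_succ', h1]
  match c with
  | 0 => simp
  | 1 => rw [iteratedDeriv_one, h2]; simp
  | c + 2 =>
    rw [iteratedDeriv_succ', h2, iteratedDeriv_const]
    simp

lemma mixedDeriv_succ_succ (hm : m ≠ 0) (d c : ℕ) (x : ℝ × ℝ) :
    mixedDeriv (hamiltonian m om U) (d + 1) (c + 1) x = 0 := by
  simp only [mixedDeriv, iteratedDeriv_hamiltonian hm]
  rw [iteratedDeriv_const]
  simp

lemma mixedDeriv_zero_succ (hm : m ≠ 0) (c : ℕ) (x : ℝ × ℝ) :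
    mixedDeriv (hamiltonian m om U) 0 (c + 1) x =
      if c = 0 then x.2 / m else if c = 1 then 1 / m else 0 := by
  simp only [mixedDeriv, iteratedDeriv_hamiltonian hm, iteratedDeriv_zero]

lemma mixedDeriv_succ_zero (d : ℕ) (x : ℝ × ℝ) :
    mixedDeriv (hamiltonian m om U) (d + 1) 0 x = iteratedDeriv (d + 1) (potential m om U) x.1 := by
  simp only [mixedDeriv, iteratedDeriv_zero, hamiltonian_eq, iteratedDeriv_succ']
  congr 1
  ext q
  rw [deriv_const_add]

variable {g : ℕ → ℕ → PowerSeries ℝ}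

lemma coeff_formalSum (f : ℕ → ℕ → Expansion) (N : ℕ) :
    PowerSeries.coeff N (formalSum f) = ∑ l ∈ Finset.range (N + 3),
      ∑ d ∈ Finset.range (l + 1), PowerSeries.coeff N (f d (l - d)) := by
  rw [formalSum, PowerSeries.coeff_mk]

lemma coeff_formalSum_homogeneous (k : ℕ → ℕ → ℝ) (N : ℕ) :
    PowerSeries.coeff N (formalSum fun d c => k d c • homogeneous g d c) =
      ∑ d ∈ Finset.range (N + 1), k d (N - d) • g d (N - d) := by
  rw [coeff_formalSum, Finset.sum_eq_single N]
  · refine Finset.sum_congr rfl fun d hd => ?_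
    have := Finset.mem_range.1 hd
    rw [PowerSeries.coeff_smul, coeff_homogeneous, if_pos (by omega)]
  · intro l _ hl
    refine Finset.sum_eq_zero fun d hd => ?_
    have := Finset.mem_range.1 hd
    rw [PowerSeries.coeff_smul, coeff_homogeneous, if_neg (by omega), smul_zero]
  · intro h
    exact absurd (Finset.mem_range.2 (by omega)) h

lemma coeff_flowP (hm : m ≠ 0) (x : ℝ × ℝ) (N : ℕ) :
    PowerSeries.coeff N (flowP (hamiltonian m om U) x (homogeneous g)) =
      -((iteratedDeriv (N + 1) (potential m om U) x.1 / N.factorial) • g N 0) := by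
  rw [flowP, map_neg, coeff_formalSum_homogeneous, Finset.sum_eq_single N]
  · simp [mixedDeriv_succ_zero]
  · intro d hd hdN
    have := Finset.mem_range.1 hd
    obtain ⟨c, hc⟩ : ∃ c, N - d = c + 1 := ⟨N - d - 1, by omega⟩
    rw [hc, mixedDeriv_succ_succ hm, zero_div, zero_smul]
  · intro h
    exact absurd (Finset.mem_range.2 (by omega)) h

/-- The kinetic energy is quadratic, and its only possible correction to `q̇ = p/m` is proportional
to `G 0 1 = 0`. -/
lemma flowQ_eq (hm : m ≠ 0) (h00 : g 0 0 = 1) (h01 : g 0 1 = 0) (x : ℝ × ℝ) :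
    flowQ (hamiltonian m om U) x (homogeneous g) = PowerSeries.C (PowerSeries.C (x.2 / m)) := by
  ext1 N
  rw [flowQ, coeff_formalSum_homogeneous, Finset.sum_eq_single 0]
  · rw [mixedDeriv_zero_succ hm, PowerSeries.coeff_C, Nat.sub_zero]
    match N with
    | 0 => simp [h00, PowerSeries.smul_eq_C_mul]
    | 1 => simp [h01]
    | N + 2 => simp
  · intro d hd hd0
    obtain ⟨c, rfl⟩ : ∃ c, d = c + 1 := ⟨d - 1, by omega⟩
    rw [mixedDeriv_succ_succ hm, zero_div, zero_smul]
  · simp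

/-- In the leading order `ℏ^{(b+a)/2}` only the terms of `H_Q` with `d + c = 2` contribute, as the
bracket lowers the order by two; they generate the linear flow of the local oscillator. -/
lemma coeff_flowG (hm : m ≠ 0) (h00 : g 0 0 = 1) (hodd : ∀ b a, Odd (b + a) → g b a = 0)
    (x : ℝ × ℝ) (b a N : ℕ) (hN : N ≤ momentOrder 1 (b + a)) :
    PowerSeries.coeff N (flowG (hamiltonian m om U) x (homogeneous g) b a) =
      if N = b + a then PowerSeries.C (1 / m) * (b : PowerSeries ℝ) * g (b - 1) (a + 1) -
        PowerSeries.C (iteratedDeriv 2 (potential m om U) x.1) * (a : PowerSeries ℝ) *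
          g (b + 1) (a - 1)
      else 0 := by
  have hG00 : homogeneous g 0 0 = 1 := by simp [homogeneous, h00]
  have hG10 : homogeneous g 1 0 = 0 := by simp [homogeneous, hodd 1 0 (by decide)]
  have hG01 : homogeneous g 0 1 = 0 := by simp [homogeneous, hodd 0 1 (by decide)]
  rw [momentOrder] at hN
  rw [flowG, coeff_formalSum]
  simp only [PowerSeries.coeff_smul]
  split_ifs with h
  · subst h
    rw [Finset.sum_eq_single 2]
    · simp only [Finset.sum_range_succ, Finset.sum_range_zero, zero_add, Nat.sub_zero,
        Nat.sub_self, mixedDeriv_succ_succ hm 0 0 x, momentBracket_zero_two hG01,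
        momentBracket_two_zero hG10, mixedDeriv_zero_succ hm 1 x, mixedDeriv_succ_zero 1 x]
      have e1 : ((2 * b : ℝ) • PowerSeries.coeff (b + a) (homogeneous g (b - 1) (a + 1))) =
          (2 * b : ℝ) • g (b - 1) (a + 1) := by
        rcases Nat.eq_zero_or_pos b with rfl | hb
        · simp
        · rw [coeff_homogeneous, if_pos (by omega)]
      have e2 : ((2 * a : ℝ) • PowerSeries.coeff (b + a) (homogeneous g (b + 1) (a - 1))) =
          (2 * a : ℝ) • g (b + 1) (a - 1) := by
        rcases Nat.eq_zero_or_pos a with rfl | hb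
        · simp
        · rw [coeff_homogeneous, if_pos (by omega)]
      rw [map_neg, PowerSeries.coeff_smul, PowerSeries.coeff_smul, e1, e2]
      rw [← map_natCast (PowerSeries.C (R := ℝ)) b, ← map_natCast (PowerSeries.C (R := ℝ)) a,
        ← map_mul, ← map_mul, ← PowerSeries.smul_eq_C_mul, ← PowerSeries.smul_eq_C_mul]
      simp only [one_ne_zero, if_false, if_true, zero_div, zero_smul, add_zero, smul_neg, smul_smul,
        Nat.factorial, Nat.cast_one, Nat.succ_eq_add_one, ← sub_eq_add_neg]
      congr 2 <;> push_cast <;> ring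
    · intro l _ hl
      refine Finset.sum_eq_zero fun d hd => ?_
      have := Finset.mem_range.1 hd
      rw [coeff_momentBracket_eq_zero (by omega), smul_zero]
    · intro h
      exact absurd (Finset.mem_range.2 (by omega)) h
  · refine Finset.sum_eq_zero fun l _ => Finset.sum_eq_zero fun d hd => ?_
    have hd' := Finset.mem_range.1 hd
    by_cases h1 : b + a ≤ 1 ∨ l ≤ 1
    · rw [momentBracket_eq_zero_of_le_one hG00 (by omega), map_zero, smul_zero]
    -- With both degrees at least two and `N ≠ b + a`, the bound on `N` leaves only `b + a = 2`, `l
    -- = 3`, `N = 3`, which is excluded by parity.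
    by_cases h2 : N + 2 = b + a + l
    · rw [momentBracket_eq_zero_of_odd hodd (by rw [Nat.odd_iff]; omega), map_zero, smul_zero]
    · rw [coeff_momentBracket_eq_zero (by omega), smul_zero]

end Flow

/-! ### Stationary curves of the Lagrangian `A(q) v² / 2 - B(q)` -/

section Variation

open MeasureTheory Set

variable {A B : ℝ → ℝ} {O : Set ℝ}

lemma hasDerivAt_of_contDiffOn {f : ℝ → ℝ} (hO : IsOpen O) (hf : ContDiffOn ℝ ∞ f O) {q : ℝ}
    (hq : q ∈ O) : HasDerivAt f (deriv f q) q :=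
  ((hf.contDiffAt (hO.mem_nhds hq)).differentiableAt (by simp)).hasDerivAt

lemma continuousOn_deriv_of_contDiffOn {f : ℝ → ℝ} (hO : IsOpen O) (hf : ContDiffOn ℝ ∞ f O) :
    ContinuousOn (deriv f) O :=
  hf.continuousOn_deriv_of_isOpen hO (by simp)

/-- The derivative of the action along a straight line of variations. -/
lemma hasDerivAt_action (hO : IsOpen O) (hA : ContDiffOn ℝ ∞ A O) (hB : ContDiffOn ℝ ∞ B O)
    {c d : ℝ} (hcd : c ≤ d) {y v η ζ : ℝ → ℝ} (hy : ContinuousOn y (Icc c d))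
    (hv : ContinuousOn v (Icc c d)) (hη : ContinuousOn η (Icc c d)) (hζ : ContinuousOn ζ (Icc c d))
    (hyO : ∀ t ∈ Icc c d, y t ∈ O) :
    HasDerivAt (fun ε : ℝ => ∫ t in c..d,
        (A (y t + ε * η t) * (v t + ε * ζ t) ^ 2 / 2 - B (y t + ε * η t)))
      (∫ t in c..d, (deriv A (y t) * η t * v t ^ 2 / 2 + A (y t) * v t * ζ t - deriv B (y t) * η t))
      0 := by
  -- The action is controlled only while the varied curve stays in `O`. Compactness gives a uniform
  -- distance `δ` to the complement, and `|ε| ≤ δ / (|K| + 1)` keeps the variation within it.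
  obtain ⟨δ, hδ, hδO⟩ := (isCompact_Icc.image_of_continuousOn hy).exists_cthickening_subset_open hO
    (by rintro _ ⟨t, ht, rfl⟩; exact hyO t ht)
  obtain ⟨K, hK⟩ := isCompact_Icc.exists_bound_of_continuousOn hη
  set r : ℝ := δ / (|K| + 1) with hr
  have hrpos : 0 < r := by positivity
  have hmem : ∀ ε ∈ Icc (-r) r, ∀ t ∈ Icc c d, y t + ε * η t ∈ O := by
    intro ε hε t ht
    apply hδO
    refine Metric.mem_cthickening_of_dist_le _ (y t) _ _ ⟨t, ht, rfl⟩ ?_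
    rw [Real.dist_eq, add_sub_cancel_left, abs_mul]
    have h1 : |ε| ≤ r := abs_le.2 hε
    have h2 : |η t| ≤ |K| + 1 := by
      have := hK t ht
      rw [Real.norm_eq_abs] at this
      linarith [le_abs_self K]
    calc |ε| * |η t| ≤ r * (|K| + 1) := by gcongr
      _ = δ := by rw [hr]; field_simp
  set S : Set (ℝ × ℝ) := Icc (-r) r ×ˢ Icc c d with hS
  have cfst : ContinuousOn (fun z : ℝ × ℝ => z.1) S := continuous_fst.continuousOn
  have csnd : ∀ {f : ℝ → ℝ}, ContinuousOn f (Icc c d) → ContinuousOn (fun z : ℝ × ℝ => f z.2) S :=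
    fun hf => hf.comp continuous_snd.continuousOn fun z hz => hz.2
  have cpos : ContinuousOn (fun z : ℝ × ℝ => y z.2 + z.1 * η z.2) S :=
    (csnd hy).add (cfst.mul (csnd hη))
  have cvel : ContinuousOn (fun z : ℝ × ℝ => v z.2 + z.1 * ζ z.2) S :=
    (csnd hv).add (cfst.mul (csnd hζ))
  have ccomp : ∀ {f : ℝ → ℝ}, ContinuousOn f O →
      ContinuousOn (fun z : ℝ × ℝ => f (y z.2 + z.1 * η z.2)) S :=
    fun hf => hf.comp cpos fun z hz => hmem _ hz.1 _ hz.2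
  set L : ℝ → ℝ → ℝ := fun ε t => A (y t + ε * η t) * (v t + ε * ζ t) ^ 2 / 2 - B (y t + ε * η t)
    with hL
  set L' : ℝ → ℝ → ℝ := fun ε t => deriv A (y t + ε * η t) * η t * (v t + ε * ζ t) ^ 2 / 2 +
    A (y t + ε * η t) * (v t + ε * ζ t) * ζ t - deriv B (y t + ε * η t) * η t with hL'
  have cL : ContinuousOn (fun z : ℝ × ℝ => L z.1 z.2) S :=
    (((ccomp hA.continuousOn).mul (cvel.pow 2)).div_const 2).sub (ccomp hB.continuousOn)
  have cL' : ContinuousOn (fun z : ℝ × ℝ => L' z.1 z.2) S :=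
    (((((ccomp (continuousOn_deriv_of_contDiffOn hO hA)).mul (csnd hη)).mul
      (cvel.pow 2)).div_const 2).add (((ccomp hA.continuousOn).mul cvel).mul (csnd hζ))).sub
      ((ccomp (continuousOn_deriv_of_contDiffOn hO hB)).mul (csnd hη))
  have slice : ∀ {f : ℝ → ℝ → ℝ}, ContinuousOn (fun z : ℝ × ℝ => f z.1 z.2) S →
      ∀ ε ∈ Icc (-r) r, ContinuousOn (f ε) (Icc c d) := fun {f} hf ε hε =>
    hf.comp (f := fun t => (ε, t)) (by fun_prop) fun t ht => ⟨hε, ht⟩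
  have hzero : (0 : ℝ) ∈ Icc (-r) r := ⟨by linarith, hrpos.le⟩
  have hsub : uIoc c d ⊆ Icc c d := by rw [uIoc_of_le hcd]; exact Ioc_subset_Icc_self
  -- The derivative of the integrand is continuous on a compact rectangle, so a constant dominates
  -- it and differentiation under the integral is allowed.
  obtain ⟨b, hb⟩ := (isCompact_Icc.prod isCompact_Icc).exists_bound_of_continuousOn cL'
  have key := intervalIntegral.hasDerivAt_integral_of_dominated_loc_of_deriv_le (μ := volume)
    (F := L) (F' := L') (x₀ := 0) (s := Icc (-r) r) (a := c) (b := d) (bound := fun _ => b)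
    (Icc_mem_nhds (by linarith) hrpos) ?_ ?_ ?_ ?_ ?_ ?_
  · have h2 := key.2
    simp only [hL', zero_mul, add_zero] at h2
    exact h2
  · filter_upwards [Icc_mem_nhds (show -r < 0 by linarith) hrpos] with ε hε
    exact ((slice cL ε hε).mono hsub).aestronglyMeasurable measurableSet_uIoc
  · exact (slice cL 0 hzero).intervalIntegrable_of_Icc hcd
  · exact ((slice cL' 0 hzero).mono hsub).aestronglyMeasurable measurableSet_uIoc
  · exact Filter.Eventually.of_forall fun t ht ε hε => hb (ε, t) ⟨hε, hsub ht⟩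
  · exact intervalIntegrable_const
  · refine Filter.Eventually.of_forall fun t ht ε hε => ?_
    have hO' := hmem ε hε t (hsub ht)
    have h1 : HasDerivAt (fun ε : ℝ => y t + ε * η t) (η t) ε := by
      simpa using ((hasDerivAt_id ε).mul_const (η t)).const_add (y t)
    have h2 : HasDerivAt (fun ε : ℝ => v t + ε * ζ t) (ζ t) ε := by
      simpa using ((hasDerivAt_id ε).mul_const (ζ t)).const_add (v t)
    have hA' := (hasDerivAt_of_contDiffOn hO hA hO').comp ε h1
    have hB' := (hasDerivAt_of_contDiffOn hO hB hO').comp ε h1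
    refine (((hA'.mul (h2.pow 2)).div_const 2).sub hB').congr_deriv ?_
    simp only [hL', Function.comp, Pi.pow_apply]
    ring

/-- The Euler-Lagrange expression. -/
def eulerLagrange (A B q : ℝ → ℝ) (t : ℝ) : ℝ :=
  A (q t) * deriv (deriv q) t + deriv A (q t) * deriv q t ^ 2 / 2 + deriv B (q t)

lemma contDiffOn_two_iff {q : ℝ → ℝ} {I : Set ℝ} (hI : IsOpen I) :
    ContDiffOn ℝ 2 q I ↔ DifferentiableOn ℝ q I ∧ DifferentiableOn ℝ (deriv q) I ∧
      ContinuousOn (deriv (deriv q)) I := by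
  rw [show (2 : WithTop ℕ∞) = 1 + 1 by norm_num, contDiffOn_succ_iff_deriv_of_isOpen hI,
    show (1 : WithTop ℕ∞) = 0 + 1 by norm_num, contDiffOn_succ_iff_deriv_of_isOpen hI,
    contDiffOn_zero]
  simp

lemma continuousOn_eulerLagrange (hO : IsOpen O) (hA : ContDiffOn ℝ ∞ A O)
    (hB : ContDiffOn ℝ ∞ B O) {I : Set ℝ} (hI : IsOpen I) {q : ℝ → ℝ} (hq : ContDiffOn ℝ 2 q I)
    (hqO : ∀ t ∈ I, q t ∈ O) : ContinuousOn (eulerLagrange A B q) I := by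
  obtain ⟨h1, h2, h3⟩ := (contDiffOn_two_iff hI).1 hq
  have comp : ∀ {f : ℝ → ℝ}, ContinuousOn f O → ContinuousOn (fun t => f (q t)) I :=
    fun hf => hf.comp h1.continuousOn hqO
  exact (((comp hA.continuousOn).mul h3).add
    (((comp (continuousOn_deriv_of_contDiffOn hO hA)).mul (h2.continuousOn.pow 2)).div_const 2)).add
    (comp (continuousOn_deriv_of_contDiffOn hO hB))

/-- The first variation of the action. -/
lemma hasDerivAt_action_eulerLagrange (hO : IsOpen O) (hA : ContDiffOn ℝ ∞ A O)
    (hB : ContDiffOn ℝ ∞ B O) {t₀ t₁ : ℝ} {q : ℝ → ℝ} (hq : ContDiffOn ℝ 2 q (Ioo t₀ t₁))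
    (hqO : ∀ t ∈ Ioo t₀ t₁, q t ∈ O) {c d : ℝ} (hc : t₀ < c) (hcd : c < d) (hd : d < t₁)
    {η : ℝ → ℝ} (hη : ContDiff ℝ ∞ η) (hsupp : tsupport η ⊆ Ioo c d) :
    HasDerivAt (fun ε : ℝ => ∫ t in c..d, (A (q t + ε * η t) *
        (deriv (fun t => q t + ε * η t) t) ^ 2 / 2 - B (q t + ε * η t)))
      (-∫ t in c..d, η t * eulerLagrange A B q t) 0 := by
  have hI : IsOpen (Ioo t₀ t₁) := isOpen_Ioo
  obtain ⟨h1, h2, h3⟩ := (contDiffOn_two_iff hI).1 hq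
  have hsub : Icc c d ⊆ Ioo t₀ t₁ := fun t ht => ⟨hc.trans_le ht.1, ht.2.trans_lt hd⟩
  have hdq : ∀ t ∈ Icc c d, HasDerivAt q (deriv q t) t := fun t ht =>
    (h1.differentiableAt (hI.mem_nhds (hsub ht))).hasDerivAt
  have hddq : ∀ t ∈ Icc c d, HasDerivAt (deriv q) (deriv (deriv q) t) t := fun t ht =>
    (h2.differentiableAt (hI.mem_nhds (hsub ht))).hasDerivAt
  have hdη : ∀ t, HasDerivAt η (deriv η t) t := fun t =>
    (hη.differentiable (by simp) t).hasDerivAt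
  have cη' : Continuous (deriv η) := hη.continuous_deriv (by simp)
  have cq := h1.continuousOn.mono hsub
  have cv := h2.continuousOn.mono hsub
  have ca := h3.mono hsub
  have comp : ∀ {f : ℝ → ℝ}, ContinuousOn f O → ContinuousOn (fun t => f (q t)) (Icc c d) :=
    fun hf => hf.comp cq fun t ht => hqO t (hsub ht)
  have cA := comp hA.continuousOn
  have cA' := comp (continuousOn_deriv_of_contDiffOn hO hA)
  have cB' := comp (continuousOn_deriv_of_contDiffOn hO hB)
  have huIcc : uIcc c d = Icc c d := uIcc_of_le hcd.le
  have key := hasDerivAt_action hO hA hB hcd.le cq cv hη.continuous.continuousOn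
    cη'.continuousOn (fun t ht => hqO t (hsub ht))
  have hfun : (fun ε : ℝ => ∫ t in c..d, (A (q t + ε * η t) *
        (deriv (fun t => q t + ε * η t) t) ^ 2 / 2 - B (q t + ε * η t))) = fun ε : ℝ =>
      ∫ t in c..d, (A (q t + ε * η t) * (deriv q t + ε * deriv η t) ^ 2 / 2 -
        B (q t + ε * η t)) := by
    ext ε
    refine intervalIntegral.integral_congr fun t ht => ?_
    rw [huIcc] at ht
    simp only [((hdq t ht).fun_add ((hdη t).const_mul ε)).deriv]
  rw [hfun]
  refine key.congr_deriv ?_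
  -- The support lies in the open interval, so no boundary terms arise in the integration by parts.
  have hηc : η c = 0 := by
    by_contra h
    exact lt_irrefl c (hsupp (subset_tsupport _ h)).1
  have hηd : η d = 0 := by
    by_contra h
    exact lt_irrefl d (hsupp (subset_tsupport _ h)).2
  have hparts := intervalIntegral.integral_mul_deriv_eq_deriv_mul (a := c) (b := d)
    (u := fun t => A (q t) * deriv q t)
    (u' := fun t => deriv A (q t) * deriv q t * deriv q t + A (q t) * deriv (deriv q) t)
    (v := η) (v' := deriv η)
    (fun t ht => by
      rw [huIcc] at ht
      exact ((hasDerivAt_of_contDiffOn hO hA (hqO t (hsub ht))).comp t (hdq t ht)).mul (hddq t ht))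
    (fun t _ => hdη t)
    ((((cA'.mul cv).mul cv).add (cA.mul ca)).intervalIntegrable_of_Icc hcd.le)
    (cη'.intervalIntegrable _ _)
  rw [hηc, hηd, mul_zero, mul_zero, sub_zero, zero_sub] at hparts
  have i1 : IntervalIntegrable (fun t => deriv A (q t) * η t * deriv q t ^ 2 / 2 -
      deriv B (q t) * η t) volume c d :=
    ((((cA'.mul hη.continuous.continuousOn).mul (cv.pow 2)).div_const 2).sub
      (cB'.mul hη.continuous.continuousOn)).intervalIntegrable_of_Icc hcd.le
  have i2 : IntervalIntegrable (fun t => A (q t) * deriv q t * deriv η t) volume c d :=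
    ((cA.mul cv).mul cη'.continuousOn).intervalIntegrable_of_Icc hcd.le
  have i3 : IntervalIntegrable (fun t => (deriv A (q t) * deriv q t * deriv q t +
      A (q t) * deriv (deriv q) t) * η t) volume c d :=
    ((((cA'.mul cv).mul cv).add (cA.mul ca)).mul
      hη.continuous.continuousOn).intervalIntegrable_of_Icc hcd.le
  calc ∫ t in c..d, (deriv A (q t) * η t * deriv q t ^ 2 / 2 + A (q t) * deriv q t * deriv η t -
        deriv B (q t) * η t)
      = ∫ t in c..d, ((deriv A (q t) * η t * deriv q t ^ 2 / 2 - deriv B (q t) * η t) +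
          A (q t) * deriv q t * deriv η t) := by
        congr 1; ext t; ring
    _ = -∫ t in c..d, η t * eulerLagrange A B q t := by
        rw [intervalIntegral.integral_add i1 i2, hparts, ← sub_eq_add_neg,
          ← intervalIntegral.integral_sub i1 i3, ← intervalIntegral.integral_neg]
        refine intervalIntegral.integral_congr fun t _ => ?_
        simp only [eulerLagrange]; ring

/-- The curve `q` is a stationary point of the action if and only if it solves the Euler-Lagrange
equation. -/
lemma stationary_iff_eulerLagrange (hO : IsOpen O) (hA : ContDiffOn ℝ ∞ A O)
    (hB : ContDiffOn ℝ ∞ B O) {t₀ t₁ : ℝ} {q : ℝ → ℝ} (hq : ContDiffOn ℝ 2 q (Ioo t₀ t₁))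
    (hqO : ∀ t ∈ Ioo t₀ t₁, q t ∈ O) :
    (∀ c d, t₀ < c → c < d → d < t₁ → ∀ η : ℝ → ℝ, ContDiff ℝ ∞ η → tsupport η ⊆ Ioo c d →
      HasDerivAt (fun ε : ℝ => ∫ t in c..d, (A (q t + ε * η t) *
        (deriv (fun t => q t + ε * η t) t) ^ 2 / 2 - B (q t + ε * η t))) 0 0) ↔
    ∀ t ∈ Ioo t₀ t₁, eulerLagrange A B q t = 0 := by
  constructor
  · intro h t ht
    obtain ⟨c, hc, hct⟩ := exists_between ht.1
    obtain ⟨d, htd, hd⟩ := exists_between ht.2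
    have hsub : Ioo c d ⊆ Ioo t₀ t₁ := Ioo_subset_Ioo hc.le hd.le
    have hcont : ContinuousOn (eulerLagrange A B q) (Ioo c d) :=
      (continuousOn_eulerLagrange hO hA hB isOpen_Ioo hq hqO).mono hsub
    -- The fundamental lemma of the calculus of variations, on a small interval around `t`. It gives
    -- vanishing almost everywhere, and continuity of the Euler-Lagrange expression then gives it at
    -- `t`.
    have hae := isOpen_Ioo.ae_eq_zero_of_integral_contDiff_smul_eq_zero (μ := volume)
      (hcont.locallyIntegrableOn measurableSet_Ioo) (fun η hη _ hsupp => by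
        have h1 := h c d hc (hct.trans htd) hd η hη hsupp
        have h2 := hasDerivAt_action_eulerLagrange hO hA hB hq hqO hc (hct.trans htd) hd hη hsupp
        have h3 := h1.unique h2
        rw [← intervalIntegral.integral_eq_integral_of_support_subset (a := c) (b := d)]
        · simp only [smul_eq_mul]; linarith
        · intro s hs
          have : η s ≠ 0 := fun h0 => hs (by simp [h0])
          exact Ioo_subset_Ioc_self (hsupp (subset_tsupport _ this)))
    have := Measure.eqOn_open_of_ae_eq (μ := volume) (U := Ioo c d) (g := fun _ => (0 : ℝ))
      ((ae_restrict_iff' measurableSet_Ioo).2 hae) isOpen_Ioo hcont continuousOn_const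
    exact this ⟨hct, htd⟩
  · intro h c d hc hcd hd η hη hsupp
    refine (hasDerivAt_action_eulerLagrange hO hA hB hq hqO hc hcd hd hη hsupp).congr_deriv ?_
    rw [neg_eq_zero]
    refine intervalIntegral.integral_zero_ae (Filter.Eventually.of_forall fun t ht => ?_)
    rw [uIoc_of_le hcd.le] at ht
    rw [h t ⟨hc.trans ht.1, ht.2.trans_lt hd⟩, mul_zero]

/-- The stationary curves are the projections of the integral curves of the Euler-Lagrange vector
field in the coordinates `q`, `p = m q̇`. -/
theorem exists_integralCurve_iff {m : ℝ} (hm : m ≠ 0) (hO : IsOpen O) (hA : ContDiffOn ℝ ∞ A O)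
    (hB : ContDiffOn ℝ ∞ B O) (hpos : ∀ q ∈ O, A q ≠ 0) (t₀ t₁ : ℝ) (q : ℝ → ℝ) :
    (∃ p : ℝ → ℝ, ∀ t ∈ Ioo t₀ t₁, q t ∈ O ∧ HasDerivAt (fun u => (q u, p u))
      (p t / m, -(m / A (q t)) * (deriv B (q t) + deriv A (q t) / 2 * (p t / m) ^ 2)) t) ↔
    ContDiffOn ℝ 2 q (Ioo t₀ t₁) ∧ (∀ t ∈ Ioo t₀ t₁, q t ∈ O) ∧
      ∀ t ∈ Ioo t₀ t₁, eulerLagrange A B q t = 0 := by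
  have hI : IsOpen (Ioo t₀ t₁) := isOpen_Ioo
  constructor
  · rintro ⟨p, hp⟩
    have hqO : ∀ t ∈ Ioo t₀ t₁, q t ∈ O := fun t ht => (hp t ht).1
    have hq' : ∀ t ∈ Ioo t₀ t₁, HasDerivAt q (p t / m) t := fun t ht =>
      (ContinuousLinearMap.fst ℝ ℝ ℝ).hasFDerivAt.comp_hasDerivAt t (hp t ht).2
    have hp' : ∀ t ∈ Ioo t₀ t₁, HasDerivAt p (-(m / A (q t)) *
        (deriv B (q t) + deriv A (q t) / 2 * (p t / m) ^ 2)) t := fun t ht =>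
      (ContinuousLinearMap.snd ℝ ℝ ℝ).hasFDerivAt.comp_hasDerivAt t (hp t ht).2
    have hdq : ∀ t ∈ Ioo t₀ t₁, deriv q t = p t / m := fun t ht => (hq' t ht).deriv
    -- Bootstrapping: `q̇` coincides with `p/m` on an open interval and inherits its
    -- differentiability, so `q` is twice differentiable; continuity of the vector field makes it
    -- `C²`.
    have hddq : ∀ t ∈ Ioo t₀ t₁, HasDerivAt (deriv q) (-(m / A (q t)) *
        (deriv B (q t) + deriv A (q t) / 2 * (p t / m) ^ 2) / m) t := fun t ht =>
      ((hp' t ht).div_const m).congr_of_eventuallyEq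
        (Filter.eventuallyEq_of_mem (hI.mem_nhds ht) hdq)
    have cq : ContinuousOn q (Ioo t₀ t₁) := fun t ht => (hq' t ht).continuousAt.continuousWithinAt
    have cp : ContinuousOn p (Ioo t₀ t₁) := fun t ht => (hp' t ht).continuousAt.continuousWithinAt
    have comp : ∀ {f : ℝ → ℝ}, ContinuousOn f O → ContinuousOn (fun t => f (q t)) (Ioo t₀ t₁) :=
      fun hf => hf.comp cq hqO
    refine ⟨(contDiffOn_two_iff hI).2 ⟨fun t ht => (hq' t ht).differentiableAt.differentiableWithinAt,
      fun t ht => (hddq t ht).differentiableAt.differentiableWithinAt, ?_⟩, hqO, fun t ht => ?_⟩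
    · refine ContinuousOn.congr ?_ fun t ht => (hddq t ht).deriv
      exact ((continuousOn_const.div (comp hA.continuousOn) fun t ht => hpos _ (hqO t ht)).neg.mul
        ((comp (continuousOn_deriv_of_contDiffOn hO hB)).add
          (((comp (continuousOn_deriv_of_contDiffOn hO hA)).div_const 2).mul
            ((cp.div_const m).pow 2)))).div_const m
    · have := hpos _ (hqO t ht)
      rw [eulerLagrange, (hddq t ht).deriv, hdq t ht]
      field_simp
      ring
  · rintro ⟨hq, hqO, hEL⟩
    obtain ⟨h1, h2, h3⟩ := (contDiffOn_two_iff hI).1 hq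
    -- Here `p` is the mean of `p̂`, for which `q̇ = p/m`; it is not the canonical momentum `A(q)
    -- q̇` of the effective Lagrangian.
    refine ⟨fun t => m * deriv q t, fun t ht => ⟨hqO t ht, ?_⟩⟩
    have hdq := (h1.differentiableAt (hI.mem_nhds ht)).hasDerivAt
    have hddq := (h2.differentiableAt (hI.mem_nhds ht)).hasDerivAt
    refine (hdq.prodMk (hddq.const_mul m)).congr_deriv ?_
    have hA0 := hpos _ (hqO t ht)
    have := hEL t ht
    rw [eulerLagrange] at this
    ext
    · simp; field_simp
    · simp only
      rw [mul_div_cancel_left₀ _ hm]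
      field_simp
      linear_combination 2 * this

end Variation

/-! ### The local frequency of the anharmonic oscillator -/

section Frequency

/-- The local frequency `(ω² + U''/m)^{1/2}`. -/
def freq (m om : ℝ) (U : ℝ → ℝ) (q : ℝ) : ℝ := Real.sqrt (om ^ 2 + iteratedDeriv 2 U q / m)

/-- The derivative of the local frequency. -/
def freqD (m om : ℝ) (U : ℝ → ℝ) (q : ℝ) : ℝ := iteratedDeriv 3 U q / (2 * m * freq m om U q)

/-- The second derivative of the local frequency. -/
def freqDD (m om : ℝ) (U : ℝ → ℝ) (q : ℝ) : ℝ :=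
  iteratedDeriv 4 U q / (2 * m * freq m om U q) -
    iteratedDeriv 3 U q * freqD m om U q / (2 * m * freq m om U q ^ 2)

/-- The domain of positive stiffness. -/
def stableDomain (m om : ℝ) (U : ℝ → ℝ) : Set ℝ := {q | 0 < stiffness m om U q}

/-- The classical force, up to sign. -/
def force (m om : ℝ) (U : ℝ → ℝ) : ℝ → ℝ := deriv (potential m om U)

variable {m om : ℝ} {U : ℝ → ℝ}

lemma contDiff_iteratedDeriv (hU : ContDiff ℝ ∞ U) (k : ℕ) : ContDiff ℝ ∞ (iteratedDeriv k U) := by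
  induction k with
  | zero => simpa using hU
  | succ k ih =>
    rw [iteratedDeriv_succ]
    exact (contDiff_infty_iff_deriv.1 ih).2

lemma hasDerivAt_iteratedDeriv (hU : ContDiff ℝ ∞ U) (k : ℕ) (q : ℝ) :
    HasDerivAt (iteratedDeriv k U) (iteratedDeriv (k + 1) U q) q := by
  rw [iteratedDeriv_succ]
  exact ((contDiff_iteratedDeriv hU k).differentiable (by simp) q).hasDerivAt

lemma contDiff_potential (hU : ContDiff ℝ ∞ U) : ContDiff ℝ ∞ (potential m om U) := by
  unfold potential
  fun_prop

lemma force_eq (hU : ContDiff ℝ ∞ U) (q : ℝ) :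
    force m om U q = m * om ^ 2 * q + deriv U q := by
  have h1 : HasDerivAt (fun q : ℝ => m * om ^ 2 * q ^ 2 / 2) (m * om ^ 2 * q) q :=
    (((hasDerivAt_pow 2 q).const_mul (m * om ^ 2)).div_const 2).congr_deriv (by simp; ring)
  exact (h1.add (hU.differentiable (by simp) q).hasDerivAt).deriv

lemma contDiff_force (hU : ContDiff ℝ ∞ U) : ContDiff ℝ ∞ (force m om U) :=
  (contDiff_infty_iff_deriv.1 (contDiff_potential hU)).2

lemma iteratedDeriv_one_potential : iteratedDeriv 1 (potential m om U) = force m om U :=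
  iteratedDeriv_one

lemma iteratedDeriv_two_potential (hU : ContDiff ℝ ∞ U) :
    iteratedDeriv 2 (potential m om U) = fun q => m * om ^ 2 + iteratedDeriv 2 U q := by
  rw [iteratedDeriv_succ, iteratedDeriv_one_potential, funext (force_eq hU)]
  ext q
  have h1 : HasDerivAt (fun q : ℝ => m * om ^ 2 * q) (m * om ^ 2) q := by
    simpa using (hasDerivAt_id q).const_mul (m * om ^ 2)
  have h2 := hasDerivAt_iteratedDeriv hU 1 q
  rw [iteratedDeriv_one] at h2
  exact (h1.add h2).deriv

lemma iteratedDeriv_three_potential (hU : ContDiff ℝ ∞ U) :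
    iteratedDeriv 3 (potential m om U) = iteratedDeriv 3 U := by
  rw [iteratedDeriv_succ, iteratedDeriv_two_potential hU]
  ext q
  rw [deriv_const_add]
  exact (hasDerivAt_iteratedDeriv hU 2 q).deriv

lemma stiffness_eq (hm : 0 < m) (hom : 0 < om) (q : ℝ) :
    stiffness m om U q = (om ^ 2 + iteratedDeriv 2 U q / m) / om ^ 2 := by
  rw [stiffness]; field_simp

lemma freq_sq_pos (hm : 0 < m) (hom : 0 < om) {q : ℝ} (hq : q ∈ stableDomain m om U) :
    0 < om ^ 2 + iteratedDeriv 2 U q / m := by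
  have h : 0 < stiffness m om U q := hq
  rw [stiffness_eq hm hom] at h
  exact (div_pos_iff_of_pos_right (by positivity)).1 h

lemma freq_pos (hm : 0 < m) (hom : 0 < om) {q : ℝ} (hq : q ∈ stableDomain m om U) :
    0 < freq m om U q := Real.sqrt_pos.2 (freq_sq_pos hm hom hq)

lemma freq_sq (hm : 0 < m) (hom : 0 < om) {q : ℝ} (hq : q ∈ stableDomain m om U) :
    freq m om U q ^ 2 = om ^ 2 + iteratedDeriv 2 U q / m :=
  Real.sq_sqrt (freq_sq_pos hm hom hq).le

lemma isOpen_stableDomain (hU : ContDiff ℝ ∞ U) : IsOpen (stableDomain m om U) := by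
  have : Continuous (stiffness m om U) := by
    unfold stiffness
    exact continuous_const.add ((contDiff_iteratedDeriv hU 2).continuous.div_const _)
  exact isOpen_lt continuous_const this

lemma contDiffOn_freq_sq (hU : ContDiff ℝ ∞ U) (O : Set ℝ) :
    ContDiffOn ℝ ∞ (fun q => om ^ 2 + iteratedDeriv 2 U q / m) O :=
  (contDiff_const.add ((contDiff_iteratedDeriv hU 2).div_const m)).contDiffOn

lemma isFrequency_freq (hm : 0 < m) (hom : 0 < om) (hU : ContDiff ℝ ∞ U) :
    IsFrequency m (force m om U) (freq m om U) (stableDomain m om U) where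
  m_pos := hm
  contDiff_force := contDiff_force hU
  isOpen_domain := isOpen_stableDomain hU
  contDiffOn_freq := (contDiffOn_freq_sq hU _).sqrt fun _ hq => (freq_sq_pos hm hom hq).ne'
  freq_pos _ hq := freq_pos hm hom hq

lemma hasDerivAt_freq (hm : 0 < m) (hom : 0 < om) (hU : ContDiff ℝ ∞ U) {q : ℝ}
    (hq : q ∈ stableDomain m om U) : HasDerivAt (freq m om U) (freqD m om U q) q := by
  have h := (((hasDerivAt_iteratedDeriv hU 2 q).div_const m).const_add (om ^ 2)).sqrt
    (freq_sq_pos hm hom hq).ne'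
  refine h.congr_deriv ?_
  have := (freq_pos hm hom hq).ne'
  rw [freqD, ← freq]
  field_simp

lemma hasDerivAt_freqD (hm : 0 < m) (hom : 0 < om) (hU : ContDiff ℝ ∞ U) {q : ℝ}
    (hq : q ∈ stableDomain m om U) : HasDerivAt (freqD m om U) (freqDD m om U q) q := by
  have hw := (freq_pos hm hom hq).ne'
  have h := (hasDerivAt_iteratedDeriv hU 3 q).div
    ((hasDerivAt_freq hm hom hU hq).const_mul (2 * m)) (by positivity)
  refine h.congr_deriv ?_
  rw [freqDD]
  field_simp

/-- The derivative of `m w² = mω² + U''`; it expresses every correction through `w` and its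
derivatives. -/
lemma iteratedDeriv_three_eq (hm : 0 < m) (hom : 0 < om) {q : ℝ} (hq : q ∈ stableDomain m om U) :
    iteratedDeriv 3 U q = 2 * m * freq m om U q * freqD m om U q := by
  have hw := (freq_pos hm hom hq).ne'
  rw [freqD]
  field_simp

/-! ### The expansion of the covariances up to second order -/

lemma transport_eq_partial (m : ℝ) (F : ℝ → ℝ) {φ : ℝ × ℝ → ℝ} {x : ℝ × ℝ}
    (hφ : DifferentiableAt ℝ φ x) :
    transport m F φ x = x.2 / m * deriv (fun q => φ (q, x.2)) x.1 -
      F x.1 * deriv (fun p => φ (x.1, p)) x.2 := by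
  have h1 : HasDerivAt (fun q => φ (q, x.2)) (fderiv ℝ φ x (1, 0)) x.1 :=
    HasFDerivAt.comp_hasDerivAt (f := fun q : ℝ => (q, x.2)) x.1 hφ.hasFDerivAt
      ((hasDerivAt_id x.1).prodMk (hasDerivAt_const x.1 x.2))
  have h2 : HasDerivAt (fun p => φ (x.1, p)) (fderiv ℝ φ x (0, 1)) x.2 :=
    HasFDerivAt.comp_hasDerivAt (f := fun p : ℝ => (x.1, p)) x.2 hφ.hasFDerivAt
      ((hasDerivAt_const x.2 x.1).prodMk (hasDerivAt_id x.2))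
  rw [h1.deriv, h2.deriv, transport]
  have : ((x.2 / m, -F x.1) : ℝ × ℝ) = (x.2 / m) • (1, 0) + (-F x.1) • (0, 1) := by simp
  rw [this, map_add, map_smul, map_smul, smul_eq_mul, smul_eq_mul]
  ring

lemma transport_varianceCoeff_zero (hm : 0 < m) (hom : 0 < om) (hU : ContDiff ℝ ∞ U) {x : ℝ × ℝ}
    (hx : x.1 ∈ stableDomain m om U) :
    transport m (force m om U) (varianceCoeff m (force m om U) (freq m om U) 0) x =
      -(x.2 * freqD m om U x.1 / (2 * m ^ 2 * freq m om U x.1 ^ 2)) := by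
  have h := isFrequency_freq hm hom hU
  have hw := (freq_pos hm hom hx).ne'
  rw [transport_eq_partial _ _ (differentiableAt_of_mem h.isOpen_preimage
    (contDiffOn_varianceCoeff h 0) hx)]
  simp only [varianceCoeff, deriv_const, mul_zero, sub_zero]
  have hd := (hasDerivAt_const x.1 (1 : ℝ)).fun_div ((hasDerivAt_freq hm hom hU hx).const_mul (2 * m))
    (by positivity)
  rw [hd.deriv]
  field_simp
  ring

/-- The second derivative along the flow contains the classical acceleration `-V'/m`, which produces
the term with `force`. This term is what later distinguishes `m q̈` from `A q̈`. -/
lemma transport_transport_varianceCoeff_zero (hm : 0 < m) (hom : 0 < om) (hU : ContDiff ℝ ∞ U)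
    {x : ℝ × ℝ} (hx : x.1 ∈ stableDomain m om U) :
    transport m (force m om U) (transport m (force m om U)
      (varianceCoeff m (force m om U) (freq m om U) 0)) x =
      -(x.2 ^ 2 / (2 * m ^ 3) * (freqDD m om U x.1 / freq m om U x.1 ^ 2 -
        2 * freqD m om U x.1 ^ 2 / freq m om U x.1 ^ 3)) +
        force m om U x.1 * freqD m om U x.1 / (2 * m ^ 2 * freq m om U x.1 ^ 2) := by
  have h := isFrequency_freq hm hom hU
  have hw := (freq_pos hm hom hx).ne'
  rw [transport_eq_partial _ _ (differentiableAt_of_mem h.isOpen_preimage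
    ((contDiffOn_varianceCoeff h 0).transport h.isOpen_preimage h.contDiff_force) hx)]
  have e1 : (fun q => transport m (force m om U)
      (varianceCoeff m (force m om U) (freq m om U) 0) (q, x.2)) =ᶠ[𝓝 x.1]
      fun q => -(x.2 * freqD m om U q / (2 * m ^ 2 * freq m om U q ^ 2)) := by
    filter_upwards [h.isOpen_domain.mem_nhds hx] with q hq
    exact transport_varianceCoeff_zero hm hom hU (x := (q, x.2)) hq
  have e2 : (fun p => transport m (force m om U)
      (varianceCoeff m (force m om U) (freq m om U) 0) (x.1, p)) =
      fun p => -(p * freqD m om U x.1 / (2 * m ^ 2 * freq m om U x.1 ^ 2)) := by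
    ext p
    exact transport_varianceCoeff_zero hm hom hU (x := (x.1, p)) hx
  have d1 : HasDerivAt (fun q => -(x.2 * freqD m om U q / (2 * m ^ 2 * freq m om U q ^ 2))) _ x.1 :=
    (((hasDerivAt_freqD hm hom hU hx).const_mul x.2).fun_div
    (((hasDerivAt_freq hm hom hU hx).fun_pow 2).const_mul (2 * m ^ 2)) (by positivity)).fun_neg
  have d2 : HasDerivAt (fun p : ℝ => -(p * freqD m om U x.1 / (2 * m ^ 2 * freq m om U x.1 ^ 2))) _
    x.2 := (((hasDerivAt_id x.2).mul_const (freqD m om U x.1)).div_const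
      (2 * m ^ 2 * freq m om U x.1 ^ 2)).fun_neg
  rw [e1.deriv_eq, e2, d1.deriv, d2.deriv]
  field_simp
  ring

/-- The recursion for `n = 0`; its first summand drops out since the first order coefficient is
zero. -/
lemma varianceCoeff_two (hm : 0 < m) (hom : 0 < om) (hU : ContDiff ℝ ∞ U) {x : ℝ × ℝ}
    (hx : x.1 ∈ stableDomain m om U) :
    varianceCoeff m (force m om U) (freq m om U) 2 x =
      x.2 ^ 2 * freqDD m om U x.1 / (8 * m ^ 3 * freq m om U x.1 ^ 4) -
        3 * x.2 ^ 2 * freqD m om U x.1 ^ 2 / (16 * m ^ 3 * freq m om U x.1 ^ 5) -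
        force m om U x.1 * freqD m om U x.1 / (8 * m ^ 2 * freq m om U x.1 ^ 4) := by
  have hw := (freq_pos hm hom hx).ne'
  rw [varianceCoeff_add_two]
  simp only [Finset.Nat.antidiagonal_zero, Finset.sum_singleton, zero_add,
    transport_transport_varianceCoeff_zero hm hom hU hx, transport_varianceCoeff_zero hm hom hU hx]
  simp only [varianceCoeff]
  field_simp
  ring

/-! ### The effective mass and potential -/

/-- The effective mass. -/
def effMass (m om : ℝ) (U : ℝ → ℝ) (hbar q : ℝ) : ℝ :=
  m + hbar * iteratedDeriv 3 U q ^ 2 /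
    (2 ^ 5 * m ^ 2 * (om ^ 2 + iteratedDeriv 2 U q / m) ^ (5 / 2 : ℝ))

/-- The effective potential. -/
def effPotential (m om : ℝ) (U : ℝ → ℝ) (hbar q : ℝ) : ℝ :=
  potential m om U q + hbar * om / 2 * (stiffness m om U q) ^ (1 / 2 : ℝ)

lemma effLagrangian_eq (hbar q v : ℝ) : effLagrangian m om U hbar q v =
    effMass m om U hbar q * v ^ 2 / 2 - effPotential m om U hbar q := by
  rw [effLagrangian, effMass, effPotential, potential]; ring

lemma effMass_eq (hm : 0 < m) (hom : 0 < om) (hbar : ℝ) {q : ℝ} (hq : q ∈ stableDomain m om U) :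
    effMass m om U hbar q = m + hbar * (freqD m om U q ^ 2 / (8 * freq m om U q ^ 3)) := by
  have hw := freq_pos hm hom hq
  rw [effMass, ← freq_sq hm hom hq, iteratedDeriv_three_eq hm hom hq, ← Real.rpow_natCast_mul hw.le]
  norm_num
  field_simp
  ring

/-- `ω` times the square root of the stiffness is `w`, so the correction is the zero-point energy of
the local oscillator. -/
lemma effPotential_eq (hm : 0 < m) (hom : 0 < om) (hbar : ℝ) {q : ℝ}
    (hq : q ∈ stableDomain m om U) :
    effPotential m om U hbar q = potential m om U q + hbar * (freq m om U q / 2) := by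
  have hw := freq_pos hm hom hq
  rw [effPotential, stiffness_eq hm hom, ← freq_sq hm hom hq, ← div_pow,
    ← Real.rpow_natCast_mul (by positivity)]
  norm_num
  field_simp

lemma contDiffOn_effMass (hm : 0 < m) (hom : 0 < om) (hU : ContDiff ℝ ∞ U) (hbar : ℝ) :
    ContDiffOn ℝ ∞ (effMass m om U hbar) (stableDomain m om U) := by
  refine contDiffOn_const.add (ContDiffOn.div (contDiffOn_const.mul
    ((contDiff_iteratedDeriv hU 3).contDiffOn.pow 2)) (contDiffOn_const.mul
    ((contDiffOn_freq_sq hU _).rpow_const_of_ne fun q hq => (freq_sq_pos hm hom hq).ne')) ?_)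
  intro q hq
  have := freq_sq_pos hm hom hq
  positivity

lemma contDiffOn_effPotential (hU : ContDiff ℝ ∞ U) (hbar : ℝ) :
    ContDiffOn ℝ ∞ (effPotential m om U hbar) (stableDomain m om U) := by
  refine (contDiff_potential hU).contDiffOn.add (contDiffOn_const.mul
    (ContDiffOn.rpow_const_of_ne ?_ fun q hq => ne_of_gt hq))
  exact (contDiff_const.add ((contDiff_iteratedDeriv hU 2).div_const _)).contDiffOn

lemma effMass_pos (hm : 0 < m) (hom : 0 < om) {hbar : ℝ} (hh : 0 < hbar) {q : ℝ}
    (hq : q ∈ stableDomain m om U) : 0 < effMass m om U hbar q := by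
  have := freq_pos hm hom hq
  rw [effMass_eq hm hom hbar hq]
  positivity

lemma deriv_effMass (hm : 0 < m) (hom : 0 < om) (hU : ContDiff ℝ ∞ U) (hbar : ℝ) {q : ℝ}
    (hq : q ∈ stableDomain m om U) : deriv (effMass m om U hbar) q =
      hbar * (freqD m om U q * freqDD m om U q / (4 * freq m om U q ^ 3) -
        3 * freqD m om U q ^ 3 / (8 * freq m om U q ^ 4)) := by
  have hw := (freq_pos hm hom hq).ne'
  have e : effMass m om U hbar =ᶠ[𝓝 q]
      fun q => m + hbar * (freqD m om U q ^ 2 / (8 * freq m om U q ^ 3)) := by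
    filter_upwards [(isOpen_stableDomain hU).mem_nhds hq] with y hy
    exact effMass_eq hm hom hbar hy
  have d := ((((hasDerivAt_freqD hm hom hU hq).fun_pow 2).fun_div
    (((hasDerivAt_freq hm hom hU hq).fun_pow 3).const_mul 8) (by positivity)).const_mul
      hbar).const_add m
  rw [e.deriv_eq, d.deriv]
  field_simp
  norm_num
  ring

lemma deriv_effPotential (hm : 0 < m) (hom : 0 < om) (hU : ContDiff ℝ ∞ U) (hbar : ℝ) {q : ℝ}
    (hq : q ∈ stableDomain m om U) : deriv (effPotential m om U hbar) q =
      force m om U q + hbar * (freqD m om U q / 2) := by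
  have e : effPotential m om U hbar =ᶠ[𝓝 q]
      fun q => potential m om U q + hbar * (freq m om U q / 2) := by
    filter_upwards [(isOpen_stableDomain hU).mem_nhds hq] with y hy
    exact effPotential_eq hm hom hbar hy
  have d := ((contDiff_potential (m := m) (om := om) hU).differentiable (by simp)
    q).hasDerivAt.fun_add (((hasDerivAt_freq hm hom hU hq).div_const 2).const_mul hbar)
  rw [e.deriv_eq, d.deriv, force]

end Frequency

/-! ### Asymptotic expansions of second order, and limits of coefficients -/

section Asymptotics

open Asymptotics Filter

/-- The polynomial of degree two that begins the series `Φ`. -/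
def jet (Φ : PowerSeries ℝ) (l : ℝ) : ℝ :=
  ∑ j ∈ Finset.range (2 + 1), PowerSeries.coeff j Φ * l ^ j

lemma jet_eq (Φ : PowerSeries ℝ) (l : ℝ) : jet Φ l = PowerSeries.coeff 0 Φ +
    PowerSeries.coeff 1 Φ * l + PowerSeries.coeff 2 Φ * l ^ 2 := by
  simp [jet, Finset.sum_range_succ]

lemma continuous_jet (Φ : PowerSeries ℝ) : Continuous (jet Φ) := by
  unfold jet; fun_prop

lemma isBigO_one_of_continuous {f : ℝ → ℝ} (hf : Continuous f) :
    f =O[𝓝 0] fun _ => (1 : ℝ) := hf.continuousAt.isBigO_one ℝ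

lemma jet_mul_sub (Φ Ψ : PowerSeries ℝ) :
    (fun l => jet Φ l * jet Ψ l - jet (Φ * Ψ) l) =O[𝓝 0] fun l : ℝ => l ^ (2 + 1) := by
  have h : (fun l => jet Φ l * jet Ψ l - jet (Φ * Ψ) l) = fun l : ℝ => l ^ (2 + 1) *
      (PowerSeries.coeff 1 Φ * PowerSeries.coeff 2 Ψ + PowerSeries.coeff 2 Φ * PowerSeries.coeff 1 Ψ +
        PowerSeries.coeff 2 Φ * PowerSeries.coeff 2 Ψ * l) := by
    ext l
    simp only [jet_eq, PowerSeries.coeff_mul, Finset.Nat.antidiagonal_succ,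
      Finset.Nat.antidiagonal_zero]
    simp
    ring
  rw [h]
  simpa using (isBigO_refl (fun l : ℝ => l ^ (2 + 1)) (𝓝 0)).mul
    (isBigO_one_of_continuous (f := fun l : ℝ => PowerSeries.coeff 1 Φ * PowerSeries.coeff 2 Ψ +
      PowerSeries.coeff 2 Φ * PowerSeries.coeff 1 Ψ +
        PowerSeries.coeff 2 Φ * PowerSeries.coeff 2 Ψ * l) (by fun_prop))

/-- The pairs of a formal series and a function that it represents up to second order. -/
def expansionRing : Subring (PowerSeries ℝ × (ℝ → ℝ)) where
  carrier := {P | (fun l => P.2 l - jet P.1 l) =O[𝓝 0] fun l : ℝ => l ^ (2 + 1)}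
  mul_mem' := fun {P R} hP hR => by
    have hcube : (fun l : ℝ => l ^ (2 + 1)) =O[𝓝 0] fun _ => (1 : ℝ) :=
      isBigO_one_of_continuous (by fun_prop)
    have hP1 : P.2 =O[𝓝 0] fun _ => (1 : ℝ) := by
      have := (Asymptotics.IsBigO.trans hP hcube).add
        (isBigO_one_of_continuous (continuous_jet P.1))
      simpa using this
    have h1 := hP1.mul hR
    have h2 := Asymptotics.IsBigO.mul hP (isBigO_one_of_continuous (continuous_jet R.1))
    have h3 := (h1.add (by simpa using h2)).add (by simpa using jet_mul_sub P.1 R.1)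
    refine IsBigO.congr h3 (fun l => ?_) (fun l => by simp)
    simp only [Prod.snd_mul, Prod.fst_mul, Pi.mul_apply]
    ring
  one_mem' := by
    refine IsBigO.congr_left (isBigO_zero _ _) fun l => ?_
    simp [jet_eq, PowerSeries.coeff_one]
  add_mem' := fun {P R} hP hR => by
    refine IsBigO.congr_left (Asymptotics.IsBigO.add hP hR) fun l => ?_
    simp [jet_eq]; ring
  zero_mem' := by
    refine IsBigO.congr_left (isBigO_zero _ _) fun l => ?_
    simp [jet_eq]
  neg_mem' := fun {P} hP => by
    refine IsBigO.congr_left (Asymptotics.IsBigO.neg_left hP) fun l => ?_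
    simp [jet_eq]; ring

lemma mem_expansionRing {Φ : PowerSeries ℝ} {φ : ℝ → ℝ} : (Φ, φ) ∈ expansionRing ↔
    (fun l => φ l - jet Φ l) =O[𝓝 0] fun l : ℝ => l ^ (2 + 1) := Iff.rfl

lemma jet_mem_expansionRing (Φ : PowerSeries ℝ) : (Φ, jet Φ) ∈ expansionRing := by
  rw [mem_expansionRing]
  simpa using isBigO_zero _ _

/-- Division in the ring of expansions. -/
lemma div_mem_expansionRing {Φ Ψ Θ : PowerSeries ℝ} {φ ψ : ℝ → ℝ} (h : Φ * Θ = Ψ)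
    (hφ : (Φ, φ) ∈ expansionRing) (hψ : (Ψ, ψ) ∈ expansionRing) (hc : ContinuousAt φ 0)
    (h0 : φ 0 ≠ 0) : (Θ, fun l => ψ l / φ l) ∈ expansionRing := by
  -- Since `Ψ = ΦΘ` exactly, the difference `ψ - φ · jet Θ` represents the zero series and is of
  -- third order; it remains so after division by `φ`, which is nonzero near `0`.
  have h1 := expansionRing.sub_mem hψ (expansionRing.mul_mem hφ (jet_mem_expansionRing Θ))
  rw [Prod.mk_mul_mk, h, Prod.mk_sub_mk, sub_self, mem_expansionRing] at h1
  have h2 : (fun l => (φ l)⁻¹) =O[𝓝 0] fun _ => (1 : ℝ) :=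
    (hc.inv₀ h0).isBigO_one ℝ
  rw [mem_expansionRing]
  refine (h1.mul h2).congr' ?_ (by simp)
  filter_upwards [hc.eventually_ne h0] with l hl
  simp [jet_eq]
  field_simp

/-- The pairs of a family of formal series, and the limit of its coefficients up to second order. -/
def limitRing : Subring ((ℝ → PowerSeries ℝ) × PowerSeries ℝ) where
  carrier := {P | ∀ j ≤ 2, Tendsto (fun τ => PowerSeries.coeff j (P.1 τ)) (𝓝 0)
    (𝓝 (PowerSeries.coeff j P.2))}
  mul_mem' := fun {P R} hP hR j hj => by
    simp only [Prod.fst_mul, Prod.snd_mul, Pi.mul_apply, PowerSeries.coeff_mul]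
    refine tendsto_finsetSum _ fun a ha => ?_
    have := Finset.HasAntidiagonal.mem_antidiagonal.1 ha
    exact (hP a.1 (by omega)).mul (hR a.2 (by omega))
  one_mem' := fun j _ => by simp
  add_mem' := fun {P R} hP hR j hj => by simpa using (hP j hj).add (hR j hj)
  zero_mem' := fun j _ => by simp
  neg_mem' := fun {P} hP j hj => by simpa using (hP j hj).neg

/-- Functions that are smooth at a point. -/
def smoothAt (x : ℝ × ℝ) : Subring (ℝ × ℝ → ℝ) where
  carrier := {φ | ContDiffAt ℝ ∞ φ x}
  mul_mem' := fun {φ ψ} (h1 : ContDiffAt ℝ ∞ φ x) (h2 : ContDiffAt ℝ ∞ ψ x) => h1.mul h2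
  one_mem' := (contDiffAt_const : ContDiffAt ℝ ∞ (fun _ => (1 : ℝ)) x)
  add_mem' := fun {φ ψ} (h1 : ContDiffAt ℝ ∞ φ x) (h2 : ContDiffAt ℝ ∞ ψ x) => h1.add h2
  zero_mem' := (contDiffAt_const : ContDiffAt ℝ ∞ (fun _ => (0 : ℝ)) x)
  neg_mem' := fun {φ} (h : ContDiffAt ℝ ∞ φ x) => h.neg

end Asymptotics

/-! ### The vacuum moments -/

/-- Without correlation each recursion advances one index by two and leaves the other fixed, so the
moments are products of double factorials `(2n)!/(2^n n!)` with powers of the two variances. -/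
lemma gaussMoment_vacuum {k : ℝ} (hk : 0 < k) (b a : ℕ) :
    gaussMoment (1 / (2 * k)) 0 (k / 2) b a =
      if Even b ∧ Even a then
        k ^ (((a : ℝ) - (b : ℝ)) / 2) * ((a.factorial : ℝ) * (b.factorial : ℝ)) /
          (2 ^ (b + a) * (((a / 2).factorial : ℝ) * ((b / 2).factorial : ℝ)))
      else 0 := by
  have aux : ∀ b a : ℕ, gaussMoment (1 / (2 * k)) 0 (k / 2) (2 * b) (2 * a) =
      k ^ ((a : ℝ) - b) * (((2 * a).factorial : ℝ) * ((2 * b).factorial : ℝ)) /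
          (2 ^ (2 * b + 2 * a) * ((a.factorial : ℝ) * (b.factorial : ℝ))) := by
    intro b
    induction b with
    | zero =>
      intro a
      induction a with
      | zero => simp
      | succ a ih =>
        rw [mul_zero] at ih
        rw [mul_zero, show 2 * (a + 1) = 2 * a + 1 + 1 by ring, gaussMoment_succ_right]
        simp only [Nat.add_sub_cancel, ih, Nat.factorial_succ]
        push_cast
        rw [show ((a : ℝ) + 1 - 0) = (a - 0) + 1 by ring, Real.rpow_add hk, Real.rpow_one]
        field_simp
        ring
    | succ b ih =>
      intro a
      rw [show 2 * (b + 1) = 2 * b + 1 + 1 by ring, gaussMoment_succ_left]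
      simp only [Nat.add_sub_cancel, ih, Nat.factorial_succ]
      push_cast
      rw [show ((a : ℝ) - b) = (a - (b + 1)) + 1 by ring, Real.rpow_add hk, Real.rpow_one]
      field_simp
      ring
  have hodd : ∀ b a : ℕ, gaussMoment (1 / (2 * k)) 0 (k / 2) (2 * b + 1) a = 0 := by
    intro b a
    induction b with
    | zero => rw [gaussMoment_succ_left]; simp
    | succ b ih =>
      rw [show 2 * (b + 1) + 1 = 2 * b + 1 + 1 + 1 by ring, gaussMoment_succ_left,
        show 2 * b + 1 + 1 - 1 = 2 * b + 1 from rfl, ih]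
      simp
  split_ifs with h
  · obtain ⟨⟨b, rfl⟩, ⟨a, rfl⟩⟩ := h
    rw [← two_mul, ← two_mul, aux]
    simp only [Nat.mul_div_cancel_left _ two_pos]
    push_cast
    rw [show ((2 * a - 2 * b : ℝ) / 2) = a - b by ring]
  · rcases Nat.even_or_odd b with hb | ⟨b, rfl⟩
    · rcases Nat.even_or_odd a with ha | ha
      · exact absurd ⟨hb, ha⟩ h
      · exact gaussMoment_eq_zero_of_odd _ _ _ _ _ (hb.add_odd ha)
    · exact hodd b a

/-! ### The effective system of the anharmonic oscillator -/

section System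

variable {m om : ℝ} {U : ℝ → ℝ}

/-- The Gaussian moments of the anharmonic oscillator, divided by `ℏ^{(b+a)/2}`. -/
def oscillatorMoment (m om : ℝ) (U : ℝ → ℝ) (x : ℝ × ℝ) (b a : ℕ) : PowerSeries ℝ :=
  momentSeries m (force m om U) (freq m om U) b a x

/-- The adiabatic effective system of the anharmonic oscillator. Its states are Gaussian. -/
def oscillatorSystem (m om : ℝ) (U : ℝ → ℝ) : EffectiveData where
  M := {x | 0 < stiffness m om U x.1}
  -- The Euler-Lagrange equation of the effective action, solved exactly for `m q̈` without
  -- expansion in `ℏ`.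
  X hbar x := (x.2 / m, -(m / effMass m om U hbar x.1) * (deriv (effPotential m om U hbar) x.1 +
    deriv (effMass m om U hbar) x.1 / 2 * (x.2 / m) ^ 2))
  G x := homogeneous (oscillatorMoment m om U x)
  -- Only variance and correlation are prescribed, truncated at second order; the momentum variance
  -- is then forced by purity.
  state l hbar x := gaussianState hbar (jet (varianceSeries m (force m om U) (freq m om U) x) l)
    (jet (correlationSeries m (force m om U) (freq m om U) x) l) x.1 x.2

lemma cf_homogeneous (g : ℕ → ℕ → PowerSeries ℝ) (b a j N : ℕ) :
    cf j N (homogeneous g b a) = if N = b + a then PowerSeries.coeff j (g b a) else 0 := by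
  rw [cf, coeff_homogeneous]
  split_ifs <;> simp

lemma oscillatorMoment_zero_zero (x : ℝ × ℝ) : oscillatorMoment m om U x 0 0 = 1 := by
  simp [oscillatorMoment, momentSeries]

lemma oscillatorMoment_odd (x : ℝ × ℝ) (b a : ℕ) (h : Odd (b + a)) :
    oscillatorMoment m om U x b a = 0 := gaussMoment_eq_zero_of_odd _ _ _ b a h

lemma oscillatorMoment_two_zero (x : ℝ × ℝ) : oscillatorMoment m om U x 2 0 =
    varianceSeries m (force m om U) (freq m om U) x := by
  rw [oscillatorMoment, momentSeries, gaussMoment_succ_left]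
  simp

lemma partialQ_homogeneous (g : ℝ × ℝ → ℕ → ℕ → PowerSeries ℝ) (b a : ℕ) (x : ℝ × ℝ) :
    partialQ (fun y => homogeneous (g y) b a) x = PowerSeries.C (PowerSeries.mk fun j =>
      deriv (fun q => PowerSeries.coeff j (g (q, x.2) b a)) x.1) * PowerSeries.X ^ (b + a) := by
  ext N j
  rw [partialQ, PowerSeries.coeff_mk, PowerSeries.coeff_mk, PowerSeries.coeff_C_mul,
    PowerSeries.coeff_X_pow]
  simp only [cf_homogeneous]
  split_ifs <;> simp

lemma partialP_homogeneous (g : ℝ × ℝ → ℕ → ℕ → PowerSeries ℝ) (b a : ℕ) (x : ℝ × ℝ) :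
    partialP (fun y => homogeneous (g y) b a) x = PowerSeries.C (PowerSeries.mk fun j =>
      deriv (fun p => PowerSeries.coeff j (g (x.1, p) b a)) x.2) * PowerSeries.X ^ (b + a) := by
  ext N j
  rw [partialP, PowerSeries.coeff_mk, PowerSeries.coeff_mk, PowerSeries.coeff_C_mul,
    PowerSeries.coeff_X_pow]
  simp only [cf_homogeneous]
  split_ifs <;> simp

/-- Moments are homogeneous in `ℏ^{1/2}`, so in leading order `ẋ^i ∂_i` acts as the classical flow
and `momentSeries_transport` applies; corrections to `ṗ` could only matter in higher orders. -/
lemma oscillator_adiabatic (hm : 0 < m) (hom : 0 < om) (hU : ContDiff ℝ ∞ U) {x : ℝ × ℝ}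
    (hx : x.1 ∈ stableDomain m om U) (b a N : ℕ) (hN : N ≤ momentOrder 1 (b + a)) :
    PowerSeries.coeff N (adiab *
      (flowQ (hamiltonian m om U) x (homogeneous (oscillatorMoment m om U x)) *
        partialQ (fun y => homogeneous (oscillatorMoment m om U y) b a) x +
      flowP (hamiltonian m om U) x (homogeneous (oscillatorMoment m om U x)) *
        partialP (fun y => homogeneous (oscillatorMoment m om U y) b a) x)) =
    PowerSeries.coeff N
      (flowG (hamiltonian m om U) x (homogeneous (oscillatorMoment m om U x)) b a) := by
  have h := isFrequency_freq hm hom hU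
  have hM := h.isOpen_preimage
  have h00 := oscillatorMoment_zero_zero (m := m) (om := om) (U := U) x
  have hodd := oscillatorMoment_odd (m := m) (om := om) (U := U) x
  have hf : m * freq m om U x.1 ^ 2 = iteratedDeriv 2 (potential m om U) x.1 := by
    rw [freq_sq hm hom hx, iteratedDeriv_two_potential hU]; field_simp
  rw [coeff_flowG hm.ne' h00 hodd x b a N hN, partialQ_homogeneous, partialP_homogeneous,
    flowQ_eq hm.ne' h00 (hodd 0 1 (by decide)), adiab, PowerSeries.coeff_C_mul, map_add,
    PowerSeries.coeff_C_mul, PowerSeries.coeff_C_mul, PowerSeries.coeff_X_pow,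
    ← mul_assoc (flowP _ _ _), PowerSeries.coeff_mul_X_pow']
  set dq : PowerSeries ℝ := PowerSeries.mk fun j =>
    deriv (fun q => PowerSeries.coeff j (oscillatorMoment m om U (q, x.2) b a)) x.1 with hdq
  set dp : PowerSeries ℝ := PowerSeries.mk fun j =>
    deriv (fun p => PowerSeries.coeff j (oscillatorMoment m om U (x.1, p) b a)) x.2 with hdp
  rw [PowerSeries.coeff_mul_C, coeff_flowP hm.ne']
  rcases lt_trichotomy N (b + a) with hlt | heq | hgt
  · rw [if_neg hlt.ne, if_neg (by omega), if_neg hlt.ne]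
    simp
  · have key := momentSeries_transport h hx b a
    have htr : transportSeries m (force m om U)
        (momentSeries m (force m om U) (freq m om U) b a) x =
        PowerSeries.C (x.2 / m) * dq - PowerSeries.C (force m om U x.1) * dp := by
      ext j
      rw [transportSeries, PowerSeries.coeff_mk, transport_eq_partial _ _
        (differentiableAt_of_mem hM (momentSeries_mem h b a j) hx), map_sub,
        PowerSeries.coeff_C_mul, PowerSeries.coeff_C_mul, hdq, hdp, PowerSeries.coeff_mk,
        PowerSeries.coeff_mk]
      rfl
    rw [htr, hf] at key
    subst heq
    simp only [if_true, le_refl, Nat.sub_self, h00, zero_add, iteratedDeriv_one_potential]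
    simp only [oscillatorMoment]
    rw [← key, PowerSeries.smul_eq_C_mul]
    simp
    ring
  · rw [if_neg hgt.ne', if_pos hgt.le, if_neg hgt.ne']
    rw [momentOrder] at hN
    -- Now `b + a < N ≤ 3`. For degree two the coefficient of order `ℏ^{1/2}` of `ṗ` enters, an odd
    -- moment; for lower degree the moment is constant.
    by_cases hn : b + a = 2
    · have : N - (b + a) = 1 := by omega
      rw [this, hodd 1 0 (by decide)]
      simp
    · have hdp0 : dp = 0 := by
        ext j
        rw [hdp, PowerSeries.coeff_mk]
        obtain ⟨rfl, rfl⟩ | h1 : (b = 0 ∧ a = 0) ∨ b + a = 1 := by omega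
        · simp [oscillatorMoment_zero_zero]
        · have : ∀ y, oscillatorMoment m om U y b a = 0 := fun y =>
            oscillatorMoment_odd y b a (by rw [h1]; decide)
          simp [this]
      rw [hdp0]
      simp

lemma truncEval_flowQ (hm : m ≠ 0) (hbar : ℝ) (x : ℝ × ℝ) :
    truncEval 2 3 hbar (flowQ (hamiltonian m om U) x (homogeneous (oscillatorMoment m om U x))) =
      x.2 / m := by
  rw [flowQ_eq hm (oscillatorMoment_zero_zero x) (oscillatorMoment_odd x 0 1 (by decide))]
  simp [truncEval, cf, Finset.sum_range_succ, PowerSeries.coeff_C]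

/-- Half-integer orders carry odd moments and vanish, and the first adiabatic order of the variance
is zero. -/
lemma truncEval_flowP (hm : 0 < m) (hU : ContDiff ℝ ∞ U) {hbar : ℝ} (hh : 0 < hbar) (x : ℝ × ℝ) :
    truncEval 2 3 hbar (flowP (hamiltonian m om U) x (homogeneous (oscillatorMoment m om U x))) =
      -force m om U x.1 - hbar * (iteratedDeriv 3 U x.1 / 2 *
        (varianceCoeff m (force m om U) (freq m om U) 0 x +
          varianceCoeff m (force m om U) (freq m om U) 2 x)) := by
  have h1 : varianceCoeff m (force m om U) (freq m om U) 1 x = 0 := by rw [varianceCoeff]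
  have hs : Real.sqrt hbar ^ 2 = hbar := Real.sq_sqrt hh.le
  simp only [truncEval, cf, Finset.sum_range_succ, Finset.sum_range_zero, coeff_flowP hm.ne',
    oscillatorMoment_zero_zero, oscillatorMoment_two_zero,
    oscillatorMoment_odd x 1 0 (by decide), oscillatorMoment_odd x 3 0 (by decide), hs]
  simp [varianceSeries, iteratedDeriv_three_potential hU, h1, PowerSeries.coeff_one]
  rw [force]
  ring

/-- With `A = m + ℏμ` and `B' + A' q̇²/2 = F + ℏb`, the effective force is `-m (F + ℏb)/(m + ℏμ)`.
Its expansion to first order in `ℏ` is `-F - ℏ (b - μF/m)`, which is the truncated quantum force. -/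
lemma oscillator_almost_preserved (hm : 0 < m) (hom : 0 < om) (hU : ContDiff ℝ ∞ U) {x : ℝ × ℝ}
    (hx : x.1 ∈ stableDomain m om U) :
    (fun hbar => ((oscillatorSystem m om U).X hbar x).2 - truncEval 2 3 hbar
      (flowP (hamiltonian m om U) x (homogeneous (oscillatorMoment m om U x))))
      =O[𝓝[>] 0] fun hbar : ℝ => hbar ^ (1 + 1) := by
  have hw := freq_pos hm hom hx
  set w := freq m om U x.1 with hwdef
  set w1 := freqD m om U x.1 with hw1
  set w2 := freqDD m om U x.1 with hw2
  set F := force m om U x.1 with hF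
  set μ := w1 ^ 2 / (8 * w ^ 3) with hμ
  set μ' := w1 * w2 / (4 * w ^ 3) - 3 * w1 ^ 3 / (8 * w ^ 4) with hμ'
  set b := w1 / 2 + μ' / 2 * (x.2 / m) ^ 2 with hb
  have hμ0 : 0 ≤ μ := by positivity
  -- The exact remainder is `ℏ² (μb - μ²F/m)/(m + ℏμ)`, and `m + ℏμ ≥ m`.
  refine Asymptotics.IsBigO.of_bound (|μ * b - μ ^ 2 * F / m| / m) ?_
  filter_upwards [self_mem_nhdsWithin] with hbar hh
  have hh : 0 < hbar := hh
  have hA : 0 < m + hbar * μ := by positivity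
  have hval : ((oscillatorSystem m om U).X hbar x).2 - truncEval 2 3 hbar
      (flowP (hamiltonian m om U) x (homogeneous (oscillatorMoment m om U x))) =
      hbar ^ 2 * ((μ * b - μ ^ 2 * F / m) / (m + hbar * μ)) := by
    -- The decisive match: the zeroth order of the variance gives the zero-point force `w'/2`, the
    -- second order the velocity term of the effective mass and the shift `-μF/m` of the inertia.
    have e2 : iteratedDeriv 3 U x.1 / 2 * (varianceCoeff m (force m om U) (freq m om U) 0 x +
          varianceCoeff m (force m om U) (freq m om U) 2 x) = b - μ * F / m := by
      have h0 : varianceCoeff m (force m om U) (freq m om U) 0 x = 1 / (2 * m * w) := by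
        rw [varianceCoeff]
      rw [varianceCoeff_two hm hom hU hx, iteratedDeriv_three_eq hm hom hx, h0, ← hwdef, ← hw1, ← hw2, ← hF, hb, hμ', hμ]
      field_simp
      ring
    rw [truncEval_flowP hm hU hh, e2]
    simp only [oscillatorSystem]
    rw [deriv_effPotential hm hom hU hbar hx, deriv_effMass hm hom hU hbar hx,
      effMass_eq hm hom hbar hx, ← hwdef, ← hw1, ← hw2, ← hF, ← hμ, ← hμ']
    have e3 : F + hbar * (w1 / 2) + hbar * μ' / 2 * (x.2 / m) ^ 2 = F + hbar * b := by
      rw [hb]; ring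
    rw [e3]
    clear_value b μ' μ F
    field_simp
    ring
  rw [hval, norm_mul, norm_div, mul_comm, Real.norm_eq_abs (_ - _), Real.norm_of_nonneg hA.le]
  gcongr
  nlinarith

/-! ### The states -/

lemma jet_variance_zero (x : ℝ × ℝ) :
    jet (varianceSeries m (force m om U) (freq m om U) x) 0 = 1 / (2 * m * freq m om U x.1) := by
  simp [jet_eq, varianceSeries, varianceCoeff]

lemma contDiffOn_jet {M : Set (ℝ × ℝ)} {Φ : ℝ × ℝ → PowerSeries ℝ} (hΦ : Φ ∈ smoothSeries M)
    (l : ℝ) : ContDiffOn ℝ ∞ (fun x => jet (Φ x) l) M :=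
  ContDiffOn.sum fun j _ => (hΦ j).mul contDiffOn_const

lemma eventually_jet_variance_pos (hm : 0 < m) (hom : 0 < om) (hU : ContDiff ℝ ∞ U) {x : ℝ × ℝ}
    (hx : x.1 ∈ stableDomain m om U) : ∀ᶠ l in 𝓝 (0 : ℝ), ∀ᶠ y in 𝓝 x,
      0 < jet (varianceSeries m (force m om U) (freq m om U) y) l := by
  have h := isFrequency_freq hm hom hU
  have hw := freq_pos hm hom hx
  have h0 : 0 < jet (varianceSeries m (force m om U) (freq m om U) x) 0 := by
    rw [jet_variance_zero]; positivity
  filter_upwards [continuousAt_const.eventually_lt (continuous_jet _).continuousAt h0] with l hl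
  have hc : ContinuousAt (fun y => jet (varianceSeries m (force m om U) (freq m om U) y) l) x :=
    ((contDiffOn_jet (varianceSeries_mem h) l).contDiffAt
      (h.isOpen_preimage.mem_nhds hx)).continuousAt
  exact continuousAt_const.eventually_lt hc hl

end System

/-! ### Smoothness and expansion of the Gaussian states, and the effective motions. -/

section States

lemma gaussMoment_apply {ι R : Type*} [CommRing R] (Y C P : ι → R) (b a : ℕ) (i : ι) :
    gaussMoment Y C P b a i = gaussMoment (Y i) (C i) (P i) b a :=
  map_gaussMoment Y C P (Pi.evalRingHom (fun _ => R) i) b a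

lemma gaussMoment_fst {R S : Type*} [CommRing R] [CommRing S] (Y C P : R × S) (b a : ℕ) :
    (gaussMoment Y C P b a).1 = gaussMoment Y.1 C.1 P.1 b a :=
  map_gaussMoment Y C P (RingHom.fst R S) b a

lemma gaussMoment_snd {R S : Type*} [CommRing R] [CommRing S] (Y C P : R × S) (b a : ℕ) :
    (gaussMoment Y C P b a).2 = gaussMoment Y.2 C.2 P.2 b a :=
  map_gaussMoment Y C P (RingHom.snd R S) b a

variable {m om : ℝ} {U : ℝ → ℝ}

lemma quantumVariable_state {hbar l : ℝ} (hh : 0 < hbar) {x : ℝ × ℝ}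
    (hl : 0 < jet (varianceSeries m (force m om U) (freq m om U) x) l) (b a : ℕ) :
    quantumVariable hbar ((oscillatorSystem m om U).state l hbar x) b a =
      Real.sqrt hbar ^ (b + a) *
        gaussMoment (jet (varianceSeries m (force m om U) (freq m om U) x) l)
          (jet (correlationSeries m (force m om U) (freq m om U) x) l)
          ((1 / 4 + jet (correlationSeries m (force m om U) (freq m om U) x) l ^ 2) /
            jet (varianceSeries m (force m om U) (freq m om U) x) l) b a :=
  (gaussianState_spec hh hl _ x.1 x.2).2.2.2 b a

lemma oscillator_state_smooth (hm : 0 < m) (hom : 0 < om) (hU : ContDiff ℝ ∞ U) {x : ℝ × ℝ}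
    (hx : x.1 ∈ stableDomain m om U) {hbar : ℝ} (hh : 0 < hbar) :
    ∀ᶠ l in 𝓝 (0 : ℝ), ∀ b a, ContDiffAt ℝ ∞
      (fun y => quantumVariable hbar ((oscillatorSystem m om U).state l hbar y) b a) x := by
  have h := isFrequency_freq hm hom hU
  have hM := h.isOpen_preimage.mem_nhds hx
  filter_upwards [eventually_jet_variance_pos hm hom hU hx] with l hl b a
  have hy : ContDiffAt ℝ ∞ (fun y => jet (varianceSeries m (force m om U) (freq m om U) y) l) x :=
    (contDiffOn_jet (varianceSeries_mem h) l).contDiffAt hM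
  have hc : ContDiffAt ℝ ∞
      (fun y => jet (correlationSeries m (force m om U) (freq m om U) y) l) x :=
    (contDiffOn_jet (correlationSeries_mem h) l).contDiffAt hM
  have hp := (contDiffAt_const (c := (1 / 4 : ℝ)).add (hc.pow 2)).div hy hl.self_of_nhds.ne'
  have key : ContDiffAt ℝ ∞ (gaussMoment _ _ _ b a) x :=
    gaussMoment_mem _ _ _ (smoothAt x) hy hc hp b a
  refine (contDiffAt_const (c := Real.sqrt hbar ^ (b + a)).mul key).congr_of_eventuallyEq ?_
  filter_upwards [hl] with y hly
  rw [quantumVariable_state hh hly, gaussMoment_apply]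
  rfl

/-- Variance and correlation of the state are jets by construction. Its momentum variance is the
quotient `(1/4 + C²)/Y` of truncations, which represents the series `P` because `YP = 1/4 + C²`
holds for the series. -/
lemma moment_mem_expansionRing (hm : 0 < m) (hom : 0 < om) (hU : ContDiff ℝ ∞ U) {x : ℝ × ℝ}
    (hx : x.1 ∈ stableDomain m om U) (b a : ℕ) :
    (oscillatorMoment m om U x b a, fun l =>
        gaussMoment (jet (varianceSeries m (force m om U) (freq m om U) x) l)
          (jet (correlationSeries m (force m om U) (freq m om U) x) l)
          ((1 / 4 + jet (correlationSeries m (force m om U) (freq m om U) x) l ^ 2) /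
            jet (varianceSeries m (force m om U) (freq m om U) x) l) b a) ∈ expansionRing := by
  have h := isFrequency_freq hm hom hU
  have hw := freq_pos hm hom hx
  set Y := varianceSeries m (force m om U) (freq m om U) x with hY
  set C := correlationSeries m (force m om U) (freq m om U) x
  set P := momentumSeries m (force m om U) (freq m om U) x
  have hYP : Y * P = PowerSeries.C (1 / 4) + C ^ 2 := by
    rw [← varianceSeries_mul_momentumSeries h hx]; ring
  have hq : ((PowerSeries.C (1 / 4) + C ^ 2, fun l => 1 / 4 + jet C l ^ 2) :
      PowerSeries ℝ × (ℝ → ℝ)) ∈ expansionRing := by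
    have h1 : ((PowerSeries.C (1 / 4), fun _ => 1 / 4) : PowerSeries ℝ × (ℝ → ℝ)) ∈
        expansionRing := by
      convert jet_mem_expansionRing (PowerSeries.C (1 / 4 : ℝ)) using 2
      ext l
      simp [jet_eq, PowerSeries.coeff_C]
    exact expansionRing.add_mem h1 (expansionRing.pow_mem (jet_mem_expansionRing C) 2)
  have h0 : jet Y 0 ≠ 0 := by
    rw [hY, jet_variance_zero]; positivity
  have hP := div_mem_expansionRing hYP (jet_mem_expansionRing Y) hq
    (continuous_jet Y).continuousAt h0
  have key := gaussMoment_mem _ _ _ expansionRing (jet_mem_expansionRing Y)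
    (jet_mem_expansionRing C) hP b a
  convert key using 1
  refine Prod.ext ?_ (funext fun l => ?_)
  · rw [gaussMoment_fst]
    rfl
  · rw [gaussMoment_snd, gaussMoment_apply]

lemma oscillator_state_expansion (hm : 0 < m) (hom : 0 < om) (hU : ContDiff ℝ ∞ U) {x : ℝ × ℝ}
    (hx : x.1 ∈ stableDomain m om U) {hbar : ℝ} (hh : 0 < hbar) (b a : ℕ) :
    (fun l => quantumVariable hbar ((oscillatorSystem m om U).state l hbar x) b a -
      ∑ j ∈ Finset.range (2 + 1), PowerSeries.coeff j (oscillatorMoment m om U x b a) *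
        Real.sqrt hbar ^ (b + a) * l ^ j) =O[𝓝 0] fun l : ℝ => l ^ (2 + 1) := by
  have h := (mem_expansionRing.1 (moment_mem_expansionRing hm hom hU hx b a)).const_mul_left
    (Real.sqrt hbar ^ (b + a))
  refine h.congr' ?_ Filter.EventuallyEq.rfl
  filter_upwards [eventually_jet_variance_pos hm hom hU hx] with l hl
  rw [quantumVariable_state hh hl.self_of_nhds, mul_sub, jet.eq_1 (oscillatorMoment m om U x b a), Finset.mul_sum]
  exact congrArg _ (Finset.sum_congr rfl fun j _ => by ring)

lemma contDiffOn_oscillatorSystem_X (hm : 0 < m) (hom : 0 < om) (hU : ContDiff ℝ ∞ U) {hbar : ℝ}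
    (hh : 0 < hbar) :
    ContDiffOn ℝ ∞ ((oscillatorSystem m om U).X hbar) (oscillatorSystem m om U).M := by
  have hO : IsOpen (stableDomain m om U) := isOpen_stableDomain hU
  have comp : ∀ {f : ℝ → ℝ}, ContDiffOn ℝ ∞ f (stableDomain m om U) →
      ContDiffOn ℝ ∞ (fun x : ℝ × ℝ => f x.1) (oscillatorSystem m om U).M :=
    fun hf => hf.comp contDiffOn_fst fun _ hx => hx
  have hv : ContDiffOn ℝ ∞ (fun x : ℝ × ℝ => x.2 / m) (oscillatorSystem m om U).M :=
    contDiffOn_snd.div_const m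
  have hA := contDiffOn_effMass hm hom hU hbar
  have hB := contDiffOn_effPotential (m := m) (om := om) hU hbar
  exact hv.prodMk ((contDiffOn_const.div (comp hA) fun x hx =>
    (effMass_pos hm hom hh hx).ne').neg.mul ((comp (hB.deriv_of_isOpen hO (by simp))).add
      (((comp (hA.deriv_of_isOpen hO (by simp))).div_const 2).mul (hv.pow 2))))

theorem isAdiabaticEffectiveSystem_oscillator (hm : 0 < m) (hom : 0 < om) (hU : ContDiff ℝ ∞ U) :
    IsAdiabaticEffectiveSystem 2 1 (hamiltonian m om U) (oscillatorSystem m om U) where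
  isOpen_M := (isFrequency_freq hm hom hU).isOpen_preimage
  smooth_X _ hh := contDiffOn_oscillatorSystem_X hm hom hU hh
  smooth_G b a j N := by
    simp only [oscillatorSystem, cf_homogeneous]
    split_ifs
    · exact momentSeries_mem (isFrequency_freq hm hom hU) b a j
    · exact contDiffOn_const
  G_zero x _ := by
    simp [oscillatorSystem, homogeneous, oscillatorMoment_zero_zero,
      oscillatorMoment_odd x 1 0 (by decide), oscillatorMoment_odd x 0 1 (by decide)]
  G_order x _ b a := dvd_mul_left _ _
  adiabatic x hx b a j N hN :=
    congrArg (PowerSeries.coeff j) (oscillator_adiabatic hm hom hU hx b a N hN)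
  almost_preserved x hx := by
    refine ⟨?_, oscillator_almost_preserved hm hom hU hx⟩
    refine (Asymptotics.isBigO_zero _ _).congr_left fun hbar => ?_
    exact (sub_eq_zero.2 (truncEval_flowQ hm.ne' hbar x).symm).symm
  state_mem x hx hbar hh := by
    filter_upwards [eventually_jet_variance_pos hm hom hU hx] with l hl
    filter_upwards [hl] with y hy
    obtain ⟨h1, h2, h3, -⟩ := gaussianState_spec hh hy
      (jet (correlationSeries m (force m om U) (freq m om U) y) l) y.1 y.2
    exact ⟨h1, h2, h3⟩
  state_smooth x hx hbar hh := oscillator_state_smooth hm hom hU hx hh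
  state_G x hx b a := by
    -- The adiabatic coefficients of the state's moments are exact multiples of `ℏ^{(b+a)/2}`, so
    -- the error of the expansion in `ℏ` is zero.
    refine ⟨fun j hbar => PowerSeries.coeff j (oscillatorMoment m om U x b a) *
      Real.sqrt hbar ^ (b + a), fun hbar hh => oscillator_state_expansion hm hom hU hx hh b a,
      fun j _ => (Asymptotics.isBigO_zero _ _).congr_left fun hbar => ?_⟩
    simp only [oscillatorSystem, cf_homogeneous, ite_mul, zero_mul]
    rw [Finset.sum_ite_eq', if_pos (by rw [Finset.mem_range, momentOrder]; omega), sub_self]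

theorem isEffectiveMotion_oscillator_iff (hm : 0 < m) (hom : 0 < om) (hU : ContDiff ℝ ∞ U)
    {hbar : ℝ} (hh : 0 < hbar) (t₀ t₁ : ℝ) (q : ℝ → ℝ) :
    (∃ p : ℝ → ℝ, IsEffectiveMotion (oscillatorSystem m om U) hbar t₀ t₁ q p) ↔
      ContDiffOn ℝ 2 q (Set.Ioo t₀ t₁) ∧ (∀ t ∈ Set.Ioo t₀ t₁, 0 < stiffness m om U (q t)) ∧
        IsStationary m om U hbar t₀ t₁ q := by
  have hO : IsOpen (stableDomain m om U) := isOpen_stableDomain hU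
  have hA := contDiffOn_effMass hm hom hU hbar
  have hB := contDiffOn_effPotential (m := m) (om := om) hU hbar
  refine (exists_integralCurve_iff hm.ne' hO hA hB
    (fun q hq => (effMass_pos hm hom hh hq).ne') t₀ t₁ q).trans ?_
  refine and_congr_right fun hq => and_congr_right fun hqO => ?_
  rw [← stationary_iff_eulerLagrange hO hA hB hq hqO]
  simp only [IsStationary, effAction, effLagrangian_eq]

end States

/-! ### The limit of vanishing anharmonicity -/

section Vacuum

open Filter

variable {m om : ℝ} {U : ℝ → ℝ}

lemma tendsto_iteratedDeriv_const_mul (U : ℝ → ℝ) (k : ℕ) (q : ℝ) :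
    Tendsto (fun τ : ℝ => iteratedDeriv k (fun y => τ * U y) q) (𝓝 0) (𝓝 0) := by
  simp only [iteratedDeriv_const_mul_field]
  have : ContinuousAt (fun τ : ℝ => τ * iteratedDeriv k U q) 0 := by fun_prop
  simpa using this.tendsto

/-- The stiffness tends to `1`, so each fixed point eventually lies in the domain where the explicit
formulas for the coefficients hold. -/
lemma eventually_mem_stableDomain (m om : ℝ) (U : ℝ → ℝ) (q : ℝ) :
    ∀ᶠ τ in 𝓝 (0 : ℝ), q ∈ stableDomain m om (fun y => τ * U y) := by
  have h : Tendsto (fun τ : ℝ => stiffness m om (fun y => τ * U y) q) (𝓝 0) (𝓝 1) := by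
    simpa [stiffness] using
      ((tendsto_iteratedDeriv_const_mul U 2 q).div_const (m * om ^ 2)).const_add 1
  exact h.eventually (lt_mem_nhds one_pos)

lemma tendsto_freq (hom : 0 < om) (U : ℝ → ℝ) (q : ℝ) :
    Tendsto (fun τ : ℝ => freq m om (fun y => τ * U y) q) (𝓝 0) (𝓝 om) := by
  have h := (((tendsto_iteratedDeriv_const_mul U 2 q).div_const m).const_add (om ^ 2)).sqrt
  simpa [freq, Real.sqrt_sq hom.le] using h

lemma tendsto_freqD (hm : 0 < m) (hom : 0 < om) (U : ℝ → ℝ) (q : ℝ) :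
    Tendsto (fun τ : ℝ => freqD m om (fun y => τ * U y) q) (𝓝 0) (𝓝 0) := by
  have h := (tendsto_iteratedDeriv_const_mul U 3 q).div
    ((tendsto_freq (m := m) hom U q).const_mul (2 * m)) (by positivity)
  rwa [zero_div] at h

lemma tendsto_freqDD (hm : 0 < m) (hom : 0 < om) (U : ℝ → ℝ) (q : ℝ) :
    Tendsto (fun τ : ℝ => freqDD m om (fun y => τ * U y) q) (𝓝 0) (𝓝 0) := by
  have hw := tendsto_freq (m := m) hom U q
  have h1 := (tendsto_iteratedDeriv_const_mul U 4 q).div (hw.const_mul (2 * m)) (by positivity)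
  have h2 := ((tendsto_iteratedDeriv_const_mul U 3 q).mul (tendsto_freqD hm hom U q)).div
    ((hw.pow 2).const_mul (2 * m)) (by positivity)
  simpa [freqDD] using h1.sub h2

lemma tendsto_force (hU : ContDiff ℝ ∞ U) (q : ℝ) :
    Tendsto (fun τ : ℝ => force m om (fun y => τ * U y) q) (𝓝 0) (𝓝 (m * om ^ 2 * q)) := by
  have h := (tendsto_iteratedDeriv_const_mul U 1 q).const_add (m * om ^ 2 * q)
  simp only [iteratedDeriv_one, add_zero] at h
  exact h.congr fun τ => (force_eq (contDiff_const.mul hU) q).symm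

lemma tendsto_transport_variance (hm : 0 < m) (hom : 0 < om) (hU : ContDiff ℝ ∞ U) (x : ℝ × ℝ) :
    Tendsto (fun τ : ℝ => transport m (force m om (fun y => τ * U y))
      (varianceCoeff m (force m om (fun y => τ * U y)) (freq m om (fun y => τ * U y)) 0) x)
      (𝓝 0) (𝓝 0) := by
  have hw := tendsto_freq (m := m) hom U x.1
  have h := (((tendsto_freqD hm hom U x.1).const_mul x.2).div ((hw.pow 2).const_mul (2 * m ^ 2))
    (by positivity)).neg
  simp only [mul_zero, zero_div, neg_zero] at h
  refine h.congr' ?_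
  filter_upwards [eventually_mem_stableDomain m om U x.1] with τ hτ
  exact (transport_varianceCoeff_zero hm hom (contDiff_const.mul hU) hτ).symm

lemma tendsto_transport_transport_variance (hm : 0 < m) (hom : 0 < om) (hU : ContDiff ℝ ∞ U)
    (x : ℝ × ℝ) :
    Tendsto (fun τ : ℝ => transport m (force m om (fun y => τ * U y))
      (transport m (force m om (fun y => τ * U y))
      (varianceCoeff m (force m om (fun y => τ * U y)) (freq m om (fun y => τ * U y)) 0)) x)
      (𝓝 0) (𝓝 0) := by
  have hw := tendsto_freq (m := m) hom U x.1
  have h1 := tendsto_freqD hm hom U x.1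
  have h2 := tendsto_freqDD hm hom U x.1
  have h3 := tendsto_force (m := m) (om := om) hU x.1
  have h := ((((h2.div (hw.pow 2) (by positivity)).sub
    (((h1.pow 2).const_mul 2).div (hw.pow 3) (by positivity))).const_mul
      (x.2 ^ 2 / (2 * m ^ 3))).neg).add ((h3.mul h1).div ((hw.pow 2).const_mul (2 * m ^ 2))
        (by positivity))
  simp only [ne_eq, OfNat.ofNat_ne_zero, not_false_eq_true, zero_pow, mul_zero, zero_div, sub_zero,
    neg_zero, add_zero] at h
  refine h.congr' ?_
  filter_upwards [eventually_mem_stableDomain m om U x.1] with τ hτ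
  exact (transport_transport_varianceCoeff_zero hm hom (contDiff_const.mul hU) hτ).symm

lemma tendsto_varianceCoeff_zero (hm : 0 < m) (hom : 0 < om) (U : ℝ → ℝ) (x : ℝ × ℝ) :
    Tendsto (fun τ : ℝ => varianceCoeff m (force m om (fun y => τ * U y))
      (freq m om (fun y => τ * U y)) 0 x) (𝓝 0) (𝓝 (1 / (2 * (m * om)))) := by
  simp only [varianceCoeff, ← mul_assoc]
  exact tendsto_const_nhds.div ((tendsto_freq hom U x.1).const_mul _) (by positivity)

lemma tendsto_varianceCoeff_two (hm : 0 < m) (hom : 0 < om) (hU : ContDiff ℝ ∞ U) (x : ℝ × ℝ) :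
    Tendsto (fun τ : ℝ => varianceCoeff m (force m om (fun y => τ * U y))
      (freq m om (fun y => τ * U y)) 2 x) (𝓝 0) (𝓝 0) := by
  have hw := tendsto_freq (m := m) hom U x.1
  have h1 := tendsto_freqD hm hom U x.1
  have h2 := tendsto_freqDD hm hom U x.1
  have h3 := tendsto_force (m := m) (om := om) hU x.1
  have h := (((h2.const_mul (x.2 ^ 2)).div ((hw.pow 4).const_mul (8 * m ^ 3))
    (by positivity)).sub (((h1.pow 2).const_mul (3 * x.2 ^ 2)).div
      ((hw.pow 5).const_mul (16 * m ^ 3)) (by positivity))).sub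
    ((h3.mul h1).div ((hw.pow 4).const_mul (8 * m ^ 2)) (by positivity))
  simp only [ne_eq, OfNat.ofNat_ne_zero, not_false_eq_true, zero_pow, mul_zero, zero_div,
    sub_zero] at h
  refine h.congr' ?_
  filter_upwards [eventually_mem_stableDomain m om U x.1] with τ hτ
  exact (varianceCoeff_two hm hom (contDiff_const.mul hU) hτ).symm

lemma varianceSeries_mem_limitRing (hm : 0 < m) (hom : 0 < om) (hU : ContDiff ℝ ∞ U)
    (x : ℝ × ℝ) :
    ((fun τ : ℝ => varianceSeries m (force m om (fun y => τ * U y))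
      (freq m om (fun y => τ * U y)) x, PowerSeries.C (1 / (2 * (m * om)))) :
      (ℝ → PowerSeries ℝ) × PowerSeries ℝ) ∈ limitRing := by
  intro j hj
  simp only [varianceSeries, PowerSeries.coeff_mk, PowerSeries.coeff_C]
  interval_cases j
  · simpa using tendsto_varianceCoeff_zero hm hom U x
  · simp [varianceCoeff]
  · simpa using tendsto_varianceCoeff_two hm hom hU x

lemma correlationSeries_mem_limitRing (hm : 0 < m) (hom : 0 < om) (hU : ContDiff ℝ ∞ U)
    (x : ℝ × ℝ) :
    ((fun τ : ℝ => correlationSeries m (force m om (fun y => τ * U y))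
      (freq m om (fun y => τ * U y)) x, 0) : (ℝ → PowerSeries ℝ) × PowerSeries ℝ) ∈
      limitRing := by
  intro j hj
  rw [map_zero]
  interval_cases j
  · simp [correlationSeries]
  · simp only [correlationSeries_coeff_succ]
    simpa using (tendsto_transport_variance hm hom hU x).const_mul (m / 2)
  · simp only [correlationSeries_coeff_succ]
    simp [varianceCoeff, transport]

/-- Zeroth order gives `m²ω²/(2mω) = mω/2`. Up to second order only the first two derivatives of the
leading variance along the flow occur, and they vanish in the limit together with `w'` and `w''`. -/
lemma momentumSeries_mem_limitRing (hm : 0 < m) (hom : 0 < om) (hU : ContDiff ℝ ∞ U)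
    (x : ℝ × ℝ) :
    ((fun τ : ℝ => momentumSeries m (force m om (fun y => τ * U y))
      (freq m om (fun y => τ * U y)) x, PowerSeries.C (m * om / 2)) :
      (ℝ → PowerSeries ℝ) × PowerSeries ℝ) ∈ limitRing := by
  have hV : ((fun τ : ℝ => PowerSeries.C (m ^ 2 * freq m om (fun y => τ * U y) x.1 ^ 2),
      PowerSeries.C (m ^ 2 * om ^ 2)) : (ℝ → PowerSeries ℝ) × PowerSeries ℝ) ∈ limitRing := by
    intro j _
    simp only [PowerSeries.coeff_C]
    split_ifs
    · exact ((tendsto_freq hom U x.1).pow 2).const_mul _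
    · exact tendsto_const_nhds
  have hD : ((fun τ : ℝ => PowerSeries.C m * (PowerSeries.X *
      transportSeries m (force m om (fun y => τ * U y)) (correlationSeries m
        (force m om (fun y => τ * U y)) (freq m om (fun y => τ * U y))) x), 0) :
      (ℝ → PowerSeries ℝ) × PowerSeries ℝ) ∈ limitRing := by
    intro j hj
    rw [map_zero]
    interval_cases j
    · simp
    · simp [PowerSeries.coeff_succ_X_mul, transportSeries, correlationSeries, transport]
    · have h := (tendsto_transport_transport_variance hm hom hU x).const_mul (m * (m / 2))
      rw [mul_zero] at h
      refine h.congr' ?_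
      filter_upwards [eventually_mem_stableDomain m om U x.1] with τ hτ
      have hf := isFrequency_freq hm hom (U := fun y => τ * U y) (contDiff_const.mul hU)
      have hd : DifferentiableAt ℝ (transport m (force m om (fun y => τ * U y))
          (varianceCoeff m (force m om (fun y => τ * U y)) (freq m om (fun y => τ * U y)) 0)) x :=
        differentiableAt_of_mem hf.isOpen_preimage ((contDiffOn_varianceCoeff hf 0).transport
          hf.isOpen_preimage hf.contDiff_force) hτ
      rw [PowerSeries.coeff_C_mul, PowerSeries.coeff_succ_X_mul, transportSeries,
        PowerSeries.coeff_mk]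
      rw [funext fun y => correlationSeries_coeff_succ 0 y, transport, transport, fderiv_const_mul hd]
      simp
      ring
  have h := limitRing.add_mem hD (limitRing.mul_mem hV (varianceSeries_mem_limitRing hm hom hU x))
  convert h using 1
  refine Prod.ext rfl ?_
  simp only [Prod.snd_add, Prod.snd_mul, zero_add, ← map_mul]
  congr 1
  field_simp

theorem tendsto_oscillatorSystem_G (hm : 0 < m) (hom : 0 < om) (hU : ContDiff ℝ ∞ U) (x : ℝ × ℝ)
    (b a j N : ℕ) (hj : j ≤ 2) :
    Tendsto (fun τ : ℝ => cf j N ((oscillatorSystem m om (fun y => τ * U y)).G x b a)) (𝓝 0)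
      (𝓝 (if j = 0 ∧ N = b + a then vacuumMoment m om b a else 0)) := by
  simp only [oscillatorSystem, cf_homogeneous]
  by_cases hN : N = b + a
  · have key := gaussMoment_mem _ _ _ limitRing (varianceSeries_mem_limitRing hm hom hU x)
      (correlationSeries_mem_limitRing hm hom hU x) (momentumSeries_mem_limitRing hm hom hU x) b a
      j hj
    simp only [gaussMoment_fst, gaussMoment_snd, gaussMoment_apply] at key
    rw [← map_zero (PowerSeries.C (R := ℝ)), ← map_gaussMoment, PowerSeries.coeff_C,
      gaussMoment_vacuum (mul_pos hm hom)] at key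
    simp only [hN, if_true, and_true]
    exact key
  · simp [hN]

end Vacuum

end AnharmonicEff

end

theorem theorem2 (m om : ℝ) (hm : 0 < m) (hom : 0 < om) :
    ∃ S : (ℝ → ℝ) → AnharmonicEff.EffectiveData,
      ∀ U : ℝ → ℝ, ContDiff ℝ ∞ U →
        AnharmonicEff.IsAdiabaticEffectiveSystem 2 1 (AnharmonicEff.hamiltonian m om U) (S U) ∧
        (S U).M = {x : ℝ × ℝ | 0 < AnharmonicEff.stiffness m om U x.1} ∧
        -- the integration constants are fixed by the vacuum in the limit `U → 0`
        (∀ (x : ℝ × ℝ) (b a j N : ℕ), j ≤ 2 →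
          Filter.Tendsto
            (fun τ : ℝ => AnharmonicEff.cf j N ((S (fun y => τ * U y)).G x b a)) (𝓝 0)
            (𝓝 (if j = 0 ∧ N = b + a then AnharmonicEff.vacuumMoment m om b a else 0))) ∧
        -- the motions of the effective system are the stationary curves of the effective action
        (∀ hbar > 0, ∀ (t₀ t₁ : ℝ) (q : ℝ → ℝ), t₀ < t₁ →
          ((∃ p : ℝ → ℝ, AnharmonicEff.IsEffectiveMotion (S U) hbar t₀ t₁ q p) ↔
            (ContDiffOn ℝ 2 q (Set.Ioo t₀ t₁) ∧
              (∀ t ∈ Set.Ioo t₀ t₁, 0 < AnharmonicEff.stiffness m om U (q t)) ∧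
              AnharmonicEff.IsStationary m om U hbar t₀ t₁ q))) :=
  ⟨AnharmonicEff.oscillatorSystem m om, fun _ hU =>
    ⟨AnharmonicEff.isAdiabaticEffectiveSystem_oscillator hm hom hU, rfl,
      AnharmonicEff.tendsto_oscillatorSystem_G hm hom hU,
      fun _ hh t₀ t₁ q _ => AnharmonicEff.isEffectiveMotion_oscillator_iff hm hom hU hh t₀ t₁ q⟩⟩
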